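/- Let $D=\{|\xi|<1\}$. A family $f(\xi,t)$ is a \emph{strong solution on $[0,b)$ of the suction equation} if for every $T\in[0,b)$ there is $r>1$ such that, for $t\in[0,T]$, $f(\cdot,t)$ is analytic and univalent in $\{|\xi|<r\}$ and $f$ is continuously differentiable in $t$ as a function with values in the analytic functions on $\{|\xi|<r\}$; and if, for $0\le t<b$, $f(0,t)=0$, $f'(0,t)>0$ and $$\operatorname{Re}\bigl[f_t(\xi,t)\,\overline{f'(\xi,t)\,\xi}\bigr]=-1,\qquad |\xi|=1,$$ where $f_t=\partial f/\partial t$ and $f'=\partial f/\partial\xi$. It is \emph{the strong solution with initial function $f_0$, with blow-up time $b$}, if $f(\cdot,0)=f_0$ on $D$ and every strong solution $g$ on some $[0,b')$ with $g(\cdot,0)=f_0$ on $D$ satisfies $b'\le b$ and $g=f$ on $\overline D\times[0,b')$. For $v=\sum_{j\ge1}v_j\xi^j$ and $\rho>1$ put $\|v\|_{\rho,1}=\sum_{j\ge1}|v_j|\rho^j j^{3/2}$. Then: (1) The strong solution with initial function $\xi$ is $f_1(\xi,t)=\sqrt{1-2t}\,\xi$, with blow-up time $1/2$. The area of $f_1(D,t)$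 is $\pi(1-2t)$ for $0\le t\le 1/2$; in particular the fluid is completely sucked out at $t=1/2$. (2) For every $T_0<1/2$ there are $\rho>1$ and $\delta>0$ such that, for every $f_0$ analytic in $D$ with $f_0(0)=0$, $f_0'(0)>0$ and $\|f_0-\xi\|_{\rho,1}<\delta$, the strong solution with initial function $f_0$ exists and its blow-up time is greater than $T_0$ (so it exists for $0\le t\le T_0$). (3) If the initial domain is close to the unit disk, then most of the fluid is sucked out before blow-up: for every $\varepsilon>0$ there are $\rho>1$ and $\delta>0$ such that, for every $f_0$ analytic in $D$ with $f_0(0)=0$, $f_0'(0)>0$ and $\|f_0-\xi\|_{\rho,1}<\delta$, the strong solution $f$ with initial function $f_0$ exists, with some blow-up time $b$, and at some time $T\in(0,b)$ the area of $f(D,T)$ is at most $\varepsilon$ times the area of $f(D,0)$. -/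

import Mathlib

open Set Metric MeasureTheory Filter Topology

/-- The time derivative `f_t(ξ,t)` of a family `f t ξ`, on the time interval `[0,b)`
(one-sided at `t = 0`). -/
noncomputable def timeDeriv (b : ℝ) (f : ℝ → ℂ → ℂ) (t : ℝ) (ξ : ℂ) : ℂ :=
  derivWithin (fun s => f s ξ) (Ico 0 b) t

/-- `f t ξ = f(ξ,t)` is a strong solution on `[0,b)` of the Polubarinova-Galin equation with
suction, `Re [f_t * conj (f' ξ)] = -1` on the unit circle.  On every compact time interval
`[0,T]` with `T < b` the maps `f(·,t)` are analytic and univalent on a common neighbourhood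
`|ξ| < r`, `r > 1`, of the closed unit disk, and `t ↦ f(·,t)` is `C¹` with values in the analytic
functions on `|ξ| < r` (that is, `f` and `f_t` exist and are jointly continuous). -/
structure IsStrongSuctionSolution (b : ℝ) (f : ℝ → ℂ → ℂ) : Prop where
  regular : ∀ T : ℝ, 0 ≤ T → T < b → ∃ r : ℝ, 1 < r ∧
    (∀ t ∈ Icc 0 T, DifferentiableOn ℂ (f t) (ball 0 r) ∧ InjOn (f t) (ball 0 r)) ∧
    (∀ t ∈ Icc 0 T, ∀ ξ ∈ ball (0 : ℂ) r,
      DifferentiableWithinAt ℝ (fun s => f s ξ) (Ico 0 b) t) ∧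
    ContinuousOn (fun p : ℝ × ℂ => f p.1 p.2) (Icc 0 T ×ˢ ball 0 r) ∧
    ContinuousOn (fun p : ℝ × ℂ => timeDeriv b f p.1 p.2) (Icc 0 T ×ˢ ball 0 r)
  map_zero : ∀ t ∈ Ico 0 b, f t 0 = 0
  deriv_zero_pos : ∀ t ∈ Ico 0 b, 0 < (deriv (f t) 0).re ∧ (deriv (f t) 0).im = 0
  equation : ∀ t ∈ Ico 0 b, ∀ ξ : ℂ, ‖ξ‖ = 1 →
    (timeDeriv b f t ξ * (starRingEnd ℂ) (deriv (f t) ξ * ξ)).re = -1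

/-- `f` on `[0,b)` is the strong solution of the suction equation with initial function `f₀`,
and it blows up at time `b`: it starts from `f₀`, and every strong solution `g` on some `[0,b')`
starting from `f₀` has `b' ≤ b` and coincides with `f` on `[0,b')`. -/
structure IsMaximalStrongSuctionSolution (f₀ : ℂ → ℂ) (b : ℝ) (f : ℝ → ℂ → ℂ) : Prop where
  strong : IsStrongSuctionSolution b f
  initial : EqOn (f 0) f₀ (ball 0 1)
  maximal : ∀ (b' : ℝ) (g : ℝ → ℂ → ℂ), IsStrongSuctionSolution b' g →
    EqOn (g 0) f₀ (ball 0 1) →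
      b' ≤ b ∧ ∀ t ∈ Ico 0 b', EqOn (g t) (f t) (closedBall 0 1)

/-- The `j`-th Taylor coefficient of `v` at the origin. -/
noncomputable def taylorCoeffZero (v : ℂ → ℂ) (j : ℕ) : ℂ :=
  iteratedDeriv j v 0 / (j.factorial : ℂ)

/-- The norm `‖v‖_{ρ,n} = ∑_{j ≥ 1} |v_j| ρ^j j^(1/2 + n)` of `v = ∑_{j ≥ 1} v_j ξ^j`, with value
`∞` when the series diverges. -/
noncomputable def perturbationNorm (ρ : ℝ) (n : ℕ) (v : ℂ → ℂ) : ENNReal :=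
  ∑' j : ℕ, ENNReal.ofReal
    (‖taylorCoeffZero v (j + 1)‖ * ρ ^ (j + 1) * ((j + 1 : ℕ) : ℝ) ^ ((1 / 2 : ℝ) + (n : ℝ)))

/-- The initial functions admitted: `f₀` is analytic in the unit disk, `f₀(0) = 0`,
`f₀'(0) > 0` and `‖f₀ - ξ‖_{ρ,1} < δ`. -/
structure IsCloseToDisk (ρ δ : ℝ) (f₀ : ℂ → ℂ) : Prop where
  analytic : DifferentiableOn ℂ f₀ (ball 0 1)
  map_zero : f₀ 0 = 0
  deriv_zero_pos : 0 < (deriv f₀ 0).re ∧ (deriv f₀ 0).im = 0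
  close : perturbationNorm ρ 1 (fun ξ => f₀ ξ - ξ) < ENNReal.ofReal δ

/-- The shrinking disk `f₁(ξ,t) = √(1 - 2t) ξ`. -/
noncomputable def diskSolution (t : ℝ) (ξ : ℂ) : ℂ := ((Real.sqrt (1 - 2 * t) : ℝ) : ℂ) * ξ

/-! ### Taylor coefficients at the origin -/

/-! Put h = 1/f'. The boundary equation says that f_t = -ξ f' p, where p is analytic across the unit
circle, Re p = |h|² there, and p(0) is real. Differentiating in ξ eliminates f and leaves h_t = h
(ξp)' - ξ p h'. The Taylor coefficients of p are correlations of those of h (`hermProj`), so this is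
a cubic system for the coefficients of h (`cubicForm`) that loses exactly one derivative.

The loss is absorbed as in the abstract Cauchy-Kovalevskaya theorem. Coefficients are measured by
weights 1/((n+1)² ρⁿ), for which convolutions and correlations are bounded, and the radius ρ shrinks
exponentially in time. The weight of index n then grows at a rate proportional to n, so a time
integration returns the factor n that the derivative costs. This is used twice. For two strong
solutions, f_t - g_t is controlled by ξ(f - g)', and iterating the estimate forces f = g
(`RegularSuctionFlow.exists_diff_bound`, `RegularSuctionFlow.exists_uniqueness_step`). For
existence, Picard iteration contracts a small ball around the disk solution h = 1/√(1-2t) on any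
[0,T] with T < 1/2, provided the initial h is close enough to 1 on a large disk
(`exists_coefficient_flow`). Then f is recovered by integrating -ξ p/h in time; Re h > 0 makes it
univalent (`CoefficientFlow.isStrongSuctionSolution_flowMap`).

The blow-up time is finite: p(0) is the mean of |h|² over the circle and is at least h(0)², so a =
f'(0,t) satisfies a a' ≤ -1 and every strong solution ends by a(0)²/2
(`IsStrongSuctionSolution.blowup_time_le`). With uniqueness this allows all solutions from f₀ to be
glued into a maximal one (`IsStrongSuctionSolution.exists_maximal`), and for the disk the bound 1/2
is attained.

For the last claim, closeness of h to the disk gives |f'| ≤ 2√(1-2t) on the closed disk. Hence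
f(D,t) lies in a disk of radius 2√(1-2t), whereas the initial domain contains a fixed disk of radius
1/8 (`exists_strongSuctionSolution`). Taking t near 1/2 makes the ratio of areas as small as
desired. -/

theorem hasSum_taylorCoeffZero {f : ℂ → ℂ} {r : ℝ} (hf : DifferentiableOn ℂ f (ball 0 r)) {z : ℂ}
    (hz : z ∈ ball (0 : ℂ) r) : HasSum (fun n => taylorCoeffZero f n * z ^ n) (f z) := by
  have h := Complex.hasSum_taylorSeries_on_ball hf hz
  have e : (fun n : ℕ => taylorCoeffZero f n * z ^ n) =
      fun n : ℕ => (n.factorial : ℂ)⁻¹ • (z - 0) ^ n • iteratedDeriv n f 0 := by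
    ext n
    simp only [taylorCoeffZero, sub_zero, smul_eq_mul]
    ring
  rwa [e]

theorem norm_taylorCoeffZero_le {f : ℂ → ℂ} {r R M : ℝ} (hf : DifferentiableOn ℂ f (ball 0 r))
    (hR : 0 < R) (hRr : R < r) (hM : ∀ z ∈ closedBall (0 : ℂ) R, ‖f z‖ ≤ M) (n : ℕ) :
    ‖taylorCoeffZero f n‖ ≤ M / R ^ n := by
  have hd : DiffContOnCl ℂ f (ball 0 R) :=
    (hf.mono (by rw [closure_ball _ hR.ne']; exact closedBall_subset_ball hRr)).diffContOnCl
  have h := Complex.norm_iteratedDeriv_le_of_forall_mem_sphere_norm_le n hR hd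
    (fun z hz => hM z (sphere_subset_closedBall hz))
  have hn : (0 : ℝ) < n.factorial := by positivity
  rw [taylorCoeffZero, norm_div, Complex.norm_natCast, div_le_iff₀ hn]
  calc _ ≤ _ := h
    _ = _ := by ring

theorem taylorCoeffZero_eq_of_hasSum {f : ℂ → ℂ} {a : ℕ → ℂ} {r : ℝ} (hr : 0 < r)
    (h : ∀ z ∈ ball (0 : ℂ) r, HasSum (fun n => a n * z ^ n) (f z)) : taylorCoeffZero f = a := by
  -- The radius r/2 is chosen because the absolutely convergent series at the interior point r/2
  -- bounds the coefficients.
  have hp : HasFPowerSeriesOnBall f (FormalMultilinearSeries.ofScalars ℂ a) 0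
      (ENNReal.ofReal (r / 2)) := by
    refine ⟨?_, by simpa using hr, ?_⟩
    · have hs : Summable fun n => a n * ((r / 2 : ℝ) : ℂ) ^ n :=
        (h _ (by simp [abs_of_pos hr]; linarith)).summable
      have := hs.norm
      rw [ENNReal.ofReal]
      refine FormalMultilinearSeries.le_radius_of_bound _
        (∑' n, ‖a n * ((r / 2 : ℝ) : ℂ) ^ n‖) fun n => ?_
      refine le_trans (le_of_eq ?_) (this.le_tsum n fun _ _ => norm_nonneg _)
      rw [FormalMultilinearSeries.ofScalars_norm, norm_mul, norm_pow, Complex.norm_real,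
        Real.norm_of_nonneg (by positivity), Real.coe_toNNReal _ (by positivity)]
    · intro y hy
      rw [eball_ofReal] at hy
      have := h y (ball_subset_ball (by linarith) hy)
      simpa [FormalMultilinearSeries.ofScalars_apply_eq, mul_comm] using this
  have ha : AnalyticAt ℂ f 0 := ⟨_, hp.hasFPowerSeriesAt⟩
  have := ha.hasFPowerSeriesAt.eq_formalMultilinearSeries hp.hasFPowerSeriesAt
  exact FormalMultilinearSeries.ofScalars_series_injective ℂ ℂ this

theorem taylorCoeffZero_congr {f g : ℂ → ℂ} {r : ℝ} (hr : 0 < r)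
    (hf : DifferentiableOn ℂ f (ball 0 r)) (h : EqOn f g (ball 0 r)) :
    taylorCoeffZero f = taylorCoeffZero g :=
  (taylorCoeffZero_eq_of_hasSum hr fun _ hz => h hz ▸ hasSum_taylorCoeffZero hf hz).symm

@[simp] theorem taylorCoeffZero_zero (f : ℂ → ℂ) : taylorCoeffZero f 0 = f 0 := by
  simp [taylorCoeffZero]

@[simp] theorem taylorCoeffZero_one (f : ℂ → ℂ) : taylorCoeffZero f 1 = deriv f 0 := by
  simp [taylorCoeffZero]

theorem taylorCoeffZero_sub {f g : ℂ → ℂ} {r : ℝ} (hr : 0 < r)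
    (hf : DifferentiableOn ℂ f (ball 0 r)) (hg : DifferentiableOn ℂ g (ball 0 r)) (n : ℕ) :
    taylorCoeffZero (fun z => f z - g z) n = taylorCoeffZero f n - taylorCoeffZero g n := by
  refine congrFun (taylorCoeffZero_eq_of_hasSum hr (a := fun n => _ - _) fun z hz => ?_) n
  simpa only [sub_mul] using (hasSum_taylorCoeffZero hf hz).sub (hasSum_taylorCoeffZero hg hz)

theorem taylorCoeffZero_const_mul {f : ℂ → ℂ} {r : ℝ} (hr : 0 < r) (c : ℂ)
    (hf : DifferentiableOn ℂ f (ball 0 r)) (n : ℕ) :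
    taylorCoeffZero (fun z => c * f z) n = c * taylorCoeffZero f n := by
  refine congrFun (taylorCoeffZero_eq_of_hasSum hr (a := fun n => c * _) fun z hz => ?_) n
  simpa only [mul_assoc] using (hasSum_taylorCoeffZero hf hz).mul_left c

theorem taylorCoeffZero_deriv (f : ℂ → ℂ) (n : ℕ) :
    taylorCoeffZero (deriv f) n = (n + 1) * taylorCoeffZero f (n + 1) := by
  have : (n.factorial : ℂ) ≠ 0 := by exact_mod_cast n.factorial_ne_zero
  have h2 : (n : ℂ) + 1 ≠ 0 := by exact_mod_cast n.succ_ne_zero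
  rw [taylorCoeffZero, taylorCoeffZero, iteratedDeriv_succ', Nat.factorial_succ]
  push_cast
  field_simp

theorem taylorCoeffZero_id_mul {f : ℂ → ℂ} {r : ℝ} (hr : 0 < r)
    (hf : DifferentiableOn ℂ f (ball 0 r)) (n : ℕ) :
    taylorCoeffZero (fun z => z * f z) (n + 1) = taylorCoeffZero f n := by
  refine congrFun (taylorCoeffZero_eq_of_hasSum hr
    (a := fun n => Nat.casesOn n 0 (taylorCoeffZero f)) fun z hz => ?_) (n + 1)
  rw [hasSum_nat_add_iff' 1 |>.symm]
  simpa [pow_succ', mul_left_comm] using (hasSum_taylorCoeffZero hf hz).mul_left z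

theorem taylorCoeffZero_id_mul_deriv {f : ℂ → ℂ} {r : ℝ} (hr : 0 < r)
    (hf : DifferentiableOn ℂ f (ball 0 r)) (n : ℕ) :
    taylorCoeffZero (fun z => z * deriv f z) n = n * taylorCoeffZero f n := by
  cases n with
  | zero => simp
  | succ n =>
    rw [taylorCoeffZero_id_mul hr (hf.deriv isOpen_ball), taylorCoeffZero_deriv]
    push_cast; ring

theorem taylorCoeffZero_mul {f g : ℂ → ℂ} {r : ℝ} (hr : 0 < r)
    (hf : DifferentiableOn ℂ f (ball 0 r)) (hg : DifferentiableOn ℂ g (ball 0 r)) (n : ℕ) :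
    taylorCoeffZero (fun z => f z * g z) n =
      ∑ p ∈ Finset.HasAntidiagonal.antidiagonal n, taylorCoeffZero f p.1 * taylorCoeffZero g p.2 := by
  refine congrFun (taylorCoeffZero_eq_of_hasSum hr
    (a := fun n => ∑ p ∈ Finset.HasAntidiagonal.antidiagonal n, taylorCoeffZero f p.1 * taylorCoeffZero g p.2)
    fun z hz => ?_) n
  have h1 := hasSum_taylorCoeffZero hf hz
  have h2 := hasSum_taylorCoeffZero hg hz
  have h3 := tsum_mul_tsum_eq_tsum_sum_antidiagonal_of_summable_norm h1.summable.norm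
    h2.summable.norm
  have h4 := (summable_norm_sum_mul_antidiagonal_of_summable_norm h1.summable.norm
    h2.summable.norm).of_norm
  rw [h1.tsum_eq, h2.tsum_eq] at h3
  have e : (fun n => (∑ p ∈ Finset.HasAntidiagonal.antidiagonal n,
      taylorCoeffZero f p.1 * taylorCoeffZero g p.2) * z ^ n) =
      fun n => ∑ p ∈ Finset.HasAntidiagonal.antidiagonal n,
        taylorCoeffZero f p.1 * z ^ p.1 * (taylorCoeffZero g p.2 * z ^ p.2) := by
    ext n
    rw [Finset.sum_mul]
    refine Finset.sum_congr rfl fun p hp => ?_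
    rw [← Finset.HasAntidiagonal.mem_antidiagonal.1 hp]
    ring
  rw [h3, e]
  exact h4.hasSum

/-! ### Weighted sequences -/

/-- The weight `((n + 1)² ρⁿ)⁻¹`. -/
noncomputable def seqWeight (ρ : ℝ) (n : ℕ) : ℝ := (((n : ℝ) + 1) ^ 2 * ρ ^ n)⁻¹

/-- The sequence `a` is bounded by `κ` times the weight of radius `ρ`. -/
def Dominated (ρ κ : ℝ) (a : ℕ → ℂ) : Prop := ∀ n, ‖a n‖ ≤ κ * seqWeight ρ n

theorem seqWeight_pos {ρ : ℝ} (hρ : 0 < ρ) (n : ℕ) : 0 < seqWeight ρ n := by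
  unfold seqWeight; positivity

theorem seqWeight_zero (ρ : ℝ) : seqWeight ρ 0 = 1 := by simp [seqWeight]

theorem seqWeight_add_le {ρ : ℝ} (hρ : 1 ≤ ρ) (l k : ℕ) : seqWeight ρ (l + k) ≤ seqWeight ρ k := by
  unfold seqWeight
  have : 0 < ρ := by linarith
  gcongr
  · linarith [Nat.cast_nonneg (α := ℝ) l]
  · exact Nat.le_add_left k l

theorem seqWeight_le {ρ : ℝ} (hρ : 1 ≤ ρ) (l : ℕ) : seqWeight ρ l ≤ (((l : ℝ) + 1) ^ 2)⁻¹ := by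
  unfold seqWeight
  gcongr
  exact le_mul_of_one_le_right (by positivity) (one_le_pow₀ hρ)

theorem seqWeight_antitone {ρ ρ' : ℝ} (hρ : 0 < ρ) (h : ρ ≤ ρ') (n : ℕ) :
    seqWeight ρ' n ≤ seqWeight ρ n := by
  unfold seqWeight
  gcongr

theorem sum_range_inv_succ_sq_le (N : ℕ) :
    ∑ i ∈ Finset.range (N + 1), (((i : ℝ) + 1) ^ 2)⁻¹ ≤ 2 - 1 / ((N : ℝ) + 1) := by
  induction N with
  | zero => norm_num
  | succ N ih =>
    rw [Finset.sum_range_succ]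
    have h : (((N : ℝ) + 1 + 1) ^ 2)⁻¹ ≤ 1 / ((N : ℝ) + 1) - 1 / ((N : ℝ) + 1 + 1) := by
      rw [div_sub_div _ _ (by positivity) (by positivity), ← one_div,
        div_le_div_iff₀ (by positivity) (by positivity)]
      nlinarith [Nat.cast_nonneg (α := ℝ) N]
    push_cast
    linarith

theorem sum_range_inv_succ_sq_le_two (N : ℕ) :
    ∑ i ∈ Finset.range N, (((i : ℝ) + 1) ^ 2)⁻¹ ≤ 2 := by
  refine (Finset.sum_le_sum_of_subset_of_nonneg
    (Finset.range_mono N.le_succ) fun _ _ _ => by positivity).trans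
    ((sum_range_inv_succ_sq_le N).trans ?_)
  have : (0 : ℝ) ≤ 1 / ((N : ℝ) + 1) := by positivity
  linarith

theorem summable_inv_succ_sq : Summable fun i : ℕ => (((i : ℝ) + 1) ^ 2)⁻¹ :=
  summable_of_sum_range_le (fun _ => by positivity) sum_range_inv_succ_sq_le_two

theorem tsum_inv_succ_sq_le_two : ∑' i : ℕ, (((i : ℝ) + 1) ^ 2)⁻¹ ≤ 2 :=
  Real.tsum_le_of_sum_range_le (fun _ => by positivity) sum_range_inv_succ_sq_le_two

/-- For p + q = n one has (n+1)² ≤ 2((p+1)² + (q+1)²), so each product of weights is at most 2 ·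
`seqWeight ρ n` times a sum of two inverse squares, each summing to at most 2; hence 8 = 2·(2+2).
This makes the weighted sequences a convolution algebra. -/
theorem sum_antidiagonal_seqWeight_le {ρ : ℝ} (hρ : 0 < ρ) (n : ℕ) :
    ∑ p ∈ Finset.HasAntidiagonal.antidiagonal n, seqWeight ρ p.1 * seqWeight ρ p.2 ≤ 8 * seqWeight ρ n := by
  have h : ∀ p ∈ Finset.HasAntidiagonal.antidiagonal n, seqWeight ρ p.1 * seqWeight ρ p.2 ≤
      (2 * seqWeight ρ n) * ((((p.1 : ℝ) + 1) ^ 2)⁻¹ + (((p.2 : ℝ) + 1) ^ 2)⁻¹) := by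
    intro p hp
    rw [← Finset.HasAntidiagonal.mem_antidiagonal.1 hp]
    unfold seqWeight
    have h1 : (0 : ℝ) ≤ p.1 := Nat.cast_nonneg _
    have h2 : (0 : ℝ) ≤ p.2 := Nat.cast_nonneg _
    rw [pow_add]
    have : (((p.1 : ℝ) + 1) ^ 2)⁻¹ + (((p.2 : ℝ) + 1) ^ 2)⁻¹ =
      (((p.1 : ℝ) + 1) ^ 2 + ((p.2 : ℝ) + 1) ^ 2) /
        (((p.1 : ℝ) + 1) ^ 2 * ((p.2 : ℝ) + 1) ^ 2) := by field_simp; ring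
    rw [this, ← mul_inv, ← div_eq_mul_inv, div_mul_div_comm, inv_eq_one_div,
      div_le_div_iff₀ (by positivity) (by positivity)]
    have h3 : (((p.1 + p.2 : ℕ) : ℝ) + 1) ^ 2 ≤
        2 * (((p.1 : ℝ) + 1) ^ 2 + ((p.2 : ℝ) + 1) ^ 2) := by
      push_cast
      nlinarith [sq_nonneg ((p.1 : ℝ) - p.2)]
    have h4 : 0 ≤ ρ ^ p.1 * ρ ^ p.2 * (((p.1 : ℝ) + 1) ^ 2 * ((p.2 : ℝ) + 1) ^ 2) := by positivity
    nlinarith [mul_le_mul_of_nonneg_left h3 h4]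
  refine (Finset.sum_le_sum h).trans ?_
  rw [← Finset.mul_sum, Finset.sum_add_distrib]
  have e1 : ∑ p ∈ Finset.HasAntidiagonal.antidiagonal n, (((p.1 : ℝ) + 1) ^ 2)⁻¹ ≤ 2 := by
    rw [Finset.Nat.sum_antidiagonal_eq_sum_range_succ_mk]
    exact sum_range_inv_succ_sq_le_two _
  have e2 : ∑ p ∈ Finset.HasAntidiagonal.antidiagonal n, (((p.2 : ℝ) + 1) ^ 2)⁻¹ ≤ 2 := by
    rw [← Finset.Nat.sum_antidiagonal_swap] at e1
    exact e1
  nlinarith [seqWeight_pos hρ n]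

theorem Dominated.nonneg {ρ κ : ℝ} {a : ℕ → ℂ} (h : Dominated ρ κ a) : 0 ≤ κ := by
  have := h 0
  rw [seqWeight_zero, mul_one] at this
  exact (norm_nonneg _).trans this

theorem Dominated.mono {ρ κ κ' : ℝ} {a : ℕ → ℂ} (hρ : 0 < ρ) (h : Dominated ρ κ a) (hk : κ ≤ κ') :
    Dominated ρ κ' a :=
  fun n => (h n).trans (mul_le_mul_of_nonneg_right hk (seqWeight_pos hρ n).le)

theorem Dominated.add {ρ κ κ' : ℝ} {a b : ℕ → ℂ} (ha : Dominated ρ κ a) (hb : Dominated ρ κ' b) :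
    Dominated ρ (κ + κ') (a + b) :=
  fun n => (norm_add_le _ _).trans (by rw [add_mul]; exact add_le_add (ha n) (hb n))

theorem Dominated.sum_antidiagonal {ρ κ κ' : ℝ} {a b : ℕ → ℂ} (hρ : 0 < ρ) (ha : Dominated ρ κ a)
    (hb : Dominated ρ κ' b) (n : ℕ) :
    ∑ p ∈ Finset.HasAntidiagonal.antidiagonal n, ‖a p.1‖ * ‖b p.2‖ ≤ 8 * κ * κ' * seqWeight ρ n := by
  calc _ ≤ ∑ p ∈ Finset.HasAntidiagonal.antidiagonal n,
        (κ * κ') * (seqWeight ρ p.1 * seqWeight ρ p.2) := by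
        refine Finset.sum_le_sum fun p _ => ?_
        calc _ ≤ (κ * seqWeight ρ p.1) * (κ' * seqWeight ρ p.2) :=
              mul_le_mul (ha _) (hb _) (norm_nonneg _)
                (mul_nonneg ha.nonneg (seqWeight_pos hρ _).le)
          _ = _ := by ring
    _ ≤ (κ * κ') * (8 * seqWeight ρ n) := by
        rw [← Finset.mul_sum]
        exact mul_le_mul_of_nonneg_left (sum_antidiagonal_seqWeight_le hρ n)
          (mul_nonneg ha.nonneg hb.nonneg)
    _ = _ := by ring

theorem Dominated.conv {ρ κ κ' : ℝ} {a b : ℕ → ℂ} (hρ : 0 < ρ) (ha : Dominated ρ κ a)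
    (hb : Dominated ρ κ' b) :
    Dominated ρ (8 * κ * κ') fun n => ∑ p ∈ Finset.HasAntidiagonal.antidiagonal n, a p.1 * b p.2 := fun n =>
  (norm_sum_le _ _).trans (by simpa only [norm_mul] using ha.sum_antidiagonal hρ hb n)

/-! ### Power series with dominated coefficients -/

/-- The sum of the power series with coefficients `a`. -/
noncomputable def powerSum (a : ℕ → ℂ) (z : ℂ) : ℂ := ∑' n, a n * z ^ n

theorem powerSum_at_zero (a : ℕ → ℂ) : powerSum a 0 = a 0 := by
  rw [powerSum, tsum_eq_single 0 (fun n hn => by simp [hn])]; simp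

theorem Dominated.norm_term_le {ρ κ : ℝ} {a : ℕ → ℂ} (hρ : 0 < ρ) (h : Dominated ρ κ a) {z : ℂ}
    (hz : ‖z‖ ≤ ρ) (n : ℕ) : ‖a n * z ^ n‖ ≤ κ * (((n : ℝ) + 1) ^ 2)⁻¹ := by
  rw [norm_mul, norm_pow]
  calc _ ≤ (κ * seqWeight ρ n) * ρ ^ n :=
        mul_le_mul (h n) (pow_le_pow_left₀ (norm_nonneg _) hz n) (by positivity)
          (mul_nonneg h.nonneg (seqWeight_pos hρ n).le)
    _ = _ := by rw [seqWeight]; field_simp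

theorem Dominated.hasSum {ρ κ : ℝ} {a : ℕ → ℂ} (hρ : 0 < ρ) (h : Dominated ρ κ a) {z : ℂ}
    (hz : ‖z‖ ≤ ρ) : HasSum (fun n => a n * z ^ n) (powerSum a z) :=
  (Summable.of_norm_bounded (summable_inv_succ_sq.mul_left κ) (h.norm_term_le hρ hz)).hasSum

theorem Dominated.norm_powerSum_le {ρ κ : ℝ} {a : ℕ → ℂ} (hρ : 0 < ρ) (h : Dominated ρ κ a) {z : ℂ}
    (hz : ‖z‖ ≤ ρ) : ‖powerSum a z‖ ≤ 2 * κ := by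
  refine (tsum_of_norm_bounded (summable_inv_succ_sq.mul_left κ).hasSum
    (h.norm_term_le hρ hz)).trans ?_
  rw [tsum_mul_left]
  nlinarith [tsum_inv_succ_sq_le_two, h.nonneg]

theorem Dominated.differentiableOn_powerSum {ρ κ : ℝ} {a : ℕ → ℂ} (hρ : 0 < ρ)
    (h : Dominated ρ κ a) : DifferentiableOn ℂ (powerSum a) (ball 0 ρ) :=
  Complex.differentiableOn_tsum_of_summable_norm (summable_inv_succ_sq.mul_left κ)
    (fun n => by fun_prop) isOpen_ball
    fun n z hz => h.norm_term_le hρ (mem_ball_zero_iff.1 hz).le n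

theorem Dominated.taylorCoeffZero_powerSum {ρ κ : ℝ} {a : ℕ → ℂ} (hρ : 0 < ρ)
    (h : Dominated ρ κ a) : taylorCoeffZero (powerSum a) = a :=
  taylorCoeffZero_eq_of_hasSum hρ fun _ hz => h.hasSum hρ (mem_ball_zero_iff.1 hz).le

/-! ### Correlations -/

/-- The correlation `∑ b_{l+k} conj c_l`. -/
noncomputable def corr (b c : ℕ → ℂ) (k : ℕ) : ℂ := ∑' l, b (l + k) * (starRingEnd ℂ) (c l)

/-- Since ρ ≥ 1 the weights decrease in the index, so b alone supplies the decay in k and c alone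
supplies the summability in l. -/
theorem Dominated.norm_corr_term_le {ρ κ κ' : ℝ} {b c : ℕ → ℂ} (hρ : 1 ≤ ρ) (hb : Dominated ρ κ b)
    (hc : Dominated ρ κ' c) (k l : ℕ) : ‖b (l + k) * (starRingEnd ℂ) (c l)‖ ≤
      κ * κ' * seqWeight ρ k * (((l : ℝ) + 1) ^ 2)⁻¹ := by
  rw [norm_mul, RCLike.norm_conj]
  calc _ ≤ (κ * seqWeight ρ k) * (κ' * (((l : ℝ) + 1) ^ 2)⁻¹) := by
        refine mul_le_mul ((hb _).trans ?_) ((hc _).trans ?_) (norm_nonneg _)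
          (mul_nonneg hb.nonneg (seqWeight_pos (by linarith) _).le)
        · exact mul_le_mul_of_nonneg_left (seqWeight_add_le hρ _ _) hb.nonneg
        · exact mul_le_mul_of_nonneg_left (seqWeight_le hρ _) hc.nonneg
    _ = _ := by ring

theorem Dominated.summable_corr {ρ κ κ' : ℝ} {b c : ℕ → ℂ} (hρ : 1 ≤ ρ) (hb : Dominated ρ κ b)
    (hc : Dominated ρ κ' c) (k : ℕ) : Summable fun l => b (l + k) * (starRingEnd ℂ) (c l) :=
  Summable.of_norm_bounded (summable_inv_succ_sq.mul_left _) (hb.norm_corr_term_le hρ hc k)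

theorem Dominated.corr {ρ κ κ' : ℝ} {b c : ℕ → ℂ} (hρ : 1 ≤ ρ) (hb : Dominated ρ κ b)
    (hc : Dominated ρ κ' c) : Dominated ρ (2 * κ * κ') (corr b c) := fun k => by
  refine (tsum_of_norm_bounded (summable_inv_succ_sq.mul_left _).hasSum
    (hb.norm_corr_term_le hρ hc k)).trans ?_
  rw [tsum_mul_left]
  have h : 0 ≤ κ * κ' * seqWeight ρ k :=
    mul_nonneg (mul_nonneg hb.nonneg hc.nonneg) (seqWeight_pos (by linarith) _).le
  nlinarith [tsum_inv_succ_sq_le_two]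

/-- Coefficients of the analytic function whose real part on the unit circle is
`Re (b conj c)`, for `b = ∑ b_n z^n` and `c = ∑ c_n z^n`. -/
noncomputable def hermProj (b c : ℕ → ℂ) (k : ℕ) : ℂ :=
  (if k = 0 then 1 / 2 else 1) * (corr b c k + corr c b k)

theorem Dominated.hermProj {ρ κ κ' : ℝ} {b c : ℕ → ℂ} (hρ : 1 ≤ ρ) (hb : Dominated ρ κ b)
    (hc : Dominated ρ κ' c) : Dominated ρ (4 * κ * κ') (hermProj b c) := fun k => by
  have h1 := hb.corr hρ hc k
  have h2 := hc.corr hρ hb k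
  have h3 : ‖((if k = 0 then 1 / 2 else 1 : ℂ))‖ ≤ 1 := by split_ifs <;> norm_num
  rw [_root_.hermProj, norm_mul]
  calc _ ≤ 1 * ‖_root_.corr b c k + _root_.corr c b k‖ :=
        mul_le_mul_of_nonneg_right h3 (norm_nonneg _)
    _ ≤ ‖_root_.corr b c k‖ + ‖_root_.corr c b k‖ := by rw [one_mul]; exact norm_add_le _ _
    _ ≤ _ := by linarith

theorem conj_corr_zero (b c : ℕ → ℂ) : (starRingEnd ℂ) (corr b c 0) = corr c b 0 := by
  simp only [corr, Complex.conj_tsum, map_mul, Complex.conj_conj, add_zero, mul_comm]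

theorem hermProj_zero_im (b c : ℕ → ℂ) : (hermProj b c 0).im = 0 := by
  rw [hermProj, ← conj_corr_zero b c, Complex.add_conj, if_pos rfl]
  simp

/-- Splits ℕ × ℕ into pairs on or below the diagonal and pairs strictly above it, each parametrized
by the offset k and the smaller index l. The main diagonal falls in the first part only. -/
theorem tsum_nat_prod_eq_add {F : ℕ × ℕ → ℂ} (hF : Summable F) :
    ∑' p, F p = ∑' k, ∑' l, F (l + k, l) + ∑' k, ∑' l, F (l, l + (k + 1)) := by
  let i1 : ℕ × ℕ → ℕ × ℕ := fun p => (p.2 + p.1, p.2)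
  let i2 : ℕ × ℕ → ℕ × ℕ := fun p => (p.2, p.2 + (p.1 + 1))
  have hi1 : Function.Injective i1 := by
    rintro ⟨a, b⟩ ⟨c, d⟩ h
    obtain ⟨h1, h2⟩ := Prod.mk.inj h
    exact Prod.ext (by simp only at *; omega) h2
  have hi2 : Function.Injective i2 := by
    rintro ⟨a, b⟩ ⟨c, d⟩ h
    obtain ⟨h1, h2⟩ := Prod.mk.inj h
    exact Prod.ext (by simp only at *; omega) h1
  have hr2 : range i2 = (range i1)ᶜ := by
    ext ⟨m, l⟩
    simp only [mem_range, mem_compl_iff, i1, i2, Prod.mk.injEq, Prod.exists]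
    constructor
    · rintro ⟨x, y, rfl, h⟩ ⟨u, v, h1, h2⟩; omega
    · intro h
      have : m < l := by
        by_contra hc
        exact h ⟨m - l, l, by omega, rfl⟩
      exact ⟨l - m - 1, m, rfl, by omega⟩
  have e1 : ∑' p : range i1, F p = ∑' p, F (i1 p) := tsum_range F hi1
  have e2 : ∑' p : range i2, F p = ∑' p, F (i2 p) := tsum_range F hi2
  have s1 : Summable fun p => F (i1 p) := hF.comp_injective hi1
  have s2 : Summable fun p => F (i2 p) := hF.comp_injective hi2
  rw [← hF.tsum_subtype_add_tsum_subtype_compl (range i1), ← hr2, e1, e2, s1.tsum_prod,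
    s2.tsum_prod]

theorem tsum_mul_tsum_eq_add {u v : ℕ → ℂ} (hu : Summable fun n => ‖u n‖)
    (hv : Summable fun n => ‖v n‖) : (∑' n, u n) * (∑' n, v n) =
      ∑' k, ∑' l, u (l + k) * v l + ∑' k, ∑' l, u l * v (l + (k + 1)) := by
  rw [tsum_mul_tsum_of_summable_norm hu hv]
  have hF : Summable fun p : ℕ × ℕ => u p.1 * v p.2 := summable_mul_of_summable_norm hu hv
  rw [tsum_nat_prod_eq_add hF]

/-- On the unit circle the function with coefficients `hermProj b c` has real part
`Re (b conj c)`. -/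
theorem re_powerSum_hermProj {ρ κ κ' : ℝ} {b c : ℕ → ℂ} (hρ : 1 ≤ ρ) (hb : Dominated ρ κ b)
    (hc : Dominated ρ κ' c) {z : ℂ} (hz : ‖z‖ = 1) :
    (powerSum (hermProj b c) z).re =
      (powerSum b z * (starRingEnd ℂ) (powerSum c z)).re := by
  have hρ0 : 0 < ρ := by linarith
  have hzz : z * (starRingEnd ℂ) z = 1 := by
    rw [Complex.mul_conj, Complex.normSq_eq_norm_sq, hz]; norm_num
  have hzn (l : ℕ) : z ^ l * (starRingEnd ℂ) z ^ l = 1 := by rw [← mul_pow, hzz, one_pow]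
  have sb : Summable fun n => ‖b n * z ^ n‖ := (hb.hasSum hρ0 (hz.trans_le hρ)).summable.norm
  have sc : Summable fun n => ‖(starRingEnd ℂ) (c n * z ^ n)‖ := by
    simpa only [RCLike.norm_conj] using (hc.hasSum hρ0 (hz.trans_le hρ)).summable.norm
  -- On the circle zˡ · conj(zˡ) = 1, so a product of terms depends on z only through the difference
  -- of the indices.
  have e1 : ∑' k, ∑' l, b (l + k) * z ^ (l + k) * (starRingEnd ℂ) (c l * z ^ l) =
      ∑' k, corr b c k * z ^ k := by
    refine tsum_congr fun k => ?_
    rw [corr, ← tsum_mul_right]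
    refine tsum_congr fun l => ?_
    simp only [map_mul, map_pow, pow_add]
    linear_combination (b (l + k) * (starRingEnd ℂ) (c l) * z ^ k) * hzn l
  -- The negative frequencies are the conjugates of positive ones with b and c exchanged, so for the
  -- real part they can be replaced by an analytic series.
  have e2 : ∑' k, ∑' l, b l * z ^ l * (starRingEnd ℂ) (c (l + (k + 1)) * z ^ (l + (k + 1))) =
      (starRingEnd ℂ) (∑' k, corr c b (k + 1) * z ^ (k + 1)) := by
    rw [Complex.conj_tsum]
    refine tsum_congr fun k => ?_
    rw [corr, ← tsum_mul_right, Complex.conj_tsum]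
    refine tsum_congr fun l => ?_
    simp only [map_mul, map_pow, Complex.conj_conj]
    rw [pow_add _ l (k + 1)]
    linear_combination (b l * (starRingEnd ℂ) (c (l + (k + 1))) *
      ((starRingEnd ℂ) z ^ (k + 1))) * hzn l
  have s1 := ((hb.corr hρ hc).hasSum hρ0 (hz.trans_le hρ)).summable
  have s2 := ((hc.corr hρ hb).hasSum hρ0 (hz.trans_le hρ)).summable
  have s3 := ((hb.hermProj hρ hc).hasSum hρ0 (hz.trans_le hρ)).summable
  have e3 : ∑' k, hermProj b c (k + 1) * z ^ (k + 1) =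
      ∑' k, corr b c (k + 1) * z ^ (k + 1) + ∑' k, corr c b (k + 1) * z ^ (k + 1) := by
    rw [← Summable.tsum_add ((summable_nat_add_iff 1).2 s1) ((summable_nat_add_iff 1).2 s2)]
    refine tsum_congr fun k => ?_
    rw [hermProj, if_neg (by omega)]
    ring
  -- The factor 1/2 at index 0 compensates for the diagonal, which occurs once in the product but is
  -- counted in both correlations.
  have e4 : (hermProj b c 0).re = (corr b c 0).re := by
    rw [hermProj, ← conj_corr_zero b c, Complex.add_conj, if_pos rfl]
    simp
  rw [powerSum, powerSum, powerSum, Complex.conj_tsum, tsum_mul_tsum_eq_add sb sc, e1, e2,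
    s1.tsum_eq_zero_add, s3.tsum_eq_zero_add, e3]
  simp only [Complex.add_re, Complex.conj_re, pow_zero, mul_one, e4]
  ring

/-! ### Analytic functions with given real part on the unit circle -/

/-- The maximum principle for exp F and exp(-F), both of modulus 1 on the circle, gives Re F = 0 in
the disk. A holomorphic function with constant real part is constant, and the condition at the
origin makes the constant 0. -/
theorem eqOn_zero_of_re_eq_zero_on_circle {F : ℂ → ℂ} {r : ℝ} (hr : 1 < r)
    (hF : DifferentiableOn ℂ F (ball 0 r)) (hre : ∀ z : ℂ, ‖z‖ = 1 → (F z).re = 0)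
    (h0 : (F 0).im = 0) : EqOn F 0 (ball 0 1) := by
  have key : ∀ G : ℂ → ℂ, DifferentiableOn ℂ G (ball 0 r) → (∀ z : ℂ, ‖z‖ = 1 → (G z).re = 0) →
      ∀ z ∈ ball (0 : ℂ) 1, (G z).re ≤ 0 := by
    intro G hG hGre z hz
    have hd : DiffContOnCl ℂ (fun z => Complex.exp (G z)) (ball 0 1) :=
      (hG.cexp.mono (by
        rw [closure_ball _ one_ne_zero]; exact closedBall_subset_ball hr)).diffContOnCl
    have := Complex.norm_le_of_forall_mem_frontier_norm_le isBounded_ball hd (C := 1)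
      (fun w hw => by
        rw [frontier_ball _ one_ne_zero, mem_sphere_zero_iff_norm] at hw
        rw [Complex.norm_exp, hGre w hw, Real.exp_zero]) (subset_closure hz)
    rwa [Complex.norm_exp, Real.exp_le_one_iff] at this
  have hz : ∀ z ∈ ball (0 : ℂ) 1, (F z).re = 0 := fun z hz => by
    have h1 := key F hF hre z hz
    have h2 := key (fun z => -F z) hF.neg (fun w hw => by simp [hre w hw]) z hz
    simp only [Complex.neg_re] at h2
    linarith
  obtain ⟨c, hc⟩ := AnalyticOnNhd.eq_const_of_re_eq_const
    ((hF.mono (ball_subset_ball hr.le)).analyticOnNhd isOpen_ball) hz isOpen_ball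
    ⟨⟨0, by simp⟩, (convex_ball _ _).isPreconnected⟩
  have hc0 := hc 0 (by simp)
  intro z hzz
  rw [hc z hzz, ← hc0]
  exact Complex.ext (hz 0 (by simp)) h0

/-- Cauchy's estimate on the larger radius R leaves a factor (ρ/R)ⁿ, and A bounds its product with
the polynomial part (n+1)² of the weight. -/
theorem dominated_taylorCoeffZero {f : ℂ → ℂ} {ρ R r M A : ℝ}
    (hf : DifferentiableOn ℂ f (ball 0 r)) (hρ : 0 < ρ) (hR : 0 < R) (hRr : R < r)
    (hM : ∀ z ∈ closedBall (0 : ℂ) R, ‖f z‖ ≤ M)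
    (hA : ∀ n : ℕ, ((n : ℝ) + 1) ^ 2 * (ρ / R) ^ n ≤ A) :
    Dominated ρ (M * A) (taylorCoeffZero f) := fun n => by
  refine (norm_taylorCoeffZero_le hf hR hRr hM n).trans ?_
  have hM0 : 0 ≤ M := (norm_nonneg _).trans (hM 0 (by simp [hR.le]))
  have h := hA n
  rw [div_pow, mul_div_assoc', div_le_iff₀ (by positivity)] at h
  rw [seqWeight, ← div_eq_mul_inv, div_le_div_iff₀ (by positivity) (by positivity)]
  nlinarith [mul_le_mul_of_nonneg_left h hM0]

theorem exists_sq_mul_geometric_le {q : ℝ} (h0 : 0 ≤ q) (h1 : q < 1) :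
    ∃ A : ℝ, 0 < A ∧ ∀ n : ℕ, ((n : ℝ) + 1) ^ 2 * q ^ n ≤ A := by
  have h : Tendsto (fun n : ℕ => ((n : ℝ) + 1) ^ 2 * q ^ n) atTop (𝓝 0) := by
    have e2 := tendsto_pow_const_mul_const_pow_of_lt_one 2 h0 h1
    have e1 := tendsto_pow_const_mul_const_pow_of_lt_one 1 h0 h1
    have e0 := tendsto_pow_const_mul_const_pow_of_lt_one 0 h0 h1
    have := (e2.add (e1.const_mul 2)).add e0
    simp only [mul_zero, add_zero] at this
    refine this.congr fun n => ?_
    ring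
  obtain ⟨A, hA⟩ := h.bddAbove_range
  exact ⟨max A 1, by positivity, fun n => (hA ⟨n, rfl⟩).trans (le_max_left _ _)⟩

/-- An analytic function near the closed unit disk, real at the origin, is determined by its real
part on the circle; here that real part is `Re (Y conj B)`. -/
theorem taylorCoeffZero_eq_hermProj {Q Y B : ℂ → ℂ} {r : ℝ} (hr : 1 < r)
    (hQ : DifferentiableOn ℂ Q (ball 0 r)) (hY : DifferentiableOn ℂ Y (ball 0 r))
    (hB : DifferentiableOn ℂ B (ball 0 r))
    (hre : ∀ z : ℂ, ‖z‖ = 1 → (Q z).re = (Y z * (starRingEnd ℂ) (B z)).re)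
    (h0 : (Q 0).im = 0) :
    taylorCoeffZero Q = hermProj (taylorCoeffZero Y) (taylorCoeffZero B) := by
  -- Two radii with 1 < ρ < R < r: boundedness holds on R, the Cauchy loss is absorbed between R and
  -- ρ, and ρ > 1 keeps the resulting series analytic across the circle.
  obtain ⟨R, hR1, hRr⟩ := exists_between hr
  obtain ⟨ρ, hρ1, hρR⟩ := exists_between hR1
  obtain ⟨A, hA0, hA⟩ := exists_sq_mul_geometric_le (q := ρ / R) (by positivity)
    ((div_lt_one (by linarith)).2 hρR)
  have hdom : ∀ f : ℂ → ℂ, DifferentiableOn ℂ f (ball 0 r) →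
      ∃ κ, Dominated ρ κ (taylorCoeffZero f) := fun f hf => by
    obtain ⟨M, hM⟩ := (isCompact_closedBall (0 : ℂ) R).exists_bound_of_continuousOn
      (hf.continuousOn.mono (closedBall_subset_ball hRr))
    exact ⟨M * A, dominated_taylorCoeffZero hf (by linarith) (by linarith) hRr hM hA⟩
  obtain ⟨κ, hκ⟩ := hdom Y hY
  obtain ⟨κ', hκ'⟩ := hdom B hB
  have hp := hκ.hermProj hρ1.le hκ'
  set p := hermProj (taylorCoeffZero Y) (taylorCoeffZero B) with hpdef
  have hcirc : ∀ z : ℂ, ‖z‖ = 1 → (Q z - powerSum p z).re = 0 := by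
    intro z hz
    have hzr : z ∈ ball (0 : ℂ) r := by simp [hz, hr]
    rw [Complex.sub_re, hpdef, re_powerSum_hermProj hρ1.le hκ hκ' hz, hre z hz, powerSum, powerSum,
      (hasSum_taylorCoeffZero hY hzr).tsum_eq, (hasSum_taylorCoeffZero hB hzr).tsum_eq, sub_self]
  have hz := eqOn_zero_of_re_eq_zero_on_circle (F := fun z => Q z - powerSum p z) hρ1
    ((hQ.mono (ball_subset_ball (by linarith))).sub (hp.differentiableOn_powerSum (by linarith)))
    hcirc (by
      rw [powerSum_at_zero, Complex.sub_im, h0, hpdef, hermProj_zero_im, sub_zero])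
  refine taylorCoeffZero_eq_of_hasSum one_pos fun z hzz => ?_
  rw [sub_eq_zero.1 (hz hzz)]
  exact hp.hasSum (by linarith) ((mem_ball_zero_iff.1 hzz).le.trans hρ1.le)

/-! ### Univalent functions and analytic families -/

/-- At a critical point f - f(z₀) = φⁿ with n ≥ 2 and φ a local coordinate. Points where φ takes the
values w and ζw, for a primitive n-th root of unity ζ, have the same image under f. -/
theorem AnalyticAt.deriv_ne_zero_of_injOn {f : ℂ → ℂ} {z₀ : ℂ} {U : Set ℂ} (hf : AnalyticAt ℂ f z₀)
    (hU : U ∈ 𝓝 z₀) (hinj : InjOn f U) : deriv f z₀ ≠ 0 := by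
  intro hd
  have hF : AnalyticAt ℂ (fun z => f z - f z₀) z₀ := hf.sub analyticAt_const
  have hnc : ¬ ∀ᶠ z in 𝓝 z₀, f z - f z₀ = 0 := by
    intro h
    obtain ⟨ε, hε, hsub⟩ := Metric.mem_nhds_iff.1 (inter_mem hU h)
    have hmem : z₀ + (ε / 2 : ℝ) ∈ ball z₀ ε := by
      simp [dist_eq_norm, abs_of_pos hε]; linarith
    have := hinj (hsub hmem).1 (mem_of_mem_nhds hU) (sub_eq_zero.1 (hsub hmem).2)
    simp [hε.ne'] at this
  obtain ⟨n, g, hg, hg0, hfg⟩ := hF.exists_eventuallyEq_pow_smul_nonzero_iff.2 hnc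
  have hn0 : n ≠ 0 := by
    rintro rfl
    have := hfg.self_of_nhds
    simp at this
    exact hg0 this.symm
  have hn1 : n ≠ 1 := by
    rintro rfl
    have h1 : HasDerivAt (fun z => (z - z₀) ^ 1 • g z) (g z₀) z₀ := by
      have := ((hasDerivAt_id z₀).sub_const z₀).fun_mul hg.differentiableAt.hasDerivAt
      simpa using this
    have h2 : HasDerivAt (fun z => f z - f z₀) (deriv f z₀) z₀ :=
      hf.differentiableAt.hasDerivAt.sub_const _
    exact hg0 ((h1.congr_of_eventuallyEq hfg).unique h2 |>.trans hd)
  set c := g z₀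
  -- An analytic n-th root of g: dividing by c = g(z₀) places the variable part near 1, away from
  -- the branch cut.
  let m : ℂ → ℂ := fun z => c ^ ((n : ℂ)⁻¹) * (g z / c) ^ ((n : ℂ)⁻¹)
  have hm : AnalyticAt ℂ m z₀ := by
    refine analyticAt_const.mul ((hg.div analyticAt_const hg0).cpow analyticAt_const ?_)
    show g z₀ / g z₀ ∈ _
    rw [div_self hg0]
    exact Complex.one_mem_slitPlane
  have hmn : ∀ z, m z ^ n = g z := fun z => by
    simp only [m, mul_pow]
    rw [Complex.cpow_nat_inv_pow _ hn0, Complex.cpow_nat_inv_pow _ hn0]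
    field_simp
  have hm0 : m z₀ ≠ 0 := fun h => hg0 (by rw [← zero_pow (M₀ := ℂ) hn0, ← h, hmn z₀])
  let φ : ℂ → ℂ := fun z => (z - z₀) * m z
  have hφa : AnalyticAt ℂ φ z₀ := (analyticAt_id.sub analyticAt_const).mul hm
  have hφd : HasDerivAt φ (m z₀) z₀ := by
    have := ((hasDerivAt_id z₀).sub_const z₀).fun_mul hm.differentiableAt.hasDerivAt
    simpa using this
  have hφs : HasStrictDerivAt φ (m z₀) z₀ := by
    have := hφa.hasStrictDerivAt
    rwa [hφd.deriv] at this
  have hmap := hφs.map_nhds_eq hm0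
  have hV := image_mem_map (m := φ) (inter_mem hU hfg)
  rw [hmap] at hV
  have hφ0 : φ z₀ = 0 := by simp [φ]
  rw [hφ0] at hV
  obtain ⟨ε, hε, hsub⟩ := Metric.mem_nhds_iff.1 hV
  have hζ := Complex.isPrimitiveRoot_exp n hn0
  set ζ := Complex.exp (2 * Real.pi * Complex.I / n)
  have hζ1 : ‖ζ‖ = 1 := hζ.norm'_eq_one hn0
  let w : ℂ := ((ε / 2 : ℝ) : ℂ)
  have hw : ‖w‖ = ε / 2 := by simp [w, abs_of_pos hε]
  obtain ⟨z1, ⟨hz1U, hz1⟩, hz1w⟩ := hsub (show w ∈ ball 0 ε by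
    rw [mem_ball_zero_iff, hw]; linarith)
  obtain ⟨z2, ⟨hz2U, hz2⟩, hz2w⟩ := hsub (show ζ * w ∈ ball 0 ε by
    rw [mem_ball_zero_iff, norm_mul, hw, hζ1]; linarith)
  have e (z : ℂ) (h : f z - f z₀ = (z - z₀) ^ n • g z) : f z - f z₀ = φ z ^ n := by
    rw [h, smul_eq_mul, mul_pow, hmn]
  have h12 : f z1 = f z2 := by
    have h1 := e z1 hz1
    have h2 := e z2 hz2
    rw [hz1w] at h1
    rw [hz2w, mul_pow, hζ.pow_eq_one, one_mul, ← h1] at h2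
    linear_combination -h2
  have := hinj hz1U hz2U h12
  rw [← this, hz1w] at hz2w
  have hw0 : w ≠ 0 := by
    rw [← norm_ne_zero_iff, hw]; positivity
  have : ζ = 1 := by
    field_simp at hz2w
    exact hz2w.symm
  exact hζ.ne_one (by omega) this

/-- Joint continuity makes F t converge to F t₀ locally uniformly in z, and by Weierstrass the
derivatives then converge locally uniformly as well. -/
theorem continuousOn_deriv_family {F : ℝ → ℂ → ℂ} {K : Set ℝ} {r : ℝ}
    (hd : ∀ t ∈ K, DifferentiableOn ℂ (F t) (ball 0 r))
    (hc : ContinuousOn (fun p : ℝ × ℂ => F p.1 p.2) (K ×ˢ ball 0 r)) :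
    ContinuousOn (fun p : ℝ × ℂ => deriv (F p.1) p.2) (K ×ˢ ball 0 r) := by
  rintro ⟨t₀, z₀⟩ ⟨ht₀, hz₀⟩
  have hloc : TendstoLocallyUniformlyOn (fun p : ℝ × ℂ => F p.1) (F t₀)
      (𝓝[K ×ˢ ball 0 r] (t₀, z₀)) (ball 0 r) := by
    rw [Metric.tendstoLocallyUniformlyOn_iff]
    intro ε hε x hx
    have h := hc (t₀, x) ⟨ht₀, hx⟩
    have h' := Metric.tendsto_nhds.1 h (ε / 2) (by positivity)
    rw [nhdsWithin_prod_eq] at h'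
    obtain ⟨u, hu, v, hv, huv⟩ := Filter.mem_prod_iff.1 h'
    refine ⟨v, hv, ?_⟩
    have hu' : Prod.fst ⁻¹' u ∈ 𝓝[K ×ˢ ball 0 r] (t₀, z₀) := by
      rw [nhdsWithin_prod_eq]; exact Filter.tendsto_fst hu
    filter_upwards [hu'] with p hp y hy
    have h1 : dist (F p.1 y) (F t₀ x) < ε / 2 := huv (mk_mem_prod hp hy)
    have h2 : dist (F t₀ y) (F t₀ x) < ε / 2 :=
      huv (mk_mem_prod (mem_of_mem_nhdsWithin ht₀ hu) hy)
    calc dist (F t₀ y) (F p.1 y) ≤ dist (F t₀ y) (F t₀ x) + dist (F p.1 y) (F t₀ x) :=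
          dist_triangle_right _ _ _
      _ < ε := by linarith
  have hder := hloc.deriv (by
    filter_upwards [self_mem_nhdsWithin] with p hp using hd p.1 hp.1) isOpen_ball
  exact hder.tendsto_comp
    ((((hd t₀ ht₀).deriv isOpen_ball).continuousOn) z₀ hz₀) hz₀ (by
      rw [nhdsWithin_prod_eq]; exact Filter.tendsto_snd)

/-- Uniform right differentiability of a family with continuous time derivative. -/
theorem exists_uniform_right_deriv {f G : ℝ → ℂ → ℂ} {T' t : ℝ} {S : Set ℂ} (hS : IsCompact S)
    (ht : 0 ≤ t) (htT : t < T')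
    (hder : ∀ s ∈ Icc 0 T', ∀ z ∈ S, HasDerivWithinAt (fun s => f s z) (G s z) (Icc 0 T') s)
    (hG : ContinuousOn (fun p : ℝ × ℂ => G p.1 p.2) (Icc 0 T' ×ˢ S)) {ε : ℝ} (hε : 0 < ε) :
    ∃ δ > 0, ∀ s ∈ Icc t (t + δ), ∀ z ∈ S, ‖f s z - f t z - (s - t) • G t z‖ ≤ ε * (s - t) := by
  have huc := (isCompact_Icc.prod hS).uniformContinuousOn_of_continuous hG
  obtain ⟨δ, hδ, hδ'⟩ := Metric.uniformContinuousOn_iff.1 huc ε hε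
  refine ⟨min (δ / 2) (T' - t), lt_min (by positivity) (by linarith), fun s hs z hz => ?_⟩
  have hsT : s ≤ T' := by linarith [hs.2, min_le_right (δ / 2) (T' - t)]
  have hsδ : s ≤ t + δ / 2 := by linarith [hs.2, min_le_left (δ / 2) (T' - t)]
  have hsub : Icc t s ⊆ Icc 0 T' := Icc_subset_Icc ht hsT
  have hd : ∀ x ∈ Icc t s, HasDerivWithinAt (fun x => f x z - (x - t) • G t z)
      (G x z - G t z) (Icc t s) x := fun x hx => by
    have h1 := (hder x (hsub hx) z hz).mono hsub
    have h2 : HasDerivWithinAt (fun x : ℝ => (x - t) • G t z) ((1 : ℝ) • G t z) (Icc t s) x :=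
      ((hasDerivWithinAt_id x _).sub_const t).smul_const _
    simpa using h1.fun_sub h2
  have := norm_image_sub_le_of_norm_deriv_le_segment' hd (C := ε) (fun x hx => by
    have hx' : x ∈ Icc t s := ⟨hx.1, hx.2.le⟩
    have := hδ' (x, z) ⟨hsub hx', hz⟩ (t, z) ⟨⟨ht, htT.le⟩, hz⟩ (by
      rw [Prod.dist_eq, dist_self, max_eq_left dist_nonneg, Real.dist_eq, abs_of_nonneg]
      · linarith [hx.2, hx.1]
      · linarith [hx.1])
    rw [dist_eq_norm] at this
    exact this.le) s ⟨hs.1, le_rfl⟩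
  simpa [sub_right_comm] using this

/-- The right difference quotients are holomorphic in z and converge uniformly, so their limit is
holomorphic. -/
theorem differentiableOn_time_deriv {f G : ℝ → ℂ → ℂ} {T' t R : ℝ}
    (ht : 0 ≤ t) (htT : t < T')
    (hd : ∀ s ∈ Icc 0 T', DifferentiableOn ℂ (f s) (ball 0 R))
    (hder : ∀ s ∈ Icc 0 T', ∀ z ∈ closedBall (0 : ℂ) R,
      HasDerivWithinAt (fun s => f s z) (G s z) (Icc 0 T') s)
    (hG : ContinuousOn (fun p : ℝ × ℂ => G p.1 p.2) (Icc 0 T' ×ˢ closedBall 0 R)) :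
    DifferentiableOn ℂ (G t) (ball 0 R) := by
  have hT : TendstoUniformlyOn (fun (s : ℝ) z => (s - t)⁻¹ • (f s z - f t z)) (G t) (𝓝[>] t)
      (ball 0 R) := by
    rw [Metric.tendstoUniformlyOn_iff]
    intro ε hε
    obtain ⟨δ, hδ, h⟩ := exists_uniform_right_deriv (isCompact_closedBall (0 : ℂ) R) ht htT hder hG
      (half_pos hε)
    have : Ioc t (t + δ) ∈ 𝓝[>] t := Ioc_mem_nhdsGT (by linarith)
    filter_upwards [this] with s hs z hz
    have h1 := h s ⟨hs.1.le, hs.2⟩ z (ball_subset_closedBall hz)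
    have hst : 0 < s - t := by linarith [hs.1]
    rw [dist_comm, dist_eq_norm]
    have e : (s - t)⁻¹ • (f s z - f t z) - G t z =
        (s - t)⁻¹ • (f s z - f t z - (s - t) • G t z) := by
      rw [smul_sub (s - t)⁻¹ (f s z - f t z), smul_smul, inv_mul_cancel₀ hst.ne', one_smul]
    rw [e, norm_smul, norm_inv, Real.norm_of_nonneg hst.le]
    calc _ ≤ (s - t)⁻¹ * (ε / 2 * (s - t)) := by gcongr
      _ = ε / 2 := by field_simp
      _ < ε := by linarith
  refine hT.tendstoLocallyUniformlyOn.differentiableOn ?_ isOpen_ball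
  have : Ioc t T' ∈ 𝓝[>] t := Ioc_mem_nhdsGT htT
  filter_upwards [this] with s hs
  exact ((hd s ⟨by linarith [hs.1], hs.2⟩).sub (hd t ⟨ht, htT.le⟩)).const_smul ((s - t)⁻¹)

/-- The Taylor remainder in time is uniformly o(s - t) on |z| ≤ R; Cauchy's estimate transfers this
to each coefficient. The tolerance ε Rⁿ cancels the R⁻ⁿ of that estimate. -/
theorem hasDerivWithinAt_taylorCoeffZero {f G : ℝ → ℂ → ℂ} {T' t r R : ℝ}
    (ht : 0 ≤ t) (htT : t < T') (hR : 0 < R) (hRr : R < r)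
    (hd : ∀ s ∈ Icc 0 T', DifferentiableOn ℂ (f s) (ball 0 r))
    (hGd : DifferentiableOn ℂ (G t) (ball 0 r))
    (hder : ∀ s ∈ Icc 0 T', ∀ z ∈ closedBall (0 : ℂ) R,
      HasDerivWithinAt (fun s => f s z) (G s z) (Icc 0 T') s)
    (hG : ContinuousOn (fun p : ℝ × ℂ => G p.1 p.2) (Icc 0 T' ×ˢ closedBall 0 R)) (n : ℕ) :
    HasDerivWithinAt (fun s => taylorCoeffZero (f s) n) (taylorCoeffZero (G t) n) (Ici t) t := by
  rw [hasDerivWithinAt_iff_isLittleO, Asymptotics.isLittleO_iff]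
  intro ε hε
  obtain ⟨δ, hδ, h⟩ := exists_uniform_right_deriv (isCompact_closedBall (0 : ℂ) R) ht htT hder hG
    (ε := ε * R ^ n) (by positivity)
  have hmem : Icc t (min (t + δ) T') ∈ 𝓝[≥] t := Icc_mem_nhdsGE (lt_min (by linarith) htT)
  filter_upwards [hmem] with s hs
  have hs1 : s ∈ Icc t (t + δ) := ⟨hs.1, hs.2.trans (min_le_left _ _)⟩
  have hst : 0 ≤ s - t := by linarith [hs.1]
  have hr : 0 < r := hR.trans hRr
  have hs' := hd s ⟨ht.trans hs.1, hs.2.trans (min_le_right _ _)⟩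
  have ht' := hd t ⟨ht, htT.le⟩
  have e : taylorCoeffZero (f s) n - taylorCoeffZero (f t) n - (s - t) • taylorCoeffZero (G t) n =
      taylorCoeffZero (fun z => f s z - f t z - ((s - t : ℝ) : ℂ) * G t z) n := by
    rw [taylorCoeffZero_sub hr (hs'.fun_sub ht') (hGd.const_mul _),
      taylorCoeffZero_sub hr hs' ht', taylorCoeffZero_const_mul hr _ hGd, Complex.real_smul]
  rw [e, Real.norm_of_nonneg hst]
  refine (norm_taylorCoeffZero_le (M := ε * R ^ n * (s - t)) ((hs'.fun_sub ht').fun_sub (hGd.const_mul _))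
    hR hRr (fun z hz => ?_) n).trans (le_of_eq ?_)
  · simpa only [Complex.real_smul] using h s hs1 z hz
  · field_simp

/-! ### Uniqueness of strong solutions -/

/-- A strong solution on `[0,T]` with time derivative `G`, together with uniform bounds on
`|ξ| < r`. -/
structure RegularSuctionFlow (T r M : ℝ) (f G : ℝ → ℂ → ℂ) : Prop where
  one_lt : 1 < r
  diff : ∀ t ∈ Icc 0 T, DifferentiableOn ℂ (f t) (ball 0 r)
  diff_time : ∀ t ∈ Icc 0 T, DifferentiableOn ℂ (G t) (ball 0 r)
  deriv_ne_zero : ∀ t ∈ Icc 0 T, ∀ z ∈ ball (0 : ℂ) r, deriv (f t) z ≠ 0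
  norm_time_le : ∀ t ∈ Icc 0 T, ∀ z ∈ ball (0 : ℂ) r, ‖G t z‖ ≤ M
  norm_deriv_le : ∀ t ∈ Icc 0 T, ∀ z ∈ ball (0 : ℂ) r, ‖deriv (f t) z‖ ≤ M
  norm_inv_le : ∀ t ∈ Icc 0 T, ∀ z ∈ ball (0 : ℂ) r, ‖(deriv (f t) z)⁻¹‖ ≤ M
  hasDeriv : ∀ t ∈ Icc 0 T, ∀ n, HasDerivWithinAt (fun s => taylorCoeffZero (f s) n)
    (taylorCoeffZero (G t) n) (Ici t) t
  continuousOn : ∀ n, ContinuousOn (fun t => taylorCoeffZero (f t) n) (Icc 0 T)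
  map_zero : ∀ t ∈ Icc 0 T, f t 0 = 0
  time_zero : ∀ t ∈ Icc 0 T, G t 0 = 0
  deriv_zero_pos : ∀ t ∈ Icc 0 T, 0 < (deriv (f t) 0).re ∧ (deriv (f t) 0).im = 0
  deriv_time_im : ∀ t ∈ Icc 0 T, (deriv (G t) 0).im = 0
  equation : ∀ t ∈ Icc 0 T, ∀ ξ : ℂ, ‖ξ‖ = 1 →
    (G t ξ * (starRingEnd ℂ) (deriv (f t) ξ * ξ)).re = -1

theorem RegularSuctionFlow.mono {T r M T' r' M' : ℝ} {f G : ℝ → ℂ → ℂ}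
    (h : RegularSuctionFlow T r M f G) (hT : T' ≤ T) (hr : r' ≤ r) (hr1 : 1 < r') (hM : M ≤ M') :
    RegularSuctionFlow T' r' M' f G := by
  have hI : Icc 0 T' ⊆ Icc 0 T := Icc_subset_Icc_right hT
  have hb : ball (0 : ℂ) r' ⊆ ball 0 r := ball_subset_ball hr
  exact ⟨hr1, fun t ht => (h.diff t (hI ht)).mono hb, fun t ht => (h.diff_time t (hI ht)).mono hb,
    fun t ht z hz => h.deriv_ne_zero t (hI ht) z (hb hz),
    fun t ht z hz => (h.norm_time_le t (hI ht) z (hb hz)).trans hM,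
    fun t ht z hz => (h.norm_deriv_le t (hI ht) z (hb hz)).trans hM,
    fun t ht z hz => (h.norm_inv_le t (hI ht) z (hb hz)).trans hM,
    fun t ht => h.hasDeriv t (hI ht), fun n => (h.continuousOn n).mono hI,
    fun t ht => h.map_zero t (hI ht), fun t ht => h.time_zero t (hI ht),
    fun t ht => h.deriv_zero_pos t (hI ht), fun t ht => h.deriv_time_im t (hI ht),
    fun t ht => h.equation t (hI ht)⟩

theorem IsStrongSuctionSolution.exists_regularSuctionFlow {b T : ℝ} {f : ℝ → ℂ → ℂ}
    (hf : IsStrongSuctionSolution b f) (h0 : 0 ≤ T) (hT : T < b) :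
    ∃ r M, RegularSuctionFlow T r M f (timeDeriv b f) := by
  -- A later time T' is needed so that right derivatives are available at T itself.
  obtain ⟨T', hTT', hT'b⟩ := exists_between hT
  have h0' : 0 ≤ T' := h0.trans hTT'.le
  obtain ⟨r₀, hr₀, hreg, hdiff, hcf, hcG⟩ := hf.regular T' h0' hT'b
  obtain ⟨R, hR1, hRr⟩ := exists_between hr₀
  obtain ⟨r, hr1, hrR⟩ := exists_between hR1
  set G := timeDeriv b f with hGdef
  have hI : Icc 0 T ⊆ Icc 0 T' := Icc_subset_Icc_right hTT'.le
  have hIb : Icc 0 T' ⊆ Ico 0 b := fun t ht => ⟨ht.1, ht.2.trans_lt hT'b⟩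
  have hcb : closedBall (0 : ℂ) R ⊆ ball 0 r₀ := closedBall_subset_ball hRr
  have hbb : ball (0 : ℂ) r ⊆ closedBall 0 R :=
    (ball_subset_ball hrR.le).trans ball_subset_closedBall
  have hder : ∀ s ∈ Icc 0 T', ∀ z ∈ ball (0 : ℂ) r₀,
      HasDerivWithinAt (fun s => f s z) (G s z) (Icc 0 T') s := fun s hs z hz =>
    (hdiff s hs z hz).hasDerivWithinAt.mono hIb
  have hsub : Icc 0 T' ×ˢ closedBall (0 : ℂ) R ⊆ Icc 0 T' ×ˢ ball 0 r₀ := prod_mono_right hcb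
  have hGd : ∀ t ∈ Icc 0 T, DifferentiableOn ℂ (G t) (ball 0 R) := fun t ht =>
    differentiableOn_time_deriv ht.1 (ht.2.trans_lt hTT')
      (fun s hs => (hreg s hs).1.mono (ball_subset_ball hRr.le))
      (fun s hs z hz => hder s hs z (hcb hz)) (hcG.mono hsub)
  have hcd := continuousOn_deriv_family (fun t ht => (hreg t ht).1) hcf
  have hne : ∀ t ∈ Icc 0 T', ∀ z ∈ ball (0 : ℂ) r₀, deriv (f t) z ≠ 0 := fun t ht z hz =>
    ((hreg t ht).1.analyticAt (isOpen_ball.mem_nhds hz)).deriv_ne_zero_of_injOn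
      (isOpen_ball.mem_nhds hz) (hreg t ht).2
  have hK : IsCompact (Icc 0 T' ×ˢ closedBall (0 : ℂ) R) :=
    isCompact_Icc.prod (isCompact_closedBall _ _)
  obtain ⟨M1, hM1⟩ := hK.exists_bound_of_continuousOn (hcG.mono hsub)
  obtain ⟨M2, hM2⟩ := hK.exists_bound_of_continuousOn (hcd.mono hsub)
  obtain ⟨M3, hM3⟩ := hK.exists_bound_of_continuousOn ((hcd.mono hsub).inv₀
    (fun p hp => hne p.1 hp.1 p.2 (hcb hp.2)))
  have hderT : ∀ t ∈ Icc 0 T, ∀ n, HasDerivWithinAt (fun s => taylorCoeffZero (f s) n)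
      (taylorCoeffZero (G t) n) (Ici t) t := fun t ht n =>
    hasDerivWithinAt_taylorCoeffZero (r := R) (R := r) ht.1 (ht.2.trans_lt hTT') (by linarith) hrR
      (fun s hs => (hreg s hs).1.mono (ball_subset_ball hRr.le)) (hGd t ht)
      (fun s hs z hz => hder s hs z (hcb (closedBall_subset_closedBall hrR.le hz)))
      (hcG.mono (prod_mono_right ((closedBall_subset_closedBall hrR.le).trans hcb))) n
  refine ⟨r, max M1 (max M2 M3), hr1, fun t ht => (hreg t (hI ht)).1.mono (hbb.trans hcb),
    fun t ht => (hGd t ht).mono (ball_subset_ball hrR.le),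
    fun t ht z hz => hne t (hI ht) z (hcb (hbb hz)),
    fun t ht z hz => (hM1 (t, z) ⟨hI ht, hbb hz⟩).trans (le_max_left _ _),
    fun t ht z hz => (hM2 (t, z) ⟨hI ht, hbb hz⟩).trans
      ((le_max_left _ _).trans (le_max_right _ _)),
    fun t ht z hz => (hM3 (t, z) ⟨hI ht, hbb hz⟩).trans
      ((le_max_right _ _).trans (le_max_right _ _)), hderT, fun n => ?_,
    fun t ht => hf.map_zero t (hIb (hI ht)), fun t ht => ?_,
    fun t ht => hf.deriv_zero_pos t (hIb (hI ht)), fun t ht => ?_,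
    fun t ht => hf.equation t (hIb (hI ht))⟩
  · have hlip : ∀ s ∈ Icc 0 T, ∀ t ∈ Icc 0 T,
        ‖taylorCoeffZero (f t) n - taylorCoeffZero (f s) n‖ ≤ M1 * ‖t - s‖ / R ^ n := by
      intro s hs t ht
      obtain ⟨r', hr', hr'r⟩ := exists_between hRr
      have hs' := (hreg s (hI hs)).1
      have ht' := (hreg t (hI ht)).1
      rw [← taylorCoeffZero_sub (by linarith) ht' hs']
      refine norm_taylorCoeffZero_le (ht'.fun_sub hs') (by linarith) hRr (fun z hz => ?_) n
      exact (convex_Icc 0 T').norm_image_sub_le_of_norm_hasDerivWithin_le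
        (fun x hx => hder x hx z (hcb hz)) (fun x hx => hM1 (x, z) ⟨hx, hz⟩) (hI hs) (hI ht)
    intro t ht
    have hz : Tendsto (fun s => M1 * ‖s - t‖ / R ^ n) (𝓝[Icc 0 T] t) (𝓝 0) := by
      have : Continuous fun s => M1 * ‖s - t‖ / R ^ n := by fun_prop
      have h2 := this.tendsto t
      simp only [sub_self, norm_zero, mul_zero, zero_div] at h2
      exact h2.mono_left nhdsWithin_le_nhds
    rw [ContinuousWithinAt, tendsto_iff_norm_sub_tendsto_zero]
    refine squeeze_zero' (Eventually.of_forall fun _ => norm_nonneg _) ?_ hz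
    filter_upwards [self_mem_nhdsWithin] with s hs using hlip t ht s hs
  · have : timeDeriv b f t 0 = derivWithin (fun _ => (0 : ℂ)) (Ico 0 b) t :=
      derivWithin_congr (fun s hs => hf.map_zero s hs) (hf.map_zero t (hIb (hI ht)))
    rw [hGdef, this]
    simp
  -- The imaginary part of f'(0,s) vanishes for s ≥ t near t, so its right derivative at t vanishes.
  · have h1 := hderT t ht 1
    simp only [taylorCoeffZero_one] at h1
    have h2 : HasDerivWithinAt (fun s => (deriv (f s) 0).im) (deriv (G t) 0).im (Ici t) t :=
      Complex.imCLM.hasFDerivAt.comp_hasDerivWithinAt t h1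
    have h3 : HasDerivWithinAt (fun s => (deriv (f s) 0).im) 0 (Ici t) t := by
      refine (hasDerivWithinAt_const t (Ici t) (0 : ℝ)).congr_of_eventuallyEq ?_
        (hf.deriv_zero_pos t (hIb (hI ht))).2
      filter_upwards [Ico_mem_nhdsGE (ht.2.trans_lt hT)] with s hs
      exact (hf.deriv_zero_pos s ⟨ht.1.trans hs.1, hs.2⟩).2
    exact (uniqueDiffWithinAt_Ici t).eq_deriv _ h2 h3

/-- Shrinking the radius by e^{-x} multiplies the n-th weight by e^{nx}: this is the growth that
pays for a derivative. -/
theorem seqWeight_mul_exp_neg {ρ x : ℝ} (n : ℕ) :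
    seqWeight (ρ * Real.exp (-x)) n = seqWeight ρ n * Real.exp (n * x) := by
  rw [seqWeight, seqWeight, mul_pow, ← Real.exp_nat_mul, mul_neg, Real.exp_neg, ← mul_assoc,
    mul_inv _ (Real.exp _)⁻¹, inv_inv]

/-- The differential inequality at one instant: `f_t - g_t` loses one derivative of `f - g`. -/
theorem RegularSuctionFlow.exists_diff_bound {T r M : ℝ} {f G g H : ℝ → ℂ → ℂ}
    (hf : RegularSuctionFlow T r M f G) (hg : RegularSuctionFlow T r M g H) :
    ∃ ρ₀ C A : ℝ, 1 < ρ₀ ∧ 0 < C ∧ ∀ t ∈ Icc 0 T, ∀ ρ ∈ Icc 1 ρ₀,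
      (∀ n : ℕ, n * ‖taylorCoeffZero (f t) n - taylorCoeffZero (g t) n‖ ≤ A * seqWeight ρ n) ∧
      ∀ κ, (∀ n : ℕ, n * ‖taylorCoeffZero (f t) n - taylorCoeffZero (g t) n‖ ≤ κ * seqWeight ρ n) →
        ∀ n, ‖taylorCoeffZero (G t) n - taylorCoeffZero (H t) n‖ ≤ C * κ * seqWeight ρ n := by
  have hr1 := hf.one_lt
  have hr0 : 0 < r := by linarith
  obtain ⟨R, hR1, hRr⟩ := exists_between hr1
  obtain ⟨ρ₀, hρ₀1, hρ₀R⟩ := exists_between hR1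
  obtain ⟨A, hA0, hA⟩ := exists_sq_mul_geometric_le (q := ρ₀ / R) (by positivity)
    ((div_lt_one (by linarith)).2 hρ₀R)
  -- The constant is 256 = 8·4·8: a convolution for Y, a `hermProj` for Q, and a convolution for D =
  -- ξ f' Q. The +1 ensures C > 0.
  refine ⟨ρ₀, 256 * r * |M| ^ 4 * A ^ 3 + 1, r * (|M| + |M|) * A, hρ₀1, by positivity,
    fun t ht ρ hρ => ?_⟩
  have hρ0 : 0 < ρ := by linarith [hρ.1]
  have hdom : ∀ (φ : ℂ → ℂ) (K : ℝ), DifferentiableOn ℂ φ (ball 0 r) →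
      (∀ z ∈ ball (0 : ℂ) r, ‖φ z‖ ≤ K) → Dominated ρ (K * A) (taylorCoeffZero φ) :=
    fun φ K hφ hK => dominated_taylorCoeffZero hφ hρ0 (by linarith) hRr
      (fun z hz => hK z (closedBall_subset_ball hRr hz)) fun n => by
        refine le_trans ?_ (hA n)
        gcongr
        exact hρ.2
  have df := hf.diff t ht
  have dg := hg.diff t ht
  have df' := df.deriv isOpen_ball
  have dg' := dg.deriv isOpen_ball
  have hMabs := le_abs_self M
  have hw (n : ℕ) : taylorCoeffZero (fun z => z * (deriv (g t) z - deriv (f t) z)) n =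
      n * (taylorCoeffZero (g t) n - taylorCoeffZero (f t) n) := by
    rw [← taylorCoeffZero_sub hr0 dg df, ← taylorCoeffZero_id_mul_deriv hr0 (dg.fun_sub df)]
    refine congrFun (taylorCoeffZero_congr hr0 (differentiableOn_id.mul (dg'.fun_sub df'))
      fun z hz => ?_) n
    show _ = z * deriv (fun z => g t z - f t z) z
    rw [deriv_fun_sub (dg.differentiableAt (isOpen_ball.mem_nhds hz))
      (df.differentiableAt (isOpen_ball.mem_nhds hz))]
    rfl
  have hnw (n : ℕ) : ‖taylorCoeffZero (fun z => z * (deriv (g t) z - deriv (f t) z)) n‖ =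
      n * ‖taylorCoeffZero (f t) n - taylorCoeffZero (g t) n‖ := by
    rw [hw, norm_mul, Complex.norm_natCast, norm_sub_rev]
  have dzw : DifferentiableOn ℂ (fun z => z * (deriv (g t) z - deriv (f t) z)) (ball 0 r) :=
    differentiableOn_id.fun_mul (dg'.fun_sub df')
  constructor
  · intro n
    rw [← hnw]
    refine hdom _ (r * (|M| + |M|)) dzw (fun z hz => ?_) n
    rw [norm_mul]
    refine mul_le_mul (mem_ball_zero_iff.1 hz).le ((norm_sub_le _ _).trans ?_) (norm_nonneg _) hr0.le
    exact add_le_add ((hg.norm_deriv_le t ht z hz).trans hMabs)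
      ((hf.norm_deriv_le t ht z hz).trans hMabs)
  intro κ hκ
  let h : ℂ → ℂ := fun z => (deriv (f t) z)⁻¹
  have dh : DifferentiableOn ℂ h (ball 0 r) := df'.inv (hf.deriv_ne_zero t ht)
  let D : ℂ → ℂ := fun z => G t z - H t z
  have dD : DifferentiableOn ℂ D (ball 0 r) := (hf.diff_time t ht).sub (hg.diff_time t ht)
  have hD0 : D 0 = 0 := by simp [D, hf.time_zero t ht, hg.time_zero t ht]
  have hmem0 : ball (0 : ℂ) r ∈ 𝓝 0 := ball_mem_nhds _ hr0
  -- Q = D/(ξ f') is analytic because D(0) = 0. Subtracting the two boundary equations determines Re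
  -- Q on the circle as Re(Y conj B), where Y carries the only derivative of g - f, and this
  -- determines Q.
  let Q : ℂ → ℂ := fun z => dslope D 0 z * h z
  have dQ : DifferentiableOn ℂ Q (ball 0 r) :=
    ((Complex.differentiableOn_dslope hmem0).2 dD).mul dh
  have hDQ : ∀ z ∈ ball (0 : ℂ) r, D z = z * deriv (f t) z * Q z := fun z hz => by
    have h1 := sub_smul_dslope D 0 z
    rw [sub_zero, hD0, sub_zero, smul_eq_mul] at h1
    have := hf.deriv_ne_zero t ht z hz
    simp only [Q, h]
    field_simp
    exact h1.symm
  let Y : ℂ → ℂ := fun z => z * (deriv (g t) z - deriv (f t) z) * h z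
  have dY : DifferentiableOn ℂ Y (ball 0 r) := dzw.fun_mul dh
  let B : ℂ → ℂ := fun z => H t z * h z
  have dB : DifferentiableOn ℂ B (ball 0 r) := (hg.diff_time t ht).fun_mul dh
  have hQ0 : (Q 0).im = 0 := by
    have e1 : deriv D 0 = deriv (G t) 0 - deriv (H t) 0 :=
      deriv_fun_sub ((hf.diff_time t ht).differentiableAt hmem0)
        ((hg.diff_time t ht).differentiableAt hmem0)
    simp only [Q, h, dslope_same, e1, Complex.mul_im, Complex.inv_im, Complex.sub_im,
      (hf.deriv_zero_pos t ht).2, hf.deriv_time_im t ht, hg.deriv_time_im t ht]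
    simp
  have hre : ∀ z : ℂ, ‖z‖ = 1 → (Q z).re = (Y z * (starRingEnd ℂ) (B z)).re := by
    intro z hz
    have hzr : z ∈ ball (0 : ℂ) r := by simp [hz, hr1]
    have e1 := hf.equation t ht z hz
    have e2 := hg.equation t ht z hz
    have hne := hf.deriv_ne_zero t ht z hzr
    have e3 : G t z = H t z + z * deriv (f t) z * Q z := by rw [← hDQ z hzr]; simp [D]
    have hzz : z * (starRingEnd ℂ) z = 1 := by
      rw [Complex.mul_conj, Complex.normSq_eq_norm_sq, hz]; norm_num
    set d := deriv (f t) z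
    set d' := deriv (g t) z
    have e4 : G t z * (starRingEnd ℂ) (d * z) =
        H t z * (starRingEnd ℂ) (d * z) + (d * (starRingEnd ℂ) d) * Q z := by
      rw [e3, map_mul]
      linear_combination (d * Q z * (starRingEnd ℂ) d) * hzz
    have e5 : (d * (starRingEnd ℂ) d) * (Y z * (starRingEnd ℂ) (B z)) =
        z * (d' - d) * (starRingEnd ℂ) (H t z) := by
      have hd' : (starRingEnd ℂ) d ≠ 0 := (map_ne_zero _).2 hne
      change d * (starRingEnd ℂ) d * (z * (d' - d) * d⁻¹ * (starRingEnd ℂ) (H t z * d⁻¹)) = _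
      rw [map_mul, map_inv₀]
      field_simp
    have e6 : (z * (d' - d) * (starRingEnd ℂ) (H t z)).re =
        (H t z * (starRingEnd ℂ) (d' * z)).re - (H t z * (starRingEnd ℂ) (d * z)).re := by
      rw [← Complex.conj_re, ← Complex.sub_re]
      congr 1
      simp only [map_mul, map_sub, Complex.conj_conj]
      ring
    have hnn : d * (starRingEnd ℂ) d = ((Complex.normSq d : ℝ) : ℂ) := Complex.mul_conj d
    rw [e4, hnn, Complex.add_re, Complex.re_ofReal_mul] at e1
    rw [hnn] at e5
    have e7 := congrArg Complex.re e5
    rw [Complex.re_ofReal_mul, e6, e2] at e7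
    have : Complex.normSq d ≠ 0 := by simpa [Complex.normSq_eq_zero] using hne
    have : Complex.normSq d * (Q z).re = Complex.normSq d * (Y z * (starRingEnd ℂ) (B z)).re := by
      rw [e7]; linarith
    exact mul_left_cancel₀ ‹_› this
  have hQc := taylorCoeffZero_eq_hermProj hr1 dQ dY dB hre hQ0
  have hYd : Dominated ρ (8 * κ * (|M| * A)) (taylorCoeffZero Y) := by
    have h1 : Dominated ρ κ
        (taylorCoeffZero (fun z => z * (deriv (g t) z - deriv (f t) z))) :=
      fun n => by rw [hnw]; exact hκ n
    have h2 := hdom h |M| dh fun z hz => (hf.norm_inv_le t ht z hz).trans hMabs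
    have h3 := h1.conv hρ0 h2
    intro n
    rw [taylorCoeffZero_mul hr0 dzw dh]
    exact h3 n
  have hBd := hdom B (|M| * |M|) dB fun z hz => by
    rw [norm_mul]
    exact mul_le_mul ((hg.norm_time_le t ht z hz).trans hMabs)
      ((hf.norm_inv_le t ht z hz).trans hMabs) (norm_nonneg _) (abs_nonneg _)
  have hQd := hYd.hermProj hρ.1 hBd
  rw [← hQc] at hQd
  have dzf : DifferentiableOn ℂ (fun z => z * deriv (f t) z) (ball 0 r) :=
    differentiableOn_id.fun_mul df'
  have hFd := hdom (fun z => z * deriv (f t) z) (r * |M|) dzf fun z hz => by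
    rw [norm_mul]
    exact mul_le_mul (mem_ball_zero_iff.1 hz).le ((hf.norm_deriv_le t ht z hz).trans hMabs)
      (norm_nonneg _) hr0.le
  have hfin := hFd.conv hρ0 hQd
  intro n
  rw [← taylorCoeffZero_sub hr0 (hf.diff_time t ht) (hg.diff_time t ht),
    congrFun (taylorCoeffZero_congr hr0 dD hDQ) n, taylorCoeffZero_mul hr0 dzf dQ]
  refine (hfin n).trans (mul_le_mul_of_nonneg_right ?_ (seqWeight_pos hρ0 n).le)
  have hκ0 : 0 ≤ κ := by simpa [seqWeight_zero] using hκ 0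
  nlinarith

/-- Integrating an exponential of rate μ gains 1/μ; with μ proportional to n this offsets one lost
derivative. -/
theorem norm_le_exp_of_norm_deriv_right_le {u u' : ℝ → ℂ} {a b K μ : ℝ} (hμ : 0 < μ) (hK : 0 ≤ K)
    (hc : ContinuousOn u (Icc a b)) (hd : ∀ x ∈ Ico a b, HasDerivWithinAt u (u' x) (Ici x) x)
    (hbd : ∀ x ∈ Ico a b, ‖u' x‖ ≤ K * Real.exp (μ * (x - a))) (ha : u a = 0) :
    ∀ x ∈ Icc a b, ‖u x‖ ≤ K / μ * Real.exp (μ * (x - a)) :=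
  fun _ hx => image_norm_le_of_norm_deriv_right_le_deriv_boundary hc hd
    (B := fun x => K / μ * Real.exp (μ * (x - a))) (B' := fun x => K * Real.exp (μ * (x - a)))
    (by rw [ha, norm_zero]; positivity)
    (fun x => by
      have h1 : HasDerivAt (fun x => μ * (x - a)) μ x := by
        simpa using ((hasDerivAt_id x).sub_const a).const_mul μ
      have := h1.exp.const_mul (K / μ)
      refine this.congr_deriv ?_
      rw [mul_comm (Real.exp _), ← mul_assoc, div_mul_cancel₀ _ hμ.ne']) hbd hx

/-- Along the radius ρ₀ e^{-2C(t-t₀)}, a bound κ for n|f_n - g_n| improves itself to κ/2, so it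
tends to 0. The step length log ρ₀/(2C) is the time for which this radius stays at least 1, and it
does not depend on t₀. -/
theorem RegularSuctionFlow.exists_uniqueness_step {T r M : ℝ} {f G g H : ℝ → ℂ → ℂ}
    (hf : RegularSuctionFlow T r M f G) (hg : RegularSuctionFlow T r M g H) :
    ∃ σ > 0, ∀ t₀ ∈ Icc 0 T, taylorCoeffZero (f t₀) = taylorCoeffZero (g t₀) →
      ∀ t ∈ Icc t₀ (min (t₀ + σ) T), taylorCoeffZero (f t) = taylorCoeffZero (g t) := by
  obtain ⟨ρ₀, C, A, hρ₀, hC, hbd⟩ := hf.exists_diff_bound hg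
  have hlog : 0 < Real.log ρ₀ := Real.log_pos hρ₀
  refine ⟨Real.log ρ₀ / (2 * C), by positivity, fun t₀ ht₀ heq => ?_⟩
  set t₁ := min (t₀ + Real.log ρ₀ / (2 * C)) T with ht₁
  set ρ : ℝ → ℝ := fun t => ρ₀ * Real.exp (-(2 * C * (t - t₀))) with hρdef
  have hI : Icc t₀ t₁ ⊆ Icc 0 T := Icc_subset_Icc ht₀.1 (min_le_right _ _)
  have hρ : ∀ t ∈ Icc t₀ t₁, ρ t ∈ Icc 1 ρ₀ := by
    intro t ht
    have h1 : 2 * C * (t - t₀) ≤ Real.log ρ₀ := by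
      have : t - t₀ ≤ Real.log ρ₀ / (2 * C) := by
        linarith [ht.2, min_le_left (t₀ + Real.log ρ₀ / (2 * C)) T]
      rw [le_div_iff₀ (by positivity)] at this
      linarith
    have h2 : 0 ≤ 2 * C * (t - t₀) := mul_nonneg (by positivity) (by linarith [ht.1])
    constructor
    · have : Real.exp (2 * C * (t - t₀)) ≤ ρ₀ := by
        rw [← Real.le_log_iff_exp_le (by linarith)]; exact h1
      simp only [hρdef, Real.exp_neg]
      rw [← div_eq_mul_inv, le_div_iff₀ (Real.exp_pos _)]
      linarith
    · exact mul_le_of_le_one_right (by linarith) (Real.exp_le_one_iff.2 (by linarith))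
  have hind : ∀ k : ℕ, ∀ t ∈ Icc t₀ t₁, ∀ n : ℕ,
      n * ‖taylorCoeffZero (f t) n - taylorCoeffZero (g t) n‖ ≤
        A / 2 ^ k * seqWeight (ρ t) n := by
    intro k
    induction k with
    | zero =>
      intro t ht n
      rw [pow_zero, div_one]
      exact (hbd t (hI ht) (ρ t) (hρ t ht)).1 n
    | succ k ih =>
      intro t ht n
      have hA : 0 ≤ A / 2 ^ k := by simpa [seqWeight_zero] using ih t ht 0
      -- The index 0 is separate because the exponential rate 2Cn vanishes there; the left side
      -- vanishes too.
      rcases n.eq_zero_or_pos with rfl | hn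
      · simp only [Nat.cast_zero, zero_mul, seqWeight_zero, mul_one]
        rw [pow_succ, ← div_div]
        linarith
      have hn' : (0 : ℝ) < n := Nat.cast_pos.2 hn
      have hw := seqWeight_pos (by linarith : 0 < ρ₀) n
      have hexp (x : ℝ) : seqWeight (ρ x) n = seqWeight ρ₀ n * Real.exp (n * (2 * C) * (x - t₀)) := by
        rw [hρdef, seqWeight_mul_exp_neg, mul_assoc (n : ℝ)]
      -- With rate 2Cn, integration turns Cκ into κ/(2n): the n is the lost derivative, and the 2 is
      -- the improvement.
      have := norm_le_exp_of_norm_deriv_right_le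
        (u := fun t => taylorCoeffZero (f t) n - taylorCoeffZero (g t) n)
        (u' := fun t => taylorCoeffZero (G t) n - taylorCoeffZero (H t) n)
        (a := t₀) (b := t₁) (K := C * (A / 2 ^ k) * seqWeight ρ₀ n) (μ := n * (2 * C))
        (by positivity) (by positivity)
        (((hf.continuousOn n).sub (hg.continuousOn n)).mono hI)
        (fun x hx => (hf.hasDeriv x (hI ⟨hx.1, hx.2.le⟩) n).fun_sub
          (hg.hasDeriv x (hI ⟨hx.1, hx.2.le⟩) n))
        (fun x hx => by
          have hx' : x ∈ Icc t₀ t₁ := ⟨hx.1, hx.2.le⟩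
          rw [mul_assoc _ (seqWeight ρ₀ n), ← hexp]
          exact (hbd x (hI hx') (ρ x) (hρ x hx')).2 _ (ih x hx') n)
        (by simp [heq]) t ht
      rw [hexp]
      calc _ ≤ n * (C * (A / 2 ^ k) * seqWeight ρ₀ n / (n * (2 * C)) *
            Real.exp (n * (2 * C) * (t - t₀))) := by gcongr
        _ = _ := by rw [pow_succ]; field_simp
  intro t ht
  ext n
  rcases n.eq_zero_or_pos with rfl | hn
  · simp [hf.map_zero t (hI ht), hg.map_zero t (hI ht)]
  have hlim : Tendsto (fun k : ℕ => A / 2 ^ k * seqWeight (ρ t) n) atTop (𝓝 0) := by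
    have h1 : Tendsto (fun k : ℕ => A * (1 / 2 : ℝ) ^ k * seqWeight (ρ t) n) atTop
        (𝓝 (A * 0 * seqWeight (ρ t) n)) :=
      ((tendsto_pow_atTop_nhds_zero_of_lt_one (by norm_num) (by norm_num)).const_mul A).mul_const _
    simpa [div_eq_mul_inv] using h1
  have h0 := ge_of_tendsto' hlim fun k => hind k t ht n
  have hn' : (0 : ℝ) < n := Nat.cast_pos.2 hn
  have : ‖taylorCoeffZero (f t) n - taylorCoeffZero (g t) n‖ = 0 :=
    le_antisymm (nonpos_of_mul_nonpos_right h0 hn') (norm_nonneg _)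
  exact sub_eq_zero.1 (norm_eq_zero.1 this)

/-- As the uniqueness step has a uniform length σ, finitely many steps cover [0,T]. -/
theorem RegularSuctionFlow.taylorCoeffZero_eq {T r M : ℝ} {f G g H : ℝ → ℂ → ℂ}
    (hf : RegularSuctionFlow T r M f G) (hg : RegularSuctionFlow T r M g H)
    (h0 : taylorCoeffZero (f 0) = taylorCoeffZero (g 0)) :
    ∀ t ∈ Icc 0 T, taylorCoeffZero (f t) = taylorCoeffZero (g t) := by
  obtain ⟨σ, hσ, hstep⟩ := hf.exists_uniqueness_step hg
  have hind : ∀ k : ℕ, ∀ t ∈ Icc 0 T, t ≤ k * σ →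
      taylorCoeffZero (f t) = taylorCoeffZero (g t) := by
    intro k
    induction k with
    | zero =>
      intro t ht htk
      have : t = 0 := le_antisymm (by simpa using htk) ht.1
      rwa [this]
    | succ k ih =>
      intro t ht htk
      rcases le_total t (k * σ) with h | h
      · exact ih t ht h
      have hk : (k : ℝ) * σ ∈ Icc 0 T := ⟨by positivity, h.trans ht.2⟩
      exact hstep _ hk (ih _ hk le_rfl) t ⟨h, le_min (by push_cast at htk; linarith) ht.2⟩
  intro t ht
  obtain ⟨k, hk⟩ := exists_nat_ge (t / σ)
  exact hind k t ht ((div_le_iff₀ hσ).1 hk)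

/-- Strong solutions with the same initial function have the same Taylor coefficients. -/
theorem IsStrongSuctionSolution.taylorCoeffZero_eq {b b' : ℝ} {f g : ℝ → ℂ → ℂ}
    (hf : IsStrongSuctionSolution b f) (hg : IsStrongSuctionSolution b' g)
    (h0 : EqOn (f 0) (g 0) (ball 0 1)) {t : ℝ} (ht : 0 ≤ t) (htb : t < b) (htb' : t < b') :
    taylorCoeffZero (f t) = taylorCoeffZero (g t) := by
  obtain ⟨r, M, hF⟩ := hf.exists_regularSuctionFlow ht htb
  obtain ⟨r', M', hG⟩ := hg.exists_regularSuctionFlow ht htb'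
  have h1 : 1 < min r r' := lt_min hF.one_lt hG.one_lt
  have h0t : (0 : ℝ) ∈ Icc 0 t := ⟨le_rfl, ht⟩
  exact (hF.mono le_rfl (min_le_left _ _) h1 (le_max_left M M')).taylorCoeffZero_eq
    (hG.mono le_rfl (min_le_right _ _) h1 (le_max_right M M'))
    (taylorCoeffZero_congr one_pos
      ((hF.diff 0 h0t).mono (ball_subset_ball hF.one_lt.le)) h0) t ⟨ht, le_rfl⟩

theorem eqOn_of_taylorCoeffZero_eq {f g : ℂ → ℂ} {r : ℝ} (hf : DifferentiableOn ℂ f (ball 0 r))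
    (hg : DifferentiableOn ℂ g (ball 0 r)) (h : taylorCoeffZero f = taylorCoeffZero g) :
    EqOn f g (ball 0 r) := fun _ hz =>
  (hasSum_taylorCoeffZero hf hz).unique (h ▸ hasSum_taylorCoeffZero hg hz)

/-! ### The blow-up time is finite -/

/-- The analytic function Q = f_t/(ξ f') has real part -|h|² on the circle, where h = 1/f'. So Q(0)
is minus the mean of |h|², which by Parseval is at most -|h(0)|²; and Q(0) is the quotient of the
derivatives of f_t and f at 0. -/
theorem RegularSuctionFlow.sq_deriv_le {T r M : ℝ} {f G : ℝ → ℂ → ℂ}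
    (hf : RegularSuctionFlow T r M f G) {t : ℝ} (ht : t ∈ Icc 0 T) :
    (deriv (f t) 0).re * (deriv (G t) 0).re ≤ -1 := by
  have hr1 := hf.one_lt
  have hr0 : 0 < r := by linarith
  have hmem0 : ball (0 : ℂ) r ∈ 𝓝 0 := ball_mem_nhds _ hr0
  have h0r : (0 : ℂ) ∈ ball (0 : ℂ) r := by simp [hr0]
  have df := hf.diff t ht
  have df' := df.deriv isOpen_ball
  let h : ℂ → ℂ := fun z => (deriv (f t) z)⁻¹
  have dh : DifferentiableOn ℂ h (ball 0 r) := df'.inv (hf.deriv_ne_zero t ht)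
  have dmh : DifferentiableOn ℂ (fun z => (-1 : ℂ) * h z) (ball 0 r) := dh.const_mul _
  let Q : ℂ → ℂ := fun z => dslope (G t) 0 z * h z
  have dQ : DifferentiableOn ℂ Q (ball 0 r) :=
    ((Complex.differentiableOn_dslope hmem0).2 (hf.diff_time t ht)).mul dh
  obtain ⟨ha, ha'⟩ := hf.deriv_zero_pos t ht
  have hQ0 : Q 0 = (((deriv (G t) 0).re / (deriv (f t) 0).re : ℝ) : ℂ) := by
    have e1 : deriv (G t) 0 = ((deriv (G t) 0).re : ℂ) :=
      Complex.ext rfl (by simp [hf.deriv_time_im t ht])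
    have e2 : deriv (f t) 0 = ((deriv (f t) 0).re : ℂ) := Complex.ext rfl (by simp [ha'])
    simp only [Q, h, dslope_same]
    rw [e1, e2]
    push_cast
    simp [div_eq_mul_inv]
  have hre : ∀ z : ℂ, ‖z‖ = 1 → (Q z).re = ((-1 * h z) * (starRingEnd ℂ) (h z)).re := by
    intro z hz
    have hzr : z ∈ ball (0 : ℂ) r := by simp [hz, hr1]
    have e1 := hf.equation t ht z hz
    have hne := hf.deriv_ne_zero t ht z hzr
    have hzz : z * (starRingEnd ℂ) z = 1 := by
      rw [Complex.mul_conj, Complex.normSq_eq_norm_sq, hz]; norm_num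
    have h1 := sub_smul_dslope (G t) 0 z
    rw [sub_zero, hf.time_zero t ht, sub_zero, smul_eq_mul] at h1
    set d := deriv (f t) z
    have e2 : G t z * (starRingEnd ℂ) (d * z) = (d * (starRingEnd ℂ) d) * Q z := by
      have : Q z = dslope (G t) 0 z * d⁻¹ := rfl
      rw [this, ← h1, map_mul]
      field_simp
      linear_combination (dslope (G t) 0 z * (starRingEnd ℂ) d) * hzz
    have e3 : (d * (starRingEnd ℂ) d) * ((-1 * h z) * (starRingEnd ℂ) (h z)) = -1 := by
      have hd' : (starRingEnd ℂ) d ≠ 0 := (map_ne_zero _).2 hne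
      change d * (starRingEnd ℂ) d * (-1 * d⁻¹ * (starRingEnd ℂ) d⁻¹) = -1
      rw [map_inv₀]
      field_simp
    have hnn : d * (starRingEnd ℂ) d = ((Complex.normSq d : ℝ) : ℂ) := Complex.mul_conj d
    rw [e2, hnn, Complex.re_ofReal_mul] at e1
    rw [hnn] at e3
    have e4 := congrArg Complex.re e3
    rw [Complex.re_ofReal_mul] at e4
    have hn : Complex.normSq d ≠ 0 := by simpa [Complex.normSq_eq_zero] using hne
    refine mul_left_cancel₀ hn ?_
    rw [e1, e4]; simp
  have hQc := congrFun (taylorCoeffZero_eq_hermProj hr1 dQ dmh dh hre (by rw [hQ0]; simp)) 0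
  have hterm : ∀ l, taylorCoeffZero (fun z => (-1 : ℂ) * h z) l *
      (starRingEnd ℂ) (taylorCoeffZero h l) = ((-(‖taylorCoeffZero h l‖ ^ 2) : ℝ) : ℂ) := fun l => by
    rw [taylorCoeffZero_const_mul hr0 _ dh, mul_assoc, Complex.mul_conj, Complex.normSq_eq_norm_sq]
    push_cast; ring
  have hcorr : corr (taylorCoeffZero fun z => (-1 : ℂ) * h z) (taylorCoeffZero h) 0 =
      ((-∑' l, ‖taylorCoeffZero h l‖ ^ 2 : ℝ) : ℂ) := by
    simp only [corr, add_zero, hterm]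
    rw [← Complex.ofReal_tsum, tsum_neg]
  rw [hermProj, ← conj_corr_zero _ (taylorCoeffZero h), Complex.add_conj, hcorr, if_pos rfl,
    taylorCoeffZero_zero, hQ0] at hQc
  have hQr : (deriv (G t) 0).re / (deriv (f t) 0).re = -∑' l, ‖taylorCoeffZero h l‖ ^ 2 := by
    rw [Complex.ofReal_re] at hQc
    have := congrArg Complex.re hQc
    rw [Complex.ofReal_re] at this
    rw [this]
    simp
  -- The coefficients are absolutely summable because 1 lies inside the disk of analyticity;
  -- eventually the squares are smaller than the terms.
  have hsum : Summable fun l => ‖taylorCoeffZero h l‖ ^ 2 := by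
    have hs := (hasSum_taylorCoeffZero dh (z := 1) (by simpa using hr1)).summable.norm
    simp only [one_pow, mul_one] at hs
    refine Summable.of_norm_bounded_eventually_nat hs ?_
    filter_upwards [hs.tendsto_atTop_zero.eventually (gt_mem_nhds one_pos)] with l hl
    rw [Real.norm_of_nonneg (by positivity)]
    nlinarith [norm_nonneg (taylorCoeffZero h l)]
  have hle := hsum.le_tsum 0 fun _ _ => by positivity
  rw [taylorCoeffZero_zero] at hle
  have hh0 : ‖h 0‖ ^ 2 = ((deriv (f t) 0).re ^ 2)⁻¹ := by
    have e2 : deriv (f t) 0 = ((deriv (f t) 0).re : ℂ) := Complex.ext rfl (by simp [ha'])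
    simp only [h]
    rw [e2, norm_inv, Complex.norm_real, Complex.ofReal_re, inv_pow, Real.norm_eq_abs, sq_abs]
  rw [hh0] at hle
  have : (deriv (G t) 0).re = -(∑' l, ‖taylorCoeffZero h l‖ ^ 2) * (deriv (f t) 0).re := by
    rw [← hQr]; field_simp
  rw [this]
  have h3 : 1 ≤ (∑' l, ‖taylorCoeffZero h l‖ ^ 2) * (deriv (f t) 0).re ^ 2 := by
    rwa [inv_le_iff_one_le_mul₀ (by positivity)] at hle
  nlinarith

/-- The square of f'(0,t) decreases at rate at least 2 but must stay positive. -/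
theorem IsStrongSuctionSolution.blowup_time_le {b : ℝ} {f : ℝ → ℂ → ℂ}
    (hf : IsStrongSuctionSolution b f) : b ≤ (deriv (f 0) 0).re ^ 2 / 2 := by
  by_contra hcon
  push Not at hcon
  set T := (deriv (f 0) 0).re ^ 2 / 2
  have hT0 : 0 ≤ T := by positivity
  obtain ⟨r, M, hF⟩ := hf.exists_regularSuctionFlow hT0 hcon
  set a : ℝ → ℝ := fun t => (deriv (f t) 0).re
  have hd : ∀ t ∈ Icc 0 T, HasDerivWithinAt a (deriv (timeDeriv b f t) 0).re (Ici t) t := by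
    intro t ht
    have h1 := hF.hasDeriv t ht 1
    simp only [taylorCoeffZero_one] at h1
    exact Complex.reCLM.hasFDerivAt.comp_hasDerivWithinAt t h1
  have hc : ContinuousOn a (Icc 0 T) := by
    have := hF.continuousOn 1
    simp only [taylorCoeffZero_one] at this
    exact Complex.continuous_re.comp_continuousOn this
  have hle := image_le_of_deriv_right_le_deriv_boundary (f := fun t => a t ^ 2)
    (f' := fun t => 2 * a t * (deriv (timeDeriv b f t) 0).re) (a := 0) (b := T)
    (B := fun t => a 0 ^ 2 - 2 * t) (B' := fun _ => -2) (hc.pow 2)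
    (fun t ht => by simpa using (hd t ⟨ht.1, ht.2.le⟩).fun_pow 2) (by simp) (by fun_prop)
    (fun t _ => by
      have := ((hasDerivAt_id t).const_mul (2 : ℝ)).const_sub (a 0 ^ 2)
      simpa using this.hasDerivWithinAt)
    (fun t ht => by
      have := hF.sq_deriv_le ⟨ht.1, ht.2.le⟩
      show 2 * a t * (deriv (timeDeriv b f t) 0).re ≤ -2
      have e : a t = (deriv (f t) 0).re := rfl
      rw [e]; linarith)
  have h1 := hle ⟨hT0, le_rfl⟩
  have h2 : 0 < a T := (hF.deriv_zero_pos T ⟨hT0, le_rfl⟩).1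
  have h3 : a 0 ^ 2 - 2 * T = 0 := by simp only [T, a]; ring
  simp only [h3] at h1
  nlinarith

/-! ### The maximal strong solution -/

theorem IsStrongSuctionSolution.eqOn_closedBall {b b' : ℝ} {f g : ℝ → ℂ → ℂ}
    (hf : IsStrongSuctionSolution b f) (hg : IsStrongSuctionSolution b' g)
    (h0 : EqOn (f 0) (g 0) (ball 0 1)) {t : ℝ} (ht : 0 ≤ t) (htb : t < b) (htb' : t < b') :
    EqOn (f t) (g t) (closedBall 0 1) := by
  obtain ⟨r, hr, hF, -⟩ := hf.regular t ht htb
  obtain ⟨r', hr', hG, -⟩ := hg.regular t ht htb'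
  have htt : t ∈ Icc 0 t := ⟨ht, le_rfl⟩
  exact (eqOn_of_taylorCoeffZero_eq (r := min r r')
    ((hF t htt).1.mono (ball_subset_ball (min_le_left _ _)))
    ((hG t htt).1.mono (ball_subset_ball (min_le_right _ _)))
    (hf.taylorCoeffZero_eq hg h0 ht htb htb')).mono (closedBall_subset_ball (lt_min hr hr'))

theorem hasDerivWithinAt_timeDeriv {b t : ℝ} {f : ℝ → ℂ → ℂ} {ξ : ℂ}
    (h : DifferentiableWithinAt ℝ (fun s => f s ξ) (Ico 0 b) t) :
    HasDerivWithinAt (fun s => f s ξ) (timeDeriv b f t ξ) (Ico 0 b) t := h.hasDerivWithinAt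

theorem timeDeriv_eq {b t : ℝ} {f : ℝ → ℂ → ℂ} {ξ v : ℂ} (ht : t ∈ Ico 0 b)
    (h : HasDerivWithinAt (fun s => f s ξ) v (Ico 0 b) t) : timeDeriv b f t ξ = v :=
  h.derivWithin (uniqueDiffOn_Ico 0 b t ht)

/-- Being a strong solution is a local property in time. -/
theorem isStrongSuctionSolution_of_local {b : ℝ} {f : ℝ → ℂ → ℂ}
    (h : ∀ T, 0 ≤ T → T < b → ∃ b' g, T < b' ∧ IsStrongSuctionSolution b' g ∧
      ∀ T' < b', ∃ r > 1, ∀ r' ≤ r, ∀ t ∈ Icc 0 T', DifferentiableOn ℂ (g t) (ball 0 r') →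
        EqOn (f t) (g t) (ball 0 r')) : IsStrongSuctionSolution b f := by
  have key : ∀ T, 0 ≤ T → T < b → ∃ b' g r, T < b' ∧ 1 < r ∧ IsStrongSuctionSolution b' g ∧
      (∀ t ∈ Icc 0 T, DifferentiableOn ℂ (g t) (ball 0 r) ∧ InjOn (g t) (ball 0 r)) ∧
      ContinuousOn (fun p : ℝ × ℂ => g p.1 p.2) (Icc 0 T ×ˢ ball 0 r) ∧
      ContinuousOn (fun p : ℝ × ℂ => timeDeriv b' g p.1 p.2) (Icc 0 T ×ˢ ball 0 r) ∧
      (∀ t ∈ Icc 0 T, EqOn (f t) (g t) (ball 0 r)) ∧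
      (∀ t ∈ Icc 0 T, ∀ ξ ∈ ball (0 : ℂ) r,
        HasDerivWithinAt (fun s => f s ξ) (timeDeriv b' g t ξ) (Ico 0 b) t) := by
    intro T hT hTb
    obtain ⟨b', g, hTb', hg, hfg⟩ := h T hT hTb
    obtain ⟨T', hTT', hT'b'⟩ := exists_between hTb'
    obtain ⟨r₁, hr₁, heq⟩ := hfg T' hT'b'
    obtain ⟨r₂, hr₂, hreg, hdiff, hc, hct⟩ := hg.regular T' (hT.trans hTT'.le) hT'b'
    have hI : Icc 0 T ⊆ Icc 0 T' := Icc_subset_Icc_right hTT'.le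
    have hb : ball (0 : ℂ) (min r₁ r₂) ⊆ ball 0 r₂ := ball_subset_ball (min_le_right _ _)
    have heq' : ∀ t ∈ Icc 0 T', EqOn (f t) (g t) (ball 0 (min r₁ r₂)) := fun t ht =>
      heq _ (min_le_left _ _) t ht ((hreg t ht).1.mono hb)
    refine ⟨b', g, min r₁ r₂, hTb', lt_min hr₁ hr₂, hg,
      fun t ht => ⟨(hreg t (hI ht)).1.mono hb, (hreg t (hI ht)).2.mono hb⟩,
      hc.mono (prod_mono hI hb), hct.mono (prod_mono hI hb), fun t ht => heq' t (hI ht), ?_⟩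
    intro t ht ξ hξ
    have htT' : t < T' := ht.2.trans_lt hTT'
    have h1 := hasDerivWithinAt_timeDeriv (hdiff t (hI ht) ξ (hb hξ))
    have hev : ∀ᶠ s in 𝓝[Ico 0 b] t, s ∈ Icc 0 T' := by
      filter_upwards [self_mem_nhdsWithin, nhdsWithin_le_nhds (Iio_mem_nhds htT')] with s hs hs'
      exact ⟨hs.1, le_of_lt hs'⟩
    have h2 : HasDerivWithinAt (fun s => g s ξ) (timeDeriv b' g t ξ) (Ico 0 b) t := by
      refine h1.mono_of_mem_nhdsWithin ?_
      filter_upwards [hev] with s hs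
      exact ⟨hs.1, hs.2.trans_lt hT'b'⟩
    refine h2.congr_of_eventuallyEq ?_ (heq' t (hI ht) hξ)
    filter_upwards [hev] with s hs
    exact heq' s hs hξ
  constructor
  · intro T hT hTb
    obtain ⟨b', g, r, hTb', hr, hg, hreg, hc, hct, heq, hder⟩ := key T hT hTb
    refine ⟨r, hr, fun t ht => ⟨(hreg t ht).1.congr (heq t ht), ?_⟩,
      fun t ht ξ hξ => (hder t ht ξ hξ).differentiableWithinAt,
      hc.congr fun p hp => heq p.1 hp.1 hp.2, hct.congr fun p hp => ?_⟩
    · exact (hreg t ht).2.congr (heq t ht).symm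
    · exact timeDeriv_eq ⟨hp.1.1, hp.1.2.trans_lt hTb⟩ (hder p.1 hp.1 p.2 hp.2)
  all_goals
    intro t ht
    obtain ⟨b', g, r, hTb', hr, hg, hreg, hc, hct, heq, hder⟩ := key t ht.1 ht.2
    have htt : t ∈ Icc 0 t := ⟨ht.1, le_rfl⟩
    have htb' : t ∈ Ico 0 b' := ⟨ht.1, hTb'⟩
    have h0 : (0 : ℂ) ∈ ball (0 : ℂ) r := by simp; linarith
    have hd : ∀ ξ ∈ ball (0 : ℂ) r, deriv (f t) ξ = deriv (g t) ξ := fun ξ hξ =>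
      ((heq t htt).eventuallyEq_of_mem (isOpen_ball.mem_nhds hξ)).deriv_eq
  · rw [heq t htt h0]; exact hg.map_zero t htb'
  · rw [hd 0 h0]; exact hg.deriv_zero_pos t htb'
  · intro ξ hξ
    have hξr : ξ ∈ ball (0 : ℂ) r := by simp [hξ, hr]
    rw [hd ξ hξr, timeDeriv_eq ht (hder t htt ξ hξr)]
    exact hg.equation t htb' ξ hξ

/-- A strong solution extends to the maximal one. -/
theorem IsStrongSuctionSolution.exists_maximal {f₀ : ℂ → ℂ} {b₀ : ℝ} {g₀ : ℝ → ℂ → ℂ}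
    (hb₀ : 0 < b₀) (hg₀ : IsStrongSuctionSolution b₀ g₀) (hi : EqOn (g₀ 0) f₀ (ball 0 1)) :
    ∃ b f, IsMaximalStrongSuctionSolution f₀ b f ∧ b₀ ≤ b := by
  let S : Set ℝ := {b | ∃ g, IsStrongSuctionSolution b g ∧ EqOn (g 0) f₀ (ball 0 1)}
  have hS : BddAbove S := by
    refine ⟨(deriv f₀ 0).re ^ 2 / 2, ?_⟩
    rintro b ⟨g, hg, hgi⟩
    rw [← (hgi.eventuallyEq_of_mem (ball_mem_nhds 0 one_pos)).deriv_eq]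
    exact hg.blowup_time_le
  have hb₀S : b₀ ∈ S := ⟨g₀, hg₀, hi⟩
  -- By uniqueness the coefficients at time t do not depend on the solution chosen. If no solution
  -- reaches t, the value 0 is a harmless default.
  have hcoef : ∀ t : ℝ, ∃ a : ℕ → ℂ, ∀ b' g, 0 ≤ t → t < b' → IsStrongSuctionSolution b' g →
      EqOn (g 0) f₀ (ball 0 1) → taylorCoeffZero (g t) = a := by
    intro t
    by_cases hex : ∃ b' g, t < b' ∧ IsStrongSuctionSolution b' g ∧ EqOn (g 0) f₀ (ball 0 1)
    · obtain ⟨b₁, g₁, htb₁, hg₁, hi₁⟩ := hex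
      exact ⟨taylorCoeffZero (g₁ t), fun b' g ht htb' hg hgi =>
        hg.taylorCoeffZero_eq hg₁ (hgi.trans hi₁.symm) ht htb' htb₁⟩
    · exact ⟨0, fun b' g _ htb' hg hgi => absurd ⟨b', g, htb', hg, hgi⟩ hex⟩
  choose a ha using hcoef
  -- Summing the common power series, rather than choosing a solution for each t, makes f agree with
  -- every solution wherever that solution is analytic around 0, beyond the unit disk included.
  let f : ℝ → ℂ → ℂ := fun t => powerSum (a t)
  have hfg : ∀ b' g, IsStrongSuctionSolution b' g → EqOn (g 0) f₀ (ball 0 1) →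
      ∀ t, 0 ≤ t → t < b' → ∀ r, DifferentiableOn ℂ (g t) (ball 0 r) →
        EqOn (f t) (g t) (ball 0 r) := by
    intro b' g hg hgi t ht htb' r hd z hz
    simp only [f, powerSum]
    rw [← ha t b' g ht htb' hg hgi]
    exact (hasSum_taylorCoeffZero hd hz).tsum_eq
  have hclosed : ∀ b' g, IsStrongSuctionSolution b' g → EqOn (g 0) f₀ (ball 0 1) →
      ∀ t ∈ Ico 0 b', EqOn (g t) (f t) (closedBall 0 1) := by
    intro b' g hg hgi t ht
    obtain ⟨r, hr, hreg, -⟩ := hg.regular t ht.1 ht.2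
    exact ((hfg b' g hg hgi t ht.1 ht.2 r (hreg t ⟨ht.1, le_rfl⟩).1).mono
      (closedBall_subset_ball hr)).symm
  refine ⟨sSup S, f, ⟨?_, ?_, ?_⟩, le_csSup hS hb₀S⟩
  · refine isStrongSuctionSolution_of_local fun T hT hTb => ?_
    obtain ⟨b', ⟨g, hg, hgi⟩, hTb'⟩ := exists_lt_of_lt_csSup ⟨b₀, hb₀S⟩ hTb
    -- The radius 2 is arbitrary here: the agreement holds on every disk on which g is analytic.
    exact ⟨b', g, hTb', hg, fun T' hT' => ⟨2, by norm_num, fun r' _ t ht hd =>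
      hfg b' g hg hgi t ht.1 (ht.2.trans_lt hT') r' hd⟩⟩
  · exact ((hclosed b₀ g₀ hg₀ hi 0 ⟨le_rfl, hb₀⟩).mono ball_subset_closedBall).symm.trans hi
  · exact fun b' g hg hgi => ⟨le_csSup hS ⟨g, hg, hgi⟩, hclosed b' g hg hgi⟩

/-! ### The shrinking disk -/

theorem hasDerivAt_diskSolution {t : ℝ} (ht : t < 1 / 2) (ξ : ℂ) :
    HasDerivAt (fun s => diskSolution s ξ) (((-(Real.sqrt (1 - 2 * t))⁻¹ : ℝ) : ℂ) * ξ) t := by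
  have h1 : HasDerivAt (fun s : ℝ => 1 - 2 * s) (-2) t := by
    simpa using ((hasDerivAt_id t).const_mul (2 : ℝ)).const_sub 1
  have h2 := (h1.sqrt (by linarith)).ofReal_comp.mul_const ξ
  refine h2.congr_deriv ?_
  congr 2
  have : Real.sqrt (1 - 2 * t) ≠ 0 := (Real.sqrt_pos.2 (by linarith)).ne'
  field_simp

theorem isStrongSuctionSolution_diskSolution :
    IsStrongSuctionSolution (1 / 2) diskSolution := by
  have hpos : ∀ {t : ℝ}, t < 1 / 2 → 0 < Real.sqrt (1 - 2 * t) := fun ht =>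
    Real.sqrt_pos.2 (by linarith)
  have hderiv : ∀ t ξ, deriv (diskSolution t) ξ = (Real.sqrt (1 - 2 * t) : ℝ) := fun t ξ => by
    have : HasDerivAt (fun z : ℂ => ((Real.sqrt (1 - 2 * t) : ℝ) : ℂ) * z)
        (Real.sqrt (1 - 2 * t) : ℝ) ξ := by
      simpa using (hasDerivAt_id ξ).const_mul ((Real.sqrt (1 - 2 * t) : ℝ) : ℂ)
    exact this.deriv
  have htd : ∀ t ∈ Ico (0 : ℝ) (1 / 2), ∀ ξ, timeDeriv (1 / 2) diskSolution t ξ =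
      ((-(Real.sqrt (1 - 2 * t))⁻¹ : ℝ) : ℂ) * ξ := fun t ht ξ =>
    timeDeriv_eq ht (hasDerivAt_diskSolution ht.2 ξ).hasDerivWithinAt
  refine ⟨fun T hT hTb => ⟨2, by norm_num, fun t ht => ⟨?_, ?_⟩, ?_, ?_, ?_⟩, ?_, ?_, ?_⟩
  · unfold diskSolution; fun_prop
  · intro x _ y _ h
    have : ((Real.sqrt (1 - 2 * t) : ℝ) : ℂ) ≠ 0 :=
      Complex.ofReal_ne_zero.2 (hpos (ht.2.trans_lt hTb)).ne'
    exact mul_left_cancel₀ this h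
  · exact fun t ht ξ _ =>
      (hasDerivAt_diskSolution (ht.2.trans_lt hTb) ξ).differentiableAt.differentiableWithinAt
  · unfold diskSolution; fun_prop
  · have : ContinuousOn (fun p : ℝ × ℂ => ((-(Real.sqrt (1 - 2 * p.1))⁻¹ : ℝ) : ℂ) * p.2)
        (Icc 0 T ×ˢ ball 0 2) := by
      refine ContinuousOn.mul (Complex.continuous_ofReal.comp_continuousOn ?_) (by fun_prop)
      refine (ContinuousOn.inv₀ (by fun_prop) fun p hp => ?_).neg
      exact (hpos (hp.1.2.trans_lt hTb)).ne'
    exact this.congr fun p hp => htd p.1 ⟨hp.1.1, hp.1.2.trans_lt hTb⟩ p.2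
  · intro t _; simp [diskSolution]
  · intro t ht
    rw [hderiv]
    exact ⟨by simpa using hpos ht.2, Complex.ofReal_im _⟩
  · intro t ht ξ hξ
    rw [htd t ht, hderiv, map_mul, Complex.conj_ofReal]
    have h1 : ξ * (starRingEnd ℂ) ξ = 1 := by
      rw [Complex.mul_conj, Complex.normSq_eq_norm_sq, hξ]; norm_num
    have h2 : ((Real.sqrt (1 - 2 * t) : ℝ) : ℂ) ≠ 0 :=
      Complex.ofReal_ne_zero.2 (hpos ht.2).ne'
    have : ((-(Real.sqrt (1 - 2 * t))⁻¹ : ℝ) : ℂ) * ξ *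
        (((Real.sqrt (1 - 2 * t) : ℝ) : ℂ) * (starRingEnd ℂ) ξ) = -1 := by
      push_cast
      field_simp
      linear_combination -h1
    rw [this]; simp

/-- Here f'(0,0) = 1, so the general bound on the existence time is 1/2, which the explicit solution
attains. -/
theorem isMaximalStrongSuctionSolution_diskSolution :
    IsMaximalStrongSuctionSolution (fun ξ => ξ) (1 / 2) diskSolution := by
  have hi : EqOn (diskSolution 0) (fun ξ => ξ) (ball 0 1) := fun z _ => by simp [diskSolution]
  refine ⟨isStrongSuctionSolution_diskSolution, hi, fun b' g hg hgi => ?_⟩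
  have hb' : b' ≤ 1 / 2 := by
    have h1 := hg.blowup_time_le
    rw [(hgi.eventuallyEq_of_mem (ball_mem_nhds 0 one_pos)).deriv_eq] at h1
    simpa using h1
  exact ⟨hb', fun t ht => hg.eqOn_closedBall isStrongSuctionSolution_diskSolution
    (hgi.trans hi.symm) ht.1 ht.2 (ht.2.trans_le hb')⟩

open scoped Pointwise in
theorem volume_diskSolution_image {t : ℝ} (ht : t ≤ 1 / 2) :
    volume (diskSolution t '' ball (0 : ℂ) 1) = ENNReal.ofReal (Real.pi * (1 - 2 * t)) := by
  have himg : diskSolution t '' ball (0 : ℂ) 1 = (Real.sqrt (1 - 2 * t)) • ball (0 : ℂ) 1 := by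
    ext z
    simp [diskSolution, mem_smul_set]
  rw [himg, Measure.addHaar_smul, Complex.finrank_real_complex, Complex.volume_ball,
    Real.sq_sqrt (by linarith), abs_of_nonneg (by linarith)]
  simp only [ENNReal.ofReal_one, one_pow, one_mul]
  rw [mul_comm Real.pi, ENNReal.ofReal_mul (by linarith)]
  congr 1
  rw [← NNReal.coe_real_pi, ENNReal.ofReal_coe_nnreal]

/-! ### The cubic evolution of the coefficients of `1 / f'` -/

/-- The coefficients of `h (ξ p)' - ξ p h'`, where `h = ∑ a_n ξ^n` and `p` has coefficients
`hermProj b c`. -/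
noncomputable def cubicForm (a b c : ℕ → ℂ) (n : ℕ) : ℂ :=
  ∑ p ∈ Finset.HasAntidiagonal.antidiagonal n,
    (1 + (p.1 : ℂ) - (p.2 : ℂ)) * (hermProj b c p.1 * a p.2)

/-- The derivatives contribute only the factor |1 + j - k| ≤ n + 1 for j + k = n; the remaining
product costs 32 = 8·4. The factor n + 1 is the whole derivative loss. -/
theorem Dominated.norm_cubicForm_le {ρ κ κ' κ'' : ℝ} {a b c : ℕ → ℂ} (hρ : 1 ≤ ρ)
    (ha : Dominated ρ κ a) (hb : Dominated ρ κ' b) (hc : Dominated ρ κ'' c) (n : ℕ) :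
    ‖cubicForm a b c n‖ ≤ (n + 1) * (32 * κ * κ' * κ'' * seqWeight ρ n) := by
  have h := (hb.hermProj hρ hc).sum_antidiagonal (by linarith) ha n
  calc _ ≤ ∑ p ∈ Finset.HasAntidiagonal.antidiagonal n,
        ((n : ℝ) + 1) * (‖_root_.hermProj b c p.1‖ * ‖a p.2‖) := by
        refine (norm_sum_le _ _).trans (Finset.sum_le_sum fun p hp => ?_)
        rw [norm_mul, norm_mul]
        refine mul_le_mul_of_nonneg_right ?_ (by positivity)
        rw [← Finset.HasAntidiagonal.mem_antidiagonal.1 hp]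
        have h1 : (1 + (p.1 : ℂ) - (p.2 : ℂ)) = ((1 + (p.1 : ℝ) - (p.2 : ℝ) : ℝ) : ℂ) := by
          push_cast; rfl
        rw [h1, Complex.norm_real, Real.norm_eq_abs, abs_le]
        push_cast
        have := Nat.cast_nonneg (α := ℝ) p.1
        have := Nat.cast_nonneg (α := ℝ) p.2
        constructor <;> linarith
    _ ≤ (n + 1) * (8 * (4 * κ' * κ'') * κ * seqWeight ρ n) := by
        rw [← Finset.mul_sum]
        exact mul_le_mul_of_nonneg_left h (by positivity)
    _ = _ := by ring

theorem Dominated.hermProj_sub {ρ κ κ' κ'' : ℝ} {a b c : ℕ → ℂ} (hρ : 1 ≤ ρ)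
    (ha : Dominated ρ κ a) (hb : Dominated ρ κ' b) (hc : Dominated ρ κ'' c) (k : ℕ) :
    _root_.hermProj (a - b) c k = _root_.hermProj a c k - _root_.hermProj b c k ∧
    _root_.hermProj c (a - b) k = _root_.hermProj c a k - _root_.hermProj c b k := by
  have e1 : _root_.corr (a - b) c k = _root_.corr a c k - _root_.corr b c k := by
    simp only [_root_.corr, Pi.sub_apply, sub_mul]
    exact (ha.summable_corr hρ hc k).tsum_sub (hb.summable_corr hρ hc k)
  have e2 : _root_.corr c (a - b) k = _root_.corr c a k - _root_.corr c b k := by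
    simp only [_root_.corr, Pi.sub_apply, map_sub, mul_sub]
    exact (hc.summable_corr hρ ha k).tsum_sub (hc.summable_corr hρ hb k)
  constructor <;> rw [_root_.hermProj, _root_.hermProj, _root_.hermProj, e1, e2] <;> ring

/-- Trilinear telescoping, replacing one argument at a time; 96 = 3·32. -/
theorem Dominated.norm_cubicForm_sub_le {ρ K κ : ℝ} {a b : ℕ → ℂ} (hρ : 1 ≤ ρ)
    (ha : Dominated ρ K a) (hb : Dominated ρ K b) (hab : Dominated ρ κ (a - b)) (n : ℕ) :
    ‖cubicForm a a a n - cubicForm b b b n‖ ≤ (n + 1) * (96 * K ^ 2 * κ * seqWeight ρ n) := by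
  have e : cubicForm a a a n - cubicForm b b b n =
      cubicForm (a - b) a a n + cubicForm b (a - b) a n + cubicForm b b (a - b) n := by
    simp only [cubicForm, ← Finset.sum_add_distrib, ← Finset.sum_sub_distrib]
    refine Finset.sum_congr rfl fun p _ => ?_
    rw [(ha.hermProj_sub hρ hb ha p.1).1, (ha.hermProj_sub hρ hb hb p.1).2, Pi.sub_apply]
    ring
  rw [e]
  have h1 := hab.norm_cubicForm_le hρ ha ha n
  have h2 := hb.norm_cubicForm_le hρ hab ha n
  have h3 := hb.norm_cubicForm_le hρ hb hab n
  calc _ ≤ ‖cubicForm (a - b) a a n‖ + ‖cubicForm b (a - b) a n‖ + ‖cubicForm b b (a - b) n‖ :=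
        norm_add₃_le
    _ ≤ _ := by nlinarith

theorem continuous_hermProj {ρ : ℝ → ℝ} {κ : ℝ} {a : ℝ → ℕ → ℂ} (hρ : ∀ s, 1 ≤ ρ s)
    (ha : ∀ s, Dominated (ρ s) κ (a s)) (hc : ∀ n, Continuous fun s => a s n) (k : ℕ) :
    Continuous fun s => hermProj (a s) (a s) k := by
  have h : Continuous fun s => corr (a s) (a s) k := by
    refine continuous_tsum (fun l => (hc _).mul (Complex.continuous_conj.comp (hc l)))
      (summable_inv_succ_sq.mul_left (κ * κ)) fun l s => ?_
    refine ((ha s).norm_corr_term_le (hρ s) (ha s) k l).trans ?_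
    have h1 : seqWeight (ρ s) k ≤ 1 := (seqWeight_le (hρ s) k).trans
      (inv_le_one_of_one_le₀ (one_le_pow₀ (by linarith [Nat.cast_nonneg (α := ℝ) k])))
    refine mul_le_mul_of_nonneg_right ?_ (by positivity)
    exact mul_le_of_le_one_right (mul_self_nonneg κ) h1
  exact continuous_const.mul (h.add h)

theorem continuous_cubicForm {ρ : ℝ → ℝ} {κ : ℝ} {a : ℝ → ℕ → ℂ} (hρ : ∀ s, 1 ≤ ρ s)
    (ha : ∀ s, Dominated (ρ s) κ (a s)) (hc : ∀ n, Continuous fun s => a s n) (n : ℕ) :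
    Continuous fun s => cubicForm (a s) (a s) (a s) n :=
  continuous_finsetSum _ fun p _ =>
    continuous_const.mul ((continuous_hermProj hρ ha hc p.1).mul (hc p.2))

theorem norm_integral_le_exp {u : ℝ → ℂ} {K μ t : ℝ} (hμ : 0 < μ) (hK : 0 ≤ K) (ht : 0 ≤ t)
    (hu : Continuous u) (hbd : ∀ s ∈ Ico 0 t, ‖u s‖ ≤ K * Real.exp (μ * s)) :
    ‖∫ s in (0 : ℝ)..t, u s‖ ≤ K / μ * Real.exp (μ * t) := by
  have hd : ∀ x, HasDerivAt (fun x => ∫ s in (0 : ℝ)..x, u s) (u x) x := fun x =>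
    hu.integral_hasStrictDerivAt 0 x |>.hasDerivAt
  have := norm_le_exp_of_norm_deriv_right_le (u := fun x => ∫ s in (0 : ℝ)..x, u s) (u' := u)
    (a := 0) (b := t) hμ hK
    (fun x _ => (hd x).continuousAt.continuousWithinAt)
    (fun x _ => (hd x).hasDerivWithinAt) (by simpa using hbd) (by simp) t ⟨ht, le_rfl⟩
  simpa using this

/-! ### Constant sequences and the disk solution in coefficient form -/

theorem dominated_single {ρ κ : ℝ} (hρ : 0 < ρ) (hκ : 0 ≤ κ) {x : ℂ} (hx : ‖x‖ ≤ κ) :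
    Dominated ρ κ (Pi.single 0 x) := fun n => by
  rcases n.eq_zero_or_pos with rfl | hn
  · simpa [seqWeight_zero] using hx
  · rw [Pi.single_eq_of_ne hn.ne', norm_zero]
    exact mul_nonneg hκ (seqWeight_pos hρ n).le

theorem corr_single (x : ℝ) (k : ℕ) :
    corr (Pi.single 0 (x : ℂ)) (Pi.single 0 (x : ℂ)) k = if k = 0 then (x : ℂ) ^ 2 else 0 := by
  rw [corr, tsum_eq_single 0 (fun l hl => by simp [Pi.single_eq_of_ne hl])]
  rcases k.eq_zero_or_pos with rfl | hk
  · simp [pow_two]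
  · simp [hk.ne']

/-- On constants the system reduces to x' = x³, whose solution with x(0) = 1 is `diskInv`. -/
theorem cubicForm_single (x : ℝ) : cubicForm (Pi.single 0 (x : ℂ)) (Pi.single 0 (x : ℂ))
    (Pi.single 0 (x : ℂ)) = Pi.single 0 ((x : ℂ) ^ 3) := by
  ext n
  have hp (k : ℕ) : hermProj (Pi.single 0 (x : ℂ)) (Pi.single 0 (x : ℂ)) k =
      if k = 0 then (x : ℂ) ^ 2 else 0 := by
    rw [hermProj, corr_single]; split_ifs <;> ring
  rcases n.eq_zero_or_pos with rfl | hn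
  · simp [cubicForm, hp]; ring
  · rw [Pi.single_eq_of_ne hn.ne', cubicForm]
    refine Finset.sum_eq_zero fun p hp' => ?_
    rw [hp]
    split_ifs with h
    · have := Finset.HasAntidiagonal.mem_antidiagonal.1 hp'
      rw [Pi.single_eq_of_ne (by omega : p.2 ≠ 0)]; simp
    · simp

/-- The coefficient `1 / f₁'` for the shrinking disk, extended continuously beyond `[0,T]`. -/
noncomputable def diskInv (t : ℝ) : ℝ := (Real.sqrt (1 - 2 * t))⁻¹

theorem hasDerivAt_diskInv {t : ℝ} (ht : t < 1 / 2) :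
    HasDerivAt diskInv (diskInv t ^ 3) t := by
  have h1 : HasDerivAt (fun s : ℝ => 1 - 2 * s) (-2) t := by
    simpa using ((hasDerivAt_id t).const_mul (2 : ℝ)).const_sub 1
  have hp : 0 < Real.sqrt (1 - 2 * t) := Real.sqrt_pos.2 (by linarith)
  have h2 := (h1.sqrt (by linarith)).fun_inv hp.ne'
  refine h2.congr_deriv ?_
  rw [diskInv]
  field_simp

theorem diskInv_zero : diskInv 0 = 1 := by simp [diskInv]

theorem diskInv_pos {t : ℝ} (ht : t < 1 / 2) : 0 < diskInv t :=
  inv_pos.2 (Real.sqrt_pos.2 (by linarith))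

theorem diskInv_mono {s t : ℝ} (hst : s ≤ t) (ht : t < 1 / 2) : diskInv s ≤ diskInv t := by
  unfold diskInv
  have : 0 < Real.sqrt (1 - 2 * t) := Real.sqrt_pos.2 (by linarith)
  gcongr

theorem one_le_diskInv {t : ℝ} (h0 : 0 ≤ t) (ht : t < 1 / 2) : 1 ≤ diskInv t :=
  diskInv_zero ▸ diskInv_mono h0 ht

theorem diskInv_eq_integral {t : ℝ} (h0 : 0 ≤ t) (ht : t < 1 / 2) :
    diskInv t = 1 + ∫ s in (0 : ℝ)..t, diskInv s ^ 3 := by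
  have hd : ∀ x ∈ uIcc 0 t, HasDerivAt diskInv (diskInv x ^ 3) x := fun x hx => by
    rw [uIcc_of_le h0] at hx
    exact hasDerivAt_diskInv (hx.2.trans_lt ht)
  rw [intervalIntegral.integral_eq_sub_of_hasDerivAt hd, diskInv_zero]
  · ring
  · exact (ContinuousOn.pow (fun x hx => (hd x hx).continuousAt.continuousWithinAt) 3).intervalIntegrable
open scoped BoundedContinuousFunction

/-! ### The fixed point argument -/

/-- Truncation of time to `[0,T]`. -/
noncomputable def clampTime (T t : ℝ) : ℝ := max 0 (min t T)

theorem continuous_clampTime (T : ℝ) : Continuous (clampTime T) := by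
  unfold clampTime; fun_prop

theorem clampTime_mem {T : ℝ} (hT : 0 ≤ T) (t : ℝ) : clampTime T t ∈ Icc 0 T :=
  ⟨le_max_left _ _, max_le hT (min_le_right _ _)⟩

theorem clampTime_of_mem {T t : ℝ} (ht : t ∈ Icc 0 T) : clampTime T t = t := by
  rw [clampTime, min_eq_left ht.2, max_eq_right ht.1]

/-- The growing weight `e^{(n+1)νt} / ((n+1)² ρ₀ⁿ)`. -/
noncomputable def expWeight (ρ₀ ν : ℝ) (n : ℕ) (t : ℝ) : ℝ :=
  seqWeight ρ₀ n * Real.exp (((n : ℝ) + 1) * ν * t)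

/-- The weight is that of the radius ρ₀ e^{-νt}, times e^{νt}. The exponent n + 1 in place of n
matches the loss in `cubicForm`, and gives a gain 1/ν even at index 0. -/
theorem expWeight_eq (ρ₀ ν : ℝ) (n : ℕ) (t : ℝ) :
    expWeight ρ₀ ν n t = Real.exp (ν * t) * seqWeight (ρ₀ * Real.exp (-(ν * t))) n := by
  rw [seqWeight_mul_exp_neg, expWeight, mul_left_comm, ← Real.exp_add]
  congr 2
  ring

theorem expWeight_pos {ρ₀ : ℝ} (hρ : 0 < ρ₀) (ν : ℝ) (n : ℕ) (t : ℝ) : 0 < expWeight ρ₀ ν n t :=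
  mul_pos (seqWeight_pos hρ n) (Real.exp_pos _)

theorem continuous_expWeight (ρ₀ ν : ℝ) (n : ℕ) : Continuous (expWeight ρ₀ ν n) := by
  unfold expWeight; fun_prop

theorem seqWeight_le_expWeight {ρ₀ ν t : ℝ} (hρ : 0 < ρ₀) (hν : 0 ≤ ν) (ht : 0 ≤ t) (n : ℕ) :
    seqWeight ρ₀ n ≤ expWeight ρ₀ ν n t :=
  le_mul_of_one_le_right (seqWeight_pos hρ n).le (Real.one_le_exp (by positivity))

/-- The time dependent sequence with normalized coefficients `z`. -/
noncomputable def weightedSeq (ρ₀ ν T : ℝ) (z : ℕ × ℝ →ᵇ ℂ) (t : ℝ) (n : ℕ) : ℂ :=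
  expWeight ρ₀ ν n (clampTime T t) * z (n, t)

theorem continuous_weightedSeq (ρ₀ ν T : ℝ) (z : ℕ × ℝ →ᵇ ℂ) (n : ℕ) :
    Continuous fun t => weightedSeq ρ₀ ν T z t n :=
  (Complex.continuous_ofReal.comp ((continuous_expWeight ρ₀ ν n).comp
    (continuous_clampTime T))).mul (z.continuous.comp (by fun_prop))

theorem weightedSeq_sub (ρ₀ ν T : ℝ) (z w : ℕ × ℝ →ᵇ ℂ) (t : ℝ) :
    weightedSeq ρ₀ ν T z t - weightedSeq ρ₀ ν T w t = weightedSeq ρ₀ ν T (z - w) t := by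
  ext n
  simp [weightedSeq, mul_sub]

theorem dominated_weightedSeq {ρ₀ ν T : ℝ} (hρ : 0 < ρ₀) (z : ℕ × ℝ →ᵇ ℂ) (t : ℝ) :
    Dominated (ρ₀ * Real.exp (-(ν * clampTime T t))) (Real.exp (ν * clampTime T t) * ‖z‖)
      (weightedSeq ρ₀ ν T z t) := fun n => by
  rw [weightedSeq, norm_mul, Complex.norm_real, Real.norm_of_nonneg (expWeight_pos hρ _ _ _).le,
    expWeight_eq]
  have h1 := z.norm_coe_le_norm (n, t)
  have h2 := seqWeight_pos (mul_pos hρ (Real.exp_pos (-(ν * clampTime T t)))) n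
  calc _ ≤ Real.exp (ν * clampTime T t) *
        seqWeight (ρ₀ * Real.exp (-(ν * clampTime T t))) n * ‖z‖ := by gcongr
    _ = _ := by ring

theorem exp_mul_clampTime_le {ν T : ℝ} (hν : 0 ≤ ν) (hT : 0 ≤ T) (t : ℝ) :
    Real.exp (ν * clampTime T t) ≤ Real.exp (ν * T) :=
  Real.exp_le_exp.2 (mul_le_mul_of_nonneg_left (clampTime_mem hT t).2 hν)

/-- Starting from the radius ρ₁ e^{νT}, the shrinking radius is still at least ρ₁ at time T. -/
theorem le_radius_clampTime {ρ₁ ν T : ℝ} (hρ : 0 ≤ ρ₁) (hν : 0 ≤ ν) (hT : 0 ≤ T) (t : ℝ) :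
    ρ₁ ≤ ρ₁ * Real.exp (ν * T) * Real.exp (-(ν * clampTime T t)) := by
  rw [mul_assoc, ← Real.exp_add]
  refine le_mul_of_one_le_right hρ (Real.one_le_exp ?_)
  have := mul_le_mul_of_nonneg_left (clampTime_mem hT t).2 hν
  linarith

/-- The integral term is controlled by the growing weight. -/
theorem norm_integral_le_expWeight {ρ₀ ν A t : ℝ} {u : ℝ → ℂ} (hρ : 0 < ρ₀) (hν : 0 < ν)
    (hA : 0 ≤ A) (ht : 0 ≤ t) (hu : Continuous u) {n : ℕ}
    (hbd : ∀ s ∈ Ico 0 t, ‖u s‖ ≤ (n + 1) * (A * expWeight ρ₀ ν n s)) :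
    ‖∫ s in (0 : ℝ)..t, u s‖ ≤ A / ν * expWeight ρ₀ ν n t := by
  have hw := seqWeight_pos hρ n
  have h := norm_integral_le_exp (u := u) (K := (n + 1) * (A * seqWeight ρ₀ n))
    (μ := ((n : ℝ) + 1) * ν) (t := t) (by positivity) (by positivity) ht hu (fun s hs => by
      refine (hbd s hs).trans (le_of_eq ?_)
      rw [expWeight]; ring)
  refine h.trans (le_of_eq ?_)
  rw [expWeight]
  field_simp

/-- The integral operator in normalized coefficients. Dividing by the growing weight keeps the
iterate bounded, and clamping time lets the iteration run in the complete space of bounded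
continuous functions on ℕ × ℝ. -/
theorem exists_picard_iterate {ρ₁ ν T κ : ℝ} (hρ : 1 ≤ ρ₁) (hν : 0 < ν) (hT : 0 ≤ T)
    {c : ℕ → ℂ} (hc : Dominated (ρ₁ * Real.exp (ν * T)) κ c) (z : ℕ × ℝ →ᵇ ℂ) :
    ∃ w : ℕ × ℝ →ᵇ ℂ, ∀ n t, w (n, t) =
      (c n + ∫ s in (0 : ℝ)..clampTime T t,
        cubicForm (weightedSeq (ρ₁ * Real.exp (ν * T)) ν T z s)
          (weightedSeq (ρ₁ * Real.exp (ν * T)) ν T z s)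
          (weightedSeq (ρ₁ * Real.exp (ν * T)) ν T z s) n) /
        expWeight (ρ₁ * Real.exp (ν * T)) ν n (clampTime T t) := by
  set ρ₀ := ρ₁ * Real.exp (ν * T) with hρ₀
  have hρ0 : 0 < ρ₀ := by positivity
  set L := Real.exp (ν * T) * ‖z‖ with hL
  have hrad : ∀ s, 1 ≤ ρ₀ * Real.exp (-(ν * clampTime T s)) := fun s =>
    hρ.trans (le_radius_clampTime (by linarith) hν.le hT s)
  have hdom : ∀ s, Dominated (ρ₀ * Real.exp (-(ν * clampTime T s))) L (weightedSeq ρ₀ ν T z s) :=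
    fun s => (dominated_weightedSeq hρ0 z s).mono (by linarith [hrad s])
      (mul_le_mul_of_nonneg_right (exp_mul_clampTime_le hν.le hT s) (norm_nonneg _))
  have hcont := continuous_cubicForm hrad hdom (continuous_weightedSeq ρ₀ ν T z)
  set N : ℕ → ℝ → ℂ := fun n s => cubicForm (weightedSeq ρ₀ ν T z s) (weightedSeq ρ₀ ν T z s)
    (weightedSeq ρ₀ ν T z s) n with hN
  have hbd : ∀ n, ∀ t ∈ Icc 0 T, ‖∫ s in (0 : ℝ)..t, N n s‖ ≤
      32 * L ^ 3 / ν * expWeight ρ₀ ν n t := by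
    intro n t ht
    refine norm_integral_le_expWeight hρ0 hν (by positivity) ht.1 (hcont n) fun s hs => ?_
    refine ((hdom s).norm_cubicForm_le (hrad s) (hdom s) (hdom s) n).trans ?_
    rw [clampTime_of_mem ⟨hs.1, hs.2.le.trans ht.2⟩, expWeight_eq]
    have h1 : 1 ≤ Real.exp (ν * s) := Real.one_le_exp (mul_nonneg hν.le hs.1)
    have h2 := seqWeight_pos (mul_pos hρ0 (Real.exp_pos (-(ν * s)))) n
    have h3 : seqWeight (ρ₀ * Real.exp (-(ν * s))) n ≤
        Real.exp (ν * s) * seqWeight (ρ₀ * Real.exp (-(ν * s))) n :=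
      le_mul_of_one_le_left h2.le h1
    have hL0 : 0 ≤ L := by positivity
    calc _ = ((n : ℝ) + 1) * (32 * L ^ 3 * seqWeight (ρ₀ * Real.exp (-(ν * s))) n) := by ring
      _ ≤ _ := by gcongr
  let F : ℕ × ℝ → ℂ := fun p => (c p.1 + ∫ s in (0 : ℝ)..clampTime T p.2, N p.1 s) /
    (expWeight ρ₀ ν p.1 (clampTime T p.2) : ℂ)
  have hF : Continuous F := by
    rw [continuous_prod_of_discrete_left]
    intro n
    have hint : Continuous fun t => c n + ∫ s in (0 : ℝ)..clampTime T t, N n s :=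
      continuous_const.add ((intervalIntegral.continuous_primitive
        (fun a b => (hcont n).intervalIntegrable a b) 0).comp (continuous_clampTime T))
    refine Continuous.div hint ?_ fun t => ?_
    · exact Complex.continuous_ofReal.comp ((continuous_expWeight ρ₀ ν n).comp
        (continuous_clampTime T))
    · exact Complex.ofReal_ne_zero.2 (expWeight_pos hρ0 _ _ _).ne'
  refine ⟨BoundedContinuousFunction.ofNormedAddCommGroup F hF (κ + 32 * L ^ 3 / ν) ?_,
    fun n t => rfl⟩
  rintro ⟨n, t⟩
  have hw := expWeight_pos hρ0 ν n (clampTime T t)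
  simp only [F]
  rw [norm_div, Complex.norm_real, Real.norm_of_nonneg hw.le, div_le_iff₀ hw, add_mul]
  refine (norm_add_le _ _).trans (add_le_add ((hc n).trans ?_) (hbd n _ (clampTime_mem hT t)))
  exact mul_le_mul_of_nonneg_left
    (seqWeight_le_expWeight hρ0 hν.le (clampTime_mem hT t).1 n) hc.nonneg

/-- Existence of the coefficients of `1 / f'` on `[0,T]`, for data close to the disk. -/
theorem exists_coefficient_flow {T : ℝ} (hT : 0 < T) (hT2 : T < 1 / 2) :
    ∃ ρ₀ η : ℝ, 2 ≤ ρ₀ ∧ 0 < η ∧ ∀ c : ℕ → ℂ, Dominated ρ₀ η (c - Pi.single 0 1) →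
      ∃ (h : ℝ → ℕ → ℂ) (K : ℝ), (∀ n, Continuous fun t => h t n) ∧ (∀ t, Dominated 2 K (h t)) ∧
        (∀ t ∈ Icc 0 T, Dominated 2 (1 / 8) (h t - Pi.single 0 (diskInv t : ℂ))) ∧
        ∀ t ∈ Icc 0 T, ∀ n, h t n = c n + ∫ s in (0 : ℝ)..t, cubicForm (h s) (h s) (h s) n := by
  set K := diskInv T + 1 with hK
  have hdT := one_le_diskInv hT.le hT2
  have hK1 : 1 ≤ K := by linarith
  set ν := 192 * K ^ 2 with hν
  have hν0 : 0 < ν := by positivity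
  set ρ₀ := 2 * Real.exp (ν * T) with hρ₀
  have hρ0 : 0 < ρ₀ := by positivity
  have hρ1 : 2 ≤ ρ₀ := by
    have : 1 ≤ Real.exp (ν * T) := Real.one_le_exp (by positivity)
    linarith
  set r := Real.exp (-(ν * T)) / 8 with hr
  have hr0 : 0 < r := by positivity
  refine ⟨ρ₀, r / 2, hρ1, by positivity, fun c hc => ?_⟩
  have hrad2 : ∀ s, 2 ≤ ρ₀ * Real.exp (-(ν * clampTime T s)) := fun s =>
    le_radius_clampTime (by norm_num) hν0.le hT.le s
  have hrad : ∀ s, 1 ≤ ρ₀ * Real.exp (-(ν * clampTime T s)) := fun s =>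
    one_le_two.trans (hrad2 s)
  have hρpos : ∀ s, 0 < ρ₀ * Real.exp (-(ν * clampTime T s)) := fun s => by positivity
  have hcd : Dominated ρ₀ (r / 2 + 1) c := by
    have h1 : Dominated ρ₀ 1 (Pi.single 0 (1 : ℂ)) :=
      dominated_single hρ0 zero_le_one (by simp)
    have := hc.add h1
    rwa [sub_add_cancel] at this
  choose Ψ hΨ using exists_picard_iterate one_le_two hν0 hT.le hcd
  set S : (ℕ × ℝ →ᵇ ℂ) → ℝ → ℕ → ℂ := weightedSeq ρ₀ ν T with hS
  have hcd' : ∀ t, diskInv (clampTime T t) ≤ diskInv T := fun t =>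
    diskInv_mono (clampTime_mem hT.le t).2 hT2
  have hcpos : ∀ t, 0 < diskInv (clampTime T t) := fun t =>
    diskInv_pos ((clampTime_mem hT.le t).2.trans_lt hT2)
  have hdc : Continuous fun t => diskInv (clampTime T t) := by
    rw [continuous_iff_continuousAt]
    intro t
    exact (hasDerivAt_diskInv ((clampTime_mem hT.le t).2.trans_lt hT2)).continuousAt.comp
      (continuous_clampTime T).continuousAt
  -- the centre of the ball
  obtain ⟨zd, hzd⟩ : ∃ zd : ℕ × ℝ →ᵇ ℂ, ∀ n t, zd (n, t) =
      (Pi.single 0 (diskInv (clampTime T t) : ℂ) : ℕ → ℂ) n / expWeight ρ₀ ν n (clampTime T t) := by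
    let F : ℕ × ℝ → ℂ := fun p => (Pi.single 0 (diskInv (clampTime T p.2) : ℂ) : ℕ → ℂ) p.1 /
      expWeight ρ₀ ν p.1 (clampTime T p.2)
    have hF : Continuous F := by
      rw [continuous_prod_of_discrete_left]
      intro n
      refine Continuous.div ?_ (Complex.continuous_ofReal.comp ((continuous_expWeight ρ₀ ν n).comp
        (continuous_clampTime T))) fun t => Complex.ofReal_ne_zero.2 (expWeight_pos hρ0 _ _ _).ne'
      rcases n.eq_zero_or_pos with rfl | hn
      · simp only [Pi.single_eq_same]; exact Complex.continuous_ofReal.comp hdc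
      · simp only [Pi.single_eq_of_ne hn.ne']; exact continuous_const
    refine ⟨BoundedContinuousFunction.ofNormedAddCommGroup F hF (diskInv T) ?_, fun n t => rfl⟩
    rintro ⟨n, t⟩
    have hw := expWeight_pos hρ0 ν n (clampTime T t)
    simp only [F]
    rw [norm_div, Complex.norm_real, Real.norm_of_nonneg hw.le, div_le_iff₀ hw]
    have hdom : Dominated ρ₀ (diskInv T) (Pi.single 0 (diskInv (clampTime T t) : ℂ)) :=
      dominated_single hρ0 (by linarith) (by
        rw [Complex.norm_real, Real.norm_of_nonneg (hcpos t).le]; exact hcd' t)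
    refine (hdom n).trans ?_
    exact mul_le_mul_of_nonneg_left
      (seqWeight_le_expWeight hρ0 hν0.le (clampTime_mem hT.le t).1 n) (by linarith)
  have hSzd : ∀ t, S zd t = Pi.single 0 (diskInv (clampTime T t) : ℂ) := fun t => by
    ext n
    have := Complex.ofReal_ne_zero.2 (expWeight_pos hρ0 ν n (clampTime T t)).ne'
    simp only [hS, weightedSeq, hzd]
    rw [mul_div_cancel₀ _ this]
  have hball : ∀ z ∈ closedBall zd r, ∀ t,
      Dominated (ρ₀ * Real.exp (-(ν * clampTime T t))) (1 / 8)
        (S z t - Pi.single 0 (diskInv (clampTime T t) : ℂ)) := by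
    intro z hz t
    rw [← hSzd, hS, weightedSeq_sub]
    refine (dominated_weightedSeq hρ0 (z - zd) t).mono (hρpos t) ?_
    rw [mem_closedBall, dist_eq_norm] at hz
    calc _ ≤ Real.exp (ν * T) * r :=
          mul_le_mul (exp_mul_clampTime_le hν0.le hT.le t) hz (norm_nonneg _) (Real.exp_pos _).le
      _ = 1 / 8 := by
          rw [hr, ← mul_div_assoc, ← Real.exp_add]; simp
  have hballK : ∀ z ∈ closedBall zd r, ∀ t,
      Dominated (ρ₀ * Real.exp (-(ν * clampTime T t))) K (S z t) := by
    intro z hz t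
    have h1 : Dominated (ρ₀ * Real.exp (-(ν * clampTime T t))) (diskInv T)
        (Pi.single 0 (diskInv (clampTime T t) : ℂ)) :=
      dominated_single (hρpos t) (by linarith) (by
        rw [Complex.norm_real, Real.norm_of_nonneg (hcpos t).le]; exact hcd' t)
    have h2 := (hball z hz t).add h1
    rw [sub_add_cancel] at h2
    exact h2.mono (hρpos t) (by linarith)
  have hcubc : ∀ z ∈ closedBall zd r, ∀ n,
      Continuous fun s => cubicForm (S z s) (S z s) (S z s) n := fun z hz =>
    continuous_cubicForm hrad (hballK z hz) (continuous_weightedSeq ρ₀ ν T z)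
  have hzdmem : zd ∈ closedBall zd r := mem_closedBall_self hr0.le
  -- The Lipschitz factor is 96 K²/ν = 1/2: the n + 1 lost in the cubic form is recovered by the
  -- time integral.
  have hcontr : ∀ z ∈ closedBall zd r, ∀ w ∈ closedBall zd r,
      dist (Ψ z) (Ψ w) ≤ 1 / 2 * dist z w := by
    intro z hz w hw
    rw [BoundedContinuousFunction.dist_le (by positivity)]
    rintro ⟨n, t⟩
    have hwt := expWeight_pos hρ0 ν n (clampTime T t)
    have ht := clampTime_mem hT.le t
    rw [dist_eq_norm, hΨ, hΨ, ← sub_div, add_sub_add_left_eq_sub,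
      ← intervalIntegral.integral_sub ((hcubc z hz n).intervalIntegrable _ _)
        ((hcubc w hw n).intervalIntegrable _ _), norm_div, Complex.norm_real,
      Real.norm_of_nonneg hwt.le, div_le_iff₀ hwt]
    have h := norm_integral_le_expWeight (A := 96 * K ^ 2 * dist z w) hρ0 hν0 (by positivity) ht.1
      ((hcubc z hz n).sub (hcubc w hw n)) (n := n) fun s hs => by
        have hs' : clampTime T s = s := clampTime_of_mem ⟨hs.1, hs.2.le.trans ht.2⟩
        have hd := dominated_weightedSeq (ν := ν) (T := T) hρ0 (z - w) s
        rw [← weightedSeq_sub] at hd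
        refine ((hballK z hz s).norm_cubicForm_sub_le (hrad s) (hballK w hw s) hd n).trans
          (le_of_eq ?_)
        rw [hs', expWeight_eq, dist_eq_norm]
        ring
    refine h.trans (le_of_eq ?_)
    rw [hν]
    field_simp
    ring
  -- The centre is the exact solution with data 1, so its iterate differs from it only through c -
  -- 1, which is dominated by r/2.
  have hcentre : dist (Ψ zd) zd ≤ r / 2 := by
    rw [BoundedContinuousFunction.dist_le (by positivity)]
    rintro ⟨n, t⟩
    have hwt := expWeight_pos hρ0 ν n (clampTime T t)
    have ht := clampTime_mem hT.le t
    have hint : ∫ s in (0 : ℝ)..clampTime T t, cubicForm (S zd s) (S zd s) (S zd s) n =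
        (Pi.single 0 ((diskInv (clampTime T t) - 1 : ℝ) : ℂ) : ℕ → ℂ) n := by
      have e : EqOn (fun s => cubicForm (S zd s) (S zd s) (S zd s) n)
          (fun s => (Pi.single 0 ((diskInv s ^ 3 : ℝ) : ℂ) : ℕ → ℂ) n) (uIcc 0 (clampTime T t)) := by
        intro s hs
        rw [uIcc_of_le ht.1] at hs
        simp only [hSzd, cubicForm_single, clampTime_of_mem ⟨hs.1, hs.2.trans ht.2⟩]
        push_cast; rfl
      rw [intervalIntegral.integral_congr e]
      rcases n.eq_zero_or_pos with rfl | hn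
      · simp only [Pi.single_eq_same]
        rw [intervalIntegral.integral_ofReal, diskInv_eq_integral ht.1 (ht.2.trans_lt hT2)]
        simp
      · simp [Pi.single_eq_of_ne hn.ne']
    rw [dist_eq_norm, hΨ, hzd, ← sub_div, norm_div, Complex.norm_real,
      Real.norm_of_nonneg hwt.le, div_le_iff₀ hwt]
    have e2 : c n + ∫ s in (0 : ℝ)..clampTime T t, cubicForm (S zd s) (S zd s) (S zd s) n =
        (c - Pi.single 0 1 : ℕ → ℂ) n + (Pi.single 0 (diskInv (clampTime T t) : ℂ) : ℕ → ℂ) n := by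
      rw [hint]
      rcases n.eq_zero_or_pos with rfl | hn
      · simp; ring
      · simp [Pi.single_eq_of_ne hn.ne']
    rw [e2, add_sub_cancel_right]
    exact (hc n).trans (mul_le_mul_of_nonneg_left
      (seqWeight_le_expWeight hρ0 hν0.le ht.1 n) (by positivity))
  have hmaps : MapsTo Ψ (closedBall zd r) (closedBall zd r) := by
    intro z hz
    rw [mem_closedBall] at hz ⊢
    calc dist (Ψ z) zd ≤ dist (Ψ z) (Ψ zd) + dist (Ψ zd) zd := dist_triangle _ _ _
      _ ≤ 1 / 2 * dist z zd + r / 2 := add_le_add (hcontr z hz zd hzdmem) hcentre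
      _ ≤ r := by linarith
  have hctr : ContractingWith (1 / 2) (hmaps.restrict Ψ _ _) := by
    refine ⟨by rw [← NNReal.coe_lt_coe]; norm_num, LipschitzWith.of_dist_le_mul ?_⟩
    rintro ⟨z, hz⟩ ⟨w, hw⟩
    simpa [Subtype.dist_eq] using hcontr z hz w hw
  obtain ⟨z, hz, hfix, -⟩ := hctr.exists_fixedPoint' isClosed_closedBall.isComplete hmaps hzdmem
    (edist_ne_top _ _)
  refine ⟨S z, K, continuous_weightedSeq ρ₀ ν T z, fun t n => ?_, fun t ht n => ?_,
    fun t ht n => ?_⟩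
  · exact (hballK z hz t n).trans (mul_le_mul_of_nonneg_left
      (seqWeight_antitone two_pos (hrad2 t) n) (by linarith))
  · have := hball z hz t n
    rw [clampTime_of_mem ht] at this
    refine this.trans (mul_le_mul_of_nonneg_left (seqWeight_antitone two_pos ?_ n) (by norm_num))
    have := hrad2 t
    rwa [clampTime_of_mem ht] at this
  · have h1 := hΨ z n t
    rw [hfix] at h1
    have hwt := Complex.ofReal_ne_zero.2 (expWeight_pos hρ0 ν n t).ne'
    rw [clampTime_of_mem ht, eq_div_iff hwt, mul_comm] at h1
    rw [← h1]
    simp only [hS, weightedSeq, clampTime_of_mem ht]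

/-! ### From the coefficients of `1 / f'` to a strong solution -/

theorem continuousOn_powerSum_family {a : ℝ → ℕ → ℂ} {ρ K : ℝ} (hρ : 0 < ρ)
    (hc : ∀ n, Continuous fun t => a t n) (ha : ∀ t, Dominated ρ K (a t)) :
    ContinuousOn (fun p : ℝ × ℂ => powerSum (a p.1) p.2) (univ ×ˢ closedBall 0 ρ) :=
  continuousOn_tsum (fun n => (((hc n).comp continuous_fst).mul (by fun_prop)).continuousOn)
    (summable_inv_succ_sq.mul_left K)
    fun n p hp => (ha p.1).norm_term_le hρ (mem_closedBall_zero_iff.1 hp.2) n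

theorem powerSum_single (x z : ℂ) : powerSum (Pi.single 0 x) z = x := by
  rw [powerSum, tsum_eq_single 0 (fun n hn => by simp [Pi.single_eq_of_ne hn])]; simp

theorem Dominated.powerSum_sub {ρ κ κ' : ℝ} {a b : ℕ → ℂ} (hρ : 0 < ρ) (ha : Dominated ρ κ a)
    (hb : Dominated ρ κ' b) {z : ℂ} (hz : ‖z‖ ≤ ρ) :
    powerSum (a - b) z = powerSum a z - powerSum b z := by
  rw [powerSum, powerSum, powerSum,
    ← (ha.hasSum hρ hz).summable.tsum_sub (hb.hasSum hρ hz).summable]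
  simp [sub_mul]

/-- The power series with coefficients `cubicForm a b c` is `a (z p)' - z p a'`. -/
theorem Dominated.powerSum_cubicForm {ρ κ κ' κ'' : ℝ} {a b c : ℕ → ℂ} (hρ : 1 ≤ ρ)
    (ha : Dominated ρ κ a) (hb : Dominated ρ κ' b) (hc : Dominated ρ κ'' c) {z : ℂ}
    (hz : z ∈ ball (0 : ℂ) ρ) :
    HasSum (fun n => cubicForm a b c n * z ^ n)
      (powerSum (_root_.hermProj b c) z * powerSum a z +
        (z * deriv (powerSum (_root_.hermProj b c)) z) * powerSum a z -
        powerSum (_root_.hermProj b c) z * (z * deriv (powerSum a) z)) := by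
  have hρ0 : 0 < ρ := by linarith
  have hp := hb.hermProj hρ hc
  have da := ha.differentiableOn_powerSum hρ0
  have dp := hp.differentiableOn_powerSum hρ0
  have da' : DifferentiableOn ℂ (fun z => z * deriv (powerSum a) z) (ball 0 ρ) :=
    differentiableOn_id.fun_mul (da.deriv isOpen_ball)
  have dp' : DifferentiableOn ℂ (fun z => z * deriv (powerSum (_root_.hermProj b c)) z)
    (ball 0 ρ) := differentiableOn_id.fun_mul (dp.deriv isOpen_ball)
  have h1 := hasSum_taylorCoeffZero (dp.fun_mul da) hz
  have h2 := hasSum_taylorCoeffZero (dp'.fun_mul da) hz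
  have h3 := hasSum_taylorCoeffZero (dp.fun_mul da') hz
  have h := (h1.add h2).sub h3
  have e : (fun n => cubicForm a b c n * z ^ n) = fun n =>
      taylorCoeffZero (fun z => powerSum (_root_.hermProj b c) z * powerSum a z) n * z ^ n +
      taylorCoeffZero (fun z => (z * deriv (powerSum (_root_.hermProj b c)) z) * powerSum a z) n *
        z ^ n -
      taylorCoeffZero (fun z => powerSum (_root_.hermProj b c) z * (z * deriv (powerSum a) z)) n *
        z ^ n := by
    ext n
    rw [taylorCoeffZero_mul hρ0 dp da, taylorCoeffZero_mul hρ0 dp' da,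
      taylorCoeffZero_mul hρ0 dp da', ← add_mul, ← sub_mul, ← Finset.sum_add_distrib,
      ← Finset.sum_sub_distrib, cubicForm]
    congr 1
    refine Finset.sum_congr rfl fun p _ => ?_
    rw [taylorCoeffZero_id_mul_deriv hρ0 da, taylorCoeffZero_id_mul_deriv hρ0 dp,
      ha.taylorCoeffZero_powerSum hρ0, hp.taylorCoeffZero_powerSum hρ0]
    ring
  rw [e]
  exact h

/-- The Noshiro-Warschawski criterion: if f(x) = f(y), the mean value theorem applied to the real
part of f/(y - x) along the segment gives a point where Re f' = 0. -/
theorem injOn_of_re_deriv_pos {f f' : ℂ → ℂ} {s : Set ℂ} (hs : Convex ℝ s)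
    (hd : ∀ z ∈ s, HasDerivAt f (f' z) z) (hpos : ∀ z ∈ s, 0 < (f' z).re) : InjOn f s := by
  intro x hx y hy hxy
  by_contra hne
  have hne' : y - x ≠ 0 := sub_ne_zero.2 (Ne.symm hne)
  have hseg : ∀ u ∈ Icc (0 : ℝ) 1, x + (u : ℂ) * (y - x) ∈ s := fun u hu => by
    have := hs.add_smul_sub_mem hx hy hu
    simpa using this
  let φ : ℝ → ℝ := fun u => (f (x + (u : ℂ) * (y - x)) / (y - x)).re
  have hφ : ∀ u ∈ Icc (0 : ℝ) 1, HasDerivAt φ (f' (x + (u : ℂ) * (y - x))).re u := fun u hu => by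
    have h1 : HasDerivAt (fun u : ℝ => x + (u : ℂ) * (y - x)) (y - x) u := by
      simpa using (Complex.ofRealCLM.hasDerivAt.mul_const (y - x)).const_add x
    have h2 := ((hd _ (hseg u hu)).comp u h1).div_const (y - x)
    rw [mul_div_cancel_right₀ _ hne'] at h2
    exact Complex.reCLM.hasFDerivAt.comp_hasDerivAt u h2
  obtain ⟨u, hu, hslope⟩ := exists_hasDerivAt_eq_slope φ _ one_pos
    (fun u hu => (hφ u hu).continuousAt.continuousWithinAt) (fun u hu => hφ u ⟨hu.1.le, hu.2.le⟩)
  have h0 := hpos _ (hseg u ⟨hu.1.le, hu.2.le⟩)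
  have h01 : φ 1 = φ 0 := by simp [φ, hxy]
  rw [hslope, h01] at h0
  simp at h0

/-- Differentiation under the integral of an analytic family. -/
theorem hasDerivAt_integral_family {G : ℝ → ℂ → ℂ} {T r t : ℝ}
    (hd : ∀ s ∈ Icc 0 T, DifferentiableOn ℂ (G s) (ball 0 r))
    (hc : ContinuousOn (fun p : ℝ × ℂ => G p.1 p.2) (Icc 0 T ×ˢ ball 0 r)) (ht : t ∈ Icc 0 T)
    {z : ℂ} (hz : z ∈ ball (0 : ℂ) r) :
    HasDerivAt (fun z => ∫ s in (0 : ℝ)..t, G s z) (∫ s in (0 : ℝ)..t, deriv (G s) z) z := by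
  obtain ⟨ε, hε, hsub⟩ := Metric.nhds_basis_closedBall.mem_iff.1 (isOpen_ball.mem_nhds hz)
  have hc' := continuousOn_deriv_family hd hc
  have hI : uIcc 0 t ⊆ Icc 0 T := by rw [uIcc_of_le ht.1]; exact Icc_subset_Icc_right ht.2
  have hI' : Set.uIoc 0 t ⊆ Icc 0 T := uIoc_subset_uIcc.trans hI
  have slice : ∀ {F : ℝ → ℂ → ℂ}, ContinuousOn (fun p : ℝ × ℂ => F p.1 p.2) (Icc 0 T ×ˢ ball 0 r) →
      ∀ x ∈ ball (0 : ℂ) r, ContinuousOn (fun s => F s x) (uIcc 0 t) := fun hF x hx =>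
    hF.comp (f := fun s => (s, x)) (by fun_prop) fun s hs => ⟨hI hs, hx⟩
  obtain ⟨M, hM⟩ := (isCompact_Icc.prod (isCompact_closedBall z ε)).exists_bound_of_continuousOn
    (hc'.mono (prod_mono_right hsub))
  refine (intervalIntegral.hasDerivAt_integral_of_dominated_loc_of_deriv_le
    (F := fun x s => G s x) (F' := fun x s => deriv (G s) x) (bound := fun _ => M)
    (closedBall_mem_nhds z hε) ?_ (slice hc z hz).intervalIntegrable ?_ ?_ ?_ ?_).2
  · filter_upwards [isOpen_ball.mem_nhds hz] with x hx
    exact ((slice hc x hx).mono uIoc_subset_uIcc).aestronglyMeasurable measurableSet_uIoc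
  · exact ((slice hc' z hz).mono uIoc_subset_uIcc).aestronglyMeasurable measurableSet_uIoc
  · exact Eventually.of_forall fun s hs x hx => hM (s, x) ⟨hI' hs, hx⟩
  · exact intervalIntegrable_const
  · exact Eventually.of_forall fun s hs x hx =>
      ((hd s (hI' hs)).differentiableAt (isOpen_ball.mem_nhds (hsub hx))).hasDerivAt

/-- A family of sequences solving the cubic system on `[0,T]`. -/
structure CoefficientFlow (T K : ℝ) (c : ℕ → ℂ) (h : ℝ → ℕ → ℂ) : Prop where
  continuous : ∀ n, Continuous fun t => h t n
  dominated : ∀ t, Dominated 2 K (h t)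
  close : ∀ t ∈ Icc 0 T, Dominated 2 (1 / 8) (h t - Pi.single 0 (diskInv t : ℂ))
  eq_integral : ∀ t ∈ Icc 0 T, ∀ n,
    h t n = c n + ∫ s in (0 : ℝ)..t, cubicForm (h s) (h s) (h s) n

namespace CoefficientFlow

variable {T K : ℝ} {c : ℕ → ℂ} {h : ℝ → ℕ → ℂ}

theorem continuous_cubicForm (H : CoefficientFlow T K c h) (n : ℕ) :
    Continuous fun s => cubicForm (h s) (h s) (h s) n :=
  _root_.continuous_cubicForm (ρ := fun _ => 2) (fun _ => one_le_two) H.dominated H.continuous n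

theorem hasDerivWithinAt_coeff (H : CoefficientFlow T K c h) (n : ℕ) {t : ℝ} (ht : t ∈ Icc 0 T) :
    HasDerivWithinAt (fun t => h t n) (cubicForm (h t) (h t) (h t) n) (Icc 0 T) t := by
  have h1 : HasDerivAt (fun t => c n + ∫ s in (0 : ℝ)..t, cubicForm (h s) (h s) (h s) n)
      (cubicForm (h t) (h t) (h t) n) t :=
    ((H.continuous_cubicForm n).integral_hasStrictDerivAt 0 t).hasDerivAt.const_add _
  exact h1.hasDerivWithinAt.congr (fun s hs => H.eq_integral s hs n) (H.eq_integral t ht n)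

theorem norm_powerSum_sub_le (H : CoefficientFlow T K c h) {t : ℝ} (ht : t ∈ Icc 0 T) {z : ℂ}
    (hz : ‖z‖ ≤ 2) : ‖powerSum (h t) z - diskInv t‖ ≤ 1 / 4 := by
  have h1 := (H.close t ht).norm_powerSum_le two_pos hz
  have h2 : Dominated 2 ‖(diskInv t : ℂ)‖ (Pi.single 0 (diskInv t : ℂ)) :=
    dominated_single two_pos (norm_nonneg _) le_rfl
  rw [(H.dominated t).powerSum_sub two_pos h2 hz, powerSum_single] at h1
  linarith

theorem re_powerSum_pos (H : CoefficientFlow T K c h) (hT : T < 1 / 2) {t : ℝ} (ht : t ∈ Icc 0 T)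
    {z : ℂ} (hz : ‖z‖ ≤ 2) : 0 < (powerSum (h t) z).re := by
  have h1 := (Complex.abs_re_le_norm _).trans (H.norm_powerSum_sub_le ht hz)
  rw [Complex.sub_re, Complex.ofReal_re, abs_le] at h1
  linarith [one_le_diskInv ht.1 (ht.2.trans_lt hT)]

theorem powerSum_ne_zero (H : CoefficientFlow T K c h) (hT : T < 1 / 2) {t : ℝ} (ht : t ∈ Icc 0 T)
    {z : ℂ} (hz : ‖z‖ ≤ 2) : powerSum (h t) z ≠ 0 := fun h0 => by
  have := H.re_powerSum_pos hT ht hz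
  rw [h0] at this
  simp at this

/-- |h| is at least d - 1/4 with d = 1/√(1-2t) ≥ 1, hence at least d/2. This bound on |f'| is what
forces the area to shrink. -/
theorem norm_inv_powerSum_le (H : CoefficientFlow T K c h) (hT : T < 1 / 2) {t : ℝ}
    (ht : t ∈ Icc 0 T) {z : ℂ} (hz : ‖z‖ ≤ 2) :
    ‖(powerSum (h t) z)⁻¹‖ ≤ 2 * Real.sqrt (1 - 2 * t) := by
  have h1 := H.norm_powerSum_sub_le ht hz
  have hd := one_le_diskInv ht.1 (ht.2.trans_lt hT)
  have h2 : diskInv t - ‖powerSum (h t) z‖ ≤ 1 / 4 := by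
    have := norm_sub_norm_le (diskInv t : ℂ) (powerSum (h t) z)
    rw [norm_sub_rev, Complex.norm_real, Real.norm_of_nonneg (by linarith)] at this
    linarith
  have h3 : (2 * Real.sqrt (1 - 2 * t))⁻¹ ≤ ‖powerSum (h t) z‖ := by
    rw [mul_inv]
    change 2⁻¹ * diskInv t ≤ _
    linarith
  rw [norm_inv]
  refine inv_le_of_inv_le₀ ?_ h3
  have : 0 < Real.sqrt (1 - 2 * t) := Real.sqrt_pos.2 (by linarith [ht.2])
  positivity

/-- The right-hand side `h (ξ p)' - ξ p h'`. -/
theorem hasDerivWithinAt_powerSum (H : CoefficientFlow T K c h) {t : ℝ} (ht : t ∈ Icc 0 T) {z : ℂ}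
    (hz : z ∈ ball (0 : ℂ) 2) : HasDerivWithinAt (fun t => powerSum (h t) z)
      (powerSum (hermProj (h t) (h t)) z * powerSum (h t) z +
        (z * deriv (powerSum (hermProj (h t) (h t))) z) * powerSum (h t) z -
        powerSum (hermProj (h t) (h t)) z * (z * deriv (powerSum (h t)) z)) (Icc 0 T) t := by
  have hz2 : ‖z‖ < 2 := mem_ball_zero_iff.1 hz
  have hK : 0 ≤ K := (H.dominated 0).nonneg
  -- The integral form is differentiable at every real time, unlike h itself, and agrees with the
  -- terms of the series on [0,T]; this permits termwise differentiation.
  let g : ℕ → ℝ → ℂ := fun n t =>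
    (c n + ∫ s in (0 : ℝ)..t, cubicForm (h s) (h s) (h s) n) * z ^ n
  have hg : ∀ n y, HasDerivAt (g n) (cubicForm (h y) (h y) (h y) n * z ^ n) y := fun n y =>
    (((H.continuous_cubicForm n).integral_hasStrictDerivAt 0 y).hasDerivAt.const_add _).mul_const _
  have hgeq : ∀ s ∈ Icc 0 T, ∀ n, g n s = h s n * z ^ n := fun s hs n => by
    simp only [g]; rw [← H.eq_integral s hs n]
  -- The factor 1/(n+1)² in the weight pays for the n + 1 of the derivative; for |z| < 2 the rest is
  -- geometric.
  have hbd : ∀ n y, ‖cubicForm (h y) (h y) (h y) n * z ^ n‖ ≤ 32 * K ^ 3 * (‖z‖ / 2) ^ n := by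
    intro n y
    rw [norm_mul, norm_pow]
    have h1 := (H.dominated y).norm_cubicForm_le one_le_two (H.dominated y) (H.dominated y) n
    calc _ ≤ ((n : ℝ) + 1) * (32 * K * K * K * seqWeight 2 n) * ‖z‖ ^ n := by gcongr
      _ = 32 * K ^ 3 * (‖z‖ / 2) ^ n * ((n : ℝ) + 1)⁻¹ := by
          rw [seqWeight, div_pow]; field_simp
      _ ≤ 32 * K ^ 3 * (‖z‖ / 2) ^ n * 1 := by
          gcongr
          exact inv_le_one_of_one_le₀ (by linarith [Nat.cast_nonneg (α := ℝ) n])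
      _ = _ := mul_one _
  have hu : Summable fun n : ℕ => 32 * K ^ 3 * (‖z‖ / 2) ^ n :=
    (summable_geometric_of_lt_one (by positivity) (by linarith)).mul_left _
  have hs0 : Summable fun n => g n t := by
    simp only [hgeq t ht]
    exact ((H.dominated t).hasSum two_pos hz2.le).summable
  have hder := hasDerivAt_tsum hu hg hbd hs0 t
  rw [((H.dominated t).powerSum_cubicForm one_le_two (H.dominated t) (H.dominated t) hz).tsum_eq]
    at hder
  have e : ∀ s ∈ Icc 0 T, powerSum (h s) z = ∑' n, g n s := fun s hs => by
    rw [powerSum]; exact tsum_congr fun n => (hgeq s hs n).symm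
  exact hder.hasDerivWithinAt.congr e (e t ht)

/-- At index 0 the system reads h₀' = p₀ h₀ with p₀ real, so Im h₀ satisfies a linear homogeneous
equation and stays 0 by Gronwall. This keeps f'(0,t) real. -/
theorem im_coeff_zero (H : CoefficientFlow T K c h) (hc0 : (c 0).im = 0) {t : ℝ}
    (ht : t ∈ Icc 0 T) : (h t 0).im = 0 := by
  have hform : ∀ s, (cubicForm (h s) (h s) (h s) 0).im =
      (hermProj (h s) (h s) 0).re * (h s 0).im := fun s => by
    simp [cubicForm, Complex.mul_im, hermProj_zero_im]
  refine eq_zero_of_abs_deriv_le_mul_abs_self_of_eq_zero_right (f := fun t => (h t 0).im)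
    (f' := fun t => (cubicForm (h t) (h t) (h t) 0).im) (K := 4 * K * K) (a := 0) (b := T)
    (Complex.continuous_im.comp (H.continuous 0)).continuousOn (fun s hs => ?_) ?_
    (fun s hs => ?_) t ht
  · have h1 : HasDerivWithinAt (fun t => (h t 0).im) (cubicForm (h s) (h s) (h s) 0).im (Icc 0 T) s :=
      Complex.imCLM.hasFDerivAt.comp_hasDerivWithinAt s
        (H.hasDerivWithinAt_coeff 0 (Ico_subset_Icc_self hs))
    exact h1.mono_of_mem_nhdsWithin (Icc_mem_nhdsGE_of_mem hs)
  · have h0T : (0 : ℝ) ∈ Icc 0 T := ⟨le_rfl, ht.1.trans ht.2⟩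
    rw [H.eq_integral 0 h0T 0]
    simpa using hc0
  · rw [hform, norm_mul]
    refine mul_le_mul_of_nonneg_right ?_ (norm_nonneg _)
    have h1 := (H.dominated s).hermProj one_le_two (H.dominated s) 0
    rw [seqWeight_zero, mul_one] at h1
    exact (Complex.abs_re_le_norm _).trans h1

end CoefficientFlow

/-! ### Velocity and reconstruction of the map -/

theorem hasDerivWithinAt_integral_of_continuousOn {g : ℝ → ℂ} {T t : ℝ}
    (hg : ContinuousOn g (Icc 0 T)) (ht : t ∈ Icc 0 T) :
    HasDerivWithinAt (fun t => ∫ s in (0 : ℝ)..t, g s) (g t) (Icc 0 T) t := by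
  have : Fact (t ∈ Icc 0 T) := ⟨ht⟩
  exact intervalIntegral.integral_hasDerivWithinAt_right
    (hg.mono (by rw [uIcc_of_le ht.1]; exact Icc_subset_Icc_right ht.2)).intervalIntegrable
    (hg.stronglyMeasurableAtFilter_nhdsWithin measurableSet_Icc t) (hg t ht)

/-- The velocity `f_t = -ξ p / h` of the solution with `1 / f' = h`, where `p` is analytic with
`Re p = |h|²` on the unit circle. -/
noncomputable def flowVelocity (h : ℝ → ℕ → ℂ) (t : ℝ) (z : ℂ) : ℂ :=
  -(z * powerSum (hermProj (h t) (h t)) z * (powerSum (h t) z)⁻¹)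

/-- The solution with initial function `g` and velocity `flowVelocity h`. -/
noncomputable def flowMap (g : ℂ → ℂ) (h : ℝ → ℕ → ℂ) (t : ℝ) (z : ℂ) : ℂ :=
  g z + ∫ s in (0 : ℝ)..t, flowVelocity h s z

namespace CoefficientFlow

variable {T K : ℝ} {c : ℕ → ℂ} {h : ℝ → ℕ → ℂ}

theorem dominated_hermProj (H : CoefficientFlow T K c h) (t : ℝ) :
    Dominated 2 (4 * K * K) (hermProj (h t) (h t)) :=
  (H.dominated t).hermProj one_le_two (H.dominated t)

theorem continuousOn_flowVelocity (H : CoefficientFlow T K c h) (hT : T < 1 / 2) :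
    ContinuousOn (fun p : ℝ × ℂ => flowVelocity h p.1 p.2) (Icc 0 T ×ˢ closedBall 0 2) := by
  have h1 := (continuousOn_powerSum_family two_pos H.continuous H.dominated).mono
    (prod_mono_left (subset_univ (Icc 0 T)))
  have h2 := (continuousOn_powerSum_family two_pos
    (continuous_hermProj (ρ := fun _ => 2) (fun _ => one_le_two) H.dominated H.continuous)
    H.dominated_hermProj).mono (prod_mono_left (subset_univ (Icc 0 T)))
  exact ((continuousOn_snd.mul h2).mul (h1.inv₀ fun p hp =>
    H.powerSum_ne_zero hT hp.1 (mem_closedBall_zero_iff.1 hp.2))).neg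

/-- The value is -h_t/h², the time derivative of 1/h. This compatibility is why the integrated map
has ξ-derivative exactly 1/h. -/
theorem hasDerivAt_flowVelocity (H : CoefficientFlow T K c h) (hT : T < 1 / 2) {t : ℝ}
    (ht : t ∈ Icc 0 T) {z : ℂ} (hz : z ∈ ball (0 : ℂ) 2) :
    HasDerivAt (flowVelocity h t) (-(powerSum (hermProj (h t) (h t)) z * powerSum (h t) z +
        (z * deriv (powerSum (hermProj (h t) (h t))) z) * powerSum (h t) z -
        powerSum (hermProj (h t) (h t)) z * (z * deriv (powerSum (h t)) z)) /
          powerSum (h t) z ^ 2) z := by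
  have hn := isOpen_ball.mem_nhds hz
  have hne := H.powerSum_ne_zero hT ht (mem_ball_zero_iff.1 hz).le
  have d1 := (((H.dominated t).differentiableOn_powerSum two_pos).differentiableAt hn).hasDerivAt
  have d2 := (((H.dominated_hermProj t).differentiableOn_powerSum
    two_pos).differentiableAt hn).hasDerivAt
  refine ((((hasDerivAt_id' z).fun_mul d2).fun_mul (d1.fun_inv hne)).fun_neg).congr_deriv ?_
  field_simp
  ring

theorem differentiableOn_flowVelocity (H : CoefficientFlow T K c h) (hT : T < 1 / 2) {t : ℝ}
    (ht : t ∈ Icc 0 T) : DifferentiableOn ℂ (flowVelocity h t) (ball 0 2) := fun _ hz =>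
  (H.hasDerivAt_flowVelocity hT ht hz).differentiableAt.differentiableWithinAt

theorem integral_deriv_flowVelocity (H : CoefficientFlow T K c h) (hT : T < 1 / 2) {t : ℝ}
    (ht : t ∈ Icc 0 T) {z : ℂ} (hz : z ∈ ball (0 : ℂ) 2) :
    ∫ s in (0 : ℝ)..t, deriv (flowVelocity h s) z =
      (powerSum (h t) z)⁻¹ - (powerSum (h 0) z)⁻¹ := by
  have hz2 := (mem_ball_zero_iff.1 hz).le
  have hsub : uIcc 0 t ⊆ Icc 0 T := by rw [uIcc_of_le ht.1]; exact Icc_subset_Icc_right ht.2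
  have hd : ∀ s ∈ Icc 0 T, HasDerivWithinAt (fun s => (powerSum (h s) z)⁻¹)
      (deriv (flowVelocity h s) z) (Icc 0 T) s := fun s hs => by
    rw [(H.hasDerivAt_flowVelocity hT hs hz).deriv]
    exact (H.hasDerivWithinAt_powerSum hs hz).fun_inv (H.powerSum_ne_zero hT hs hz2)
  have hc : ContinuousOn (fun s => deriv (flowVelocity h s) z) (Icc 0 T) :=
    (continuousOn_deriv_family (fun s hs => H.differentiableOn_flowVelocity hT hs)
      ((H.continuousOn_flowVelocity hT).mono (prod_mono_right ball_subset_closedBall))).comp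
      (f := fun s => (s, z)) (by fun_prop) fun s hs => ⟨hs, hz⟩
  refine intervalIntegral.integral_eq_sub_of_hasDeriv_right
    (f := fun s => (powerSum (h s) z)⁻¹)
    (fun s hs => ((hd s (hsub hs)).mono hsub).continuousWithinAt) (fun s hs => ?_)
    (hc.mono hsub).intervalIntegrable
  rw [min_eq_left ht.1, max_eq_right ht.1] at hs
  have hs' : s ∈ Ico 0 T := ⟨hs.1.le, hs.2.trans_le ht.2⟩
  exact ((hd s (Ico_subset_Icc_self hs')).mono_of_mem_nhdsWithin
    (Icc_mem_nhdsGE_of_mem hs')).mono Ioi_subset_Ici_self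

theorem apply_zero (H : CoefficientFlow T K c h) (hT0 : 0 ≤ T) : h 0 = c := by
  ext n; simp [H.eq_integral 0 ⟨le_rfl, hT0⟩ n]

section

variable {g : ℂ → ℂ}

theorem hasDerivAt_flowMap (H : CoefficientFlow T K c h) (hT : T < 1 / 2)
    (hg : ∀ z ∈ ball (0 : ℂ) 2, HasDerivAt g (powerSum c z)⁻¹ z) {t : ℝ} (ht : t ∈ Icc 0 T)
    {z : ℂ} (hz : z ∈ ball (0 : ℂ) 2) :
    HasDerivAt (flowMap g h t) (powerSum (h t) z)⁻¹ z := by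
  have h1 := hasDerivAt_integral_family (fun s hs => H.differentiableOn_flowVelocity hT hs)
    ((H.continuousOn_flowVelocity hT).mono (prod_mono_right ball_subset_closedBall)) ht hz
  refine ((hg z hz).fun_add h1).congr_deriv ?_
  rw [H.integral_deriv_flowVelocity hT ht hz, H.apply_zero (ht.1.trans ht.2)]
  ring

theorem hasDerivWithinAt_flowMap (H : CoefficientFlow T K c h) (hT : T < 1 / 2) (g : ℂ → ℂ)
    {t : ℝ} (ht : t ∈ Icc 0 T) {z : ℂ} (hz : z ∈ closedBall (0 : ℂ) 2) :
    HasDerivWithinAt (fun s => flowMap g h s z) (flowVelocity h t z) (Icc 0 T) t :=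
  (hasDerivWithinAt_integral_of_continuousOn (g := fun s => flowVelocity h s z)
    ((H.continuousOn_flowVelocity hT).comp (f := fun s => (s, z)) (by fun_prop)
      fun s hs => ⟨hs, hz⟩) ht).const_add _

theorem continuousOn_flowMap (H : CoefficientFlow T K c h) (hT : T < 1 / 2)
    (hg : ∀ z ∈ ball (0 : ℂ) 2, HasDerivAt g (powerSum c z)⁻¹ z) :
    ContinuousOn (fun p : ℝ × ℂ => flowMap g h p.1 p.2) (Icc 0 T ×ˢ ball 0 2) := by
  obtain ⟨M, hM⟩ := (isCompact_Icc.prod (isCompact_closedBall (0 : ℂ) 2)).exists_bound_of_continuousOn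
    (H.continuousOn_flowVelocity hT)
  -- Joint continuity follows from continuity in z together with a Lipschitz bound in t that is
  -- uniform in z.
  refine continuousOn_prod_of_continuousOn_lipschitzOnWith _ M.toNNReal
    (fun t ht z hz => (H.hasDerivAt_flowMap hT hg ht hz).continuousAt.continuousWithinAt)
    fun z hz => (convex_Icc 0 T).lipschitzOnWith_of_nnnorm_hasDerivWithin_le
      (fun t ht => H.hasDerivWithinAt_flowMap hT g ht (ball_subset_closedBall hz)) fun t ht => ?_
  rw [← NNReal.coe_le_coe, coe_nnnorm]
  exact (hM (t, z) ⟨ht, ball_subset_closedBall hz⟩).trans (Real.le_coe_toNNReal M)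

theorem norm_flowMap_le (H : CoefficientFlow T K c h) (hT : T < 1 / 2)
    (hg : ∀ z ∈ ball (0 : ℂ) 2, HasDerivAt g (powerSum c z)⁻¹ z) (hg0 : g 0 = 0) {t : ℝ}
    (ht : t ∈ Icc 0 T) {z : ℂ} (hz : z ∈ closedBall (0 : ℂ) 1) :
    ‖flowMap g h t z‖ ≤ 2 * Real.sqrt (1 - 2 * t) := by
  have h1 := (convex_closedBall (0 : ℂ) 1).norm_image_sub_le_of_norm_hasDerivWithin_le
    (f := flowMap g h t) (f' := fun z => (powerSum (h t) z)⁻¹) (x := 0) (y := z)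
    (fun x hx => (H.hasDerivAt_flowMap hT hg ht
      (closedBall_subset_ball one_lt_two hx)).hasDerivWithinAt)
    (fun x hx => H.norm_inv_powerSum_le hT ht
      ((mem_closedBall_zero_iff.1 hx).trans one_le_two))
    (mem_closedBall_self zero_le_one) hz
  have h0 : flowMap g h t 0 = 0 := by simp [flowMap, flowVelocity, hg0]
  rw [h0, sub_zero, sub_zero] at h1
  refine h1.trans (mul_le_of_le_one_right (by positivity) (mem_closedBall_zero_iff.1 hz))

/-- Univalence on |ξ| < 2 holds because Re f' = Re h/|h|² > 0 there. The boundary equation holds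
because f_t · conj(f' ξ) = -p/|h|² on the circle, where Re p = |h|². -/
theorem isStrongSuctionSolution_flowMap (H : CoefficientFlow T K c h) (hT : T < 1 / 2)
    (hc0 : (c 0).im = 0) (hg : ∀ z ∈ ball (0 : ℂ) 2, HasDerivAt g (powerSum c z)⁻¹ z)
    (hg0 : g 0 = 0) : IsStrongSuctionSolution T (flowMap g h) := by
  have htd : ∀ t ∈ Ico 0 T, ∀ z ∈ closedBall (0 : ℂ) 2,
      timeDeriv T (flowMap g h) t z = flowVelocity h t z := fun t ht z hz =>
    timeDeriv_eq ht ((H.hasDerivWithinAt_flowMap hT g (Ico_subset_Icc_self ht) hz).mono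
      Ico_subset_Icc_self)
  refine ⟨fun T' hT'0 hT' => ⟨2, one_lt_two, fun t ht => ?_, fun t ht z hz => ?_, ?_, ?_⟩,
    fun t _ => by simp [flowMap, flowVelocity, hg0], fun t ht => ?_, fun t ht z hz => ?_⟩
  · have ht' : t ∈ Icc 0 T := Icc_subset_Icc_right hT'.le ht
    refine ⟨fun z hz => (H.hasDerivAt_flowMap hT hg ht' hz).differentiableAt.differentiableWithinAt,
      injOn_of_re_deriv_pos (convex_ball 0 2) (fun z hz => H.hasDerivAt_flowMap hT hg ht' hz)
        fun z hz => ?_⟩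
    have hz2 := (mem_ball_zero_iff.1 hz).le
    rw [Complex.inv_re]
    exact div_pos (H.re_powerSum_pos hT ht' hz2)
      (Complex.normSq_pos.2 (H.powerSum_ne_zero hT ht' hz2))
  · exact ((H.hasDerivWithinAt_flowMap hT g (Icc_subset_Icc_right hT'.le ht)
      (ball_subset_closedBall hz)).mono Ico_subset_Icc_self).differentiableWithinAt
  · exact (H.continuousOn_flowMap hT hg).mono (prod_mono_left (Icc_subset_Icc_right hT'.le))
  · refine ((H.continuousOn_flowVelocity hT).mono
      (prod_mono (Icc_subset_Icc_right hT'.le) ball_subset_closedBall)).congr fun p hp => ?_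
    exact htd p.1 ⟨hp.1.1, hp.1.2.trans_lt hT'⟩ p.2 (ball_subset_closedBall hp.2)
  · have ht' := Ico_subset_Icc_self ht
    rw [(H.hasDerivAt_flowMap hT hg ht' (mem_ball_self two_pos)).deriv, Complex.inv_re,
      Complex.inv_im, powerSum_at_zero, H.im_coeff_zero hc0 ht']
    have h1 := H.re_powerSum_pos hT ht' (z := 0) (by simp)
    have h2 := H.powerSum_ne_zero hT ht' (z := 0) (by simp)
    rw [powerSum_at_zero] at h1 h2
    exact ⟨div_pos h1 (Complex.normSq_pos.2 h2), by simp⟩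
  · have ht' := Ico_subset_Icc_self ht
    have hzb : z ∈ ball (0 : ℂ) 2 := by simp [hz]
    have hne := H.powerSum_ne_zero hT ht' (z := z) (by simp [hz])
    rw [htd t ht z (ball_subset_closedBall hzb), (H.hasDerivAt_flowMap hT hg ht' hzb).deriv]
    have hre := re_powerSum_hermProj one_le_two (H.dominated t) (H.dominated t) hz
    rw [Complex.mul_conj, Complex.ofReal_re] at hre
    have hzz : z * (starRingEnd ℂ) z = 1 := by
      rw [Complex.mul_conj, Complex.normSq_eq_norm_sq, hz]; norm_num
    have hn : Complex.normSq (powerSum (h t) z) ≠ 0 := (Complex.normSq_pos.2 hne).ne'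
    have e : flowVelocity h t z * (starRingEnd ℂ) ((powerSum (h t) z)⁻¹ * z) =
        -(powerSum (hermProj (h t) (h t)) z *
          ((Complex.normSq (powerSum (h t) z))⁻¹ : ℝ)) := by
      rw [← map_inv₀, ← Complex.mul_conj, map_mul, flowVelocity]
      linear_combination (-(powerSum (hermProj (h t) (h t)) z * (powerSum (h t) z)⁻¹ *
        (starRingEnd ℂ) (powerSum (h t) z)⁻¹)) * hzz
    rw [e, Complex.neg_re, Complex.re_mul_ofReal, hre, mul_inv_cancel₀ hn]

end

end CoefficientFlow

/-! ### Initial functions close to the identity -/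

/-- A function close to the identity extends to the disk of radius `ρ`, with derivative close to
`1`. -/
theorem IsCloseToDisk.exists_extension {ρ δ : ℝ} {f₀ : ℂ → ℂ} (hρ : 1 ≤ ρ) (hδ : 0 ≤ δ)
    (h : IsCloseToDisk ρ δ f₀) : ∃ g : ℂ → ℂ, DifferentiableOn ℂ g (ball 0 ρ) ∧
      EqOn g f₀ (ball 0 1) ∧ ∀ z ∈ ball (0 : ℂ) ρ, ‖deriv g z - 1‖ ≤ δ := by
  have hρ0 : 0 < ρ := by linarith
  set v : ℂ → ℂ := fun ξ => f₀ ξ - ξ with hv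
  let a : ℕ → ℂ := fun n => taylorCoeffZero v (n + 1)
  let w : ℕ → ℝ := fun n =>
    ‖a n‖ * ρ ^ (n + 1) * ((n + 1 : ℕ) : ℝ) ^ ((1 / 2 : ℝ) + ((1 : ℕ) : ℝ))
  let u : ℕ → ℝ := fun n => ((n : ℝ) + 1) * ‖a n‖ * ρ ^ n
  have hw0 : ∀ n, 0 ≤ w n := fun n => by positivity
  -- The terms u bound those of v' on |z| < ρ. The norm controls them since j^{3/2} ≥ j and ρ^{n+1}
  -- ≥ ρⁿ.
  have huw : ∀ n, u n ≤ w n := fun n => by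
    have e1 : ρ ^ n ≤ ρ ^ (n + 1) := pow_le_pow_right₀ hρ n.le_succ
    have e2 : ((n : ℝ) + 1) ≤ ((n + 1 : ℕ) : ℝ) ^ ((1 / 2 : ℝ) + ((1 : ℕ) : ℝ)) := by
      conv_lhs => rw [← Nat.cast_succ, ← Real.rpow_one ((n.succ : ℕ) : ℝ)]
      refine Real.rpow_le_rpow_of_exponent_le ?_ (by norm_num)
      exact_mod_cast Nat.succ_le_succ n.zero_le
    calc u n = ‖a n‖ * ρ ^ n * ((n : ℝ) + 1) := by simp only [u]; ring
      _ ≤ w n := by simp only [w]; gcongr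
  have hsum : ∀ s : Finset ℕ, ∑ n ∈ s, u n ≤ δ := fun s => by
    refine (Finset.sum_le_sum fun n _ => huw n).trans ?_
    rw [← ENNReal.ofReal_le_ofReal_iff hδ, ENNReal.ofReal_sum_of_nonneg fun n _ => hw0 n]
    exact (ENNReal.sum_le_tsum s).trans h.close.le
  have hu0 : ∀ n, 0 ≤ u n := fun n => by positivity
  have hu : Summable u := summable_of_sum_le hu0 hsum
  have hbd : ∀ n, ∀ z ∈ ball (0 : ℂ) ρ, ‖a n * (((n : ℂ) + 1) * z ^ n)‖ ≤ u n := fun n z hz => by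
    have : ‖(n : ℂ) + 1‖ = (n : ℝ) + 1 := by
      rw [← Nat.cast_succ, Complex.norm_natCast, Nat.cast_succ]
    rw [norm_mul, norm_mul, norm_pow, this]
    calc _ ≤ ‖a n‖ * (((n : ℝ) + 1) * ρ ^ n) := by
          gcongr; exact (mem_ball_zero_iff.1 hz).le
      _ = u n := by simp only [u]; ring
  have hder : ∀ z ∈ ball (0 : ℂ) ρ, HasDerivAt (fun z => z + ∑' n, a n * z ^ (n + 1))
      (1 + ∑' n, a n * (((n : ℂ) + 1) * z ^ n)) z := fun z hz => by
    refine (hasDerivAt_id' z).fun_add (hasDerivAt_tsum_of_isPreconnected hu isOpen_ball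
      (convex_ball (0 : ℂ) ρ).isPreconnected (fun n y _ => ?_) hbd (mem_ball_self hρ0) ?_ hz)
    · simpa using (hasDerivAt_pow (n + 1) y).const_mul (a n)
    · simp
  refine ⟨fun z => z + ∑' n, a n * z ^ (n + 1),
    fun z hz => (hder z hz).differentiableAt.differentiableWithinAt, fun z hz => ?_,
    fun z hz => ?_⟩
  · have h1 := hasSum_taylorCoeffZero (f := v) (h.analytic.fun_sub differentiableOn_id) hz
    rw [← hasSum_nat_add_iff' 1] at h1
    simp only [Finset.range_one, Finset.sum_singleton, taylorCoeffZero_zero, hv, h.map_zero] at h1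
    simp only [a, hv, h1.tsum_eq]
    ring
  · rw [(hder z hz).deriv, add_sub_cancel_left]
    exact (tsum_of_norm_bounded hu.hasSum fun n => hbd n z hz).trans
      (Real.tsum_le_of_sum_le hu0 hsum)

theorem hasSum_single_zero_mul_pow (x z : ℂ) :
    HasSum (fun n => (Pi.single 0 x : ℕ → ℂ) n * z ^ n) x := by
  have h := hasSum_single (f := fun n => (Pi.single 0 x : ℕ → ℂ) n * z ^ n) 0
    (fun n hn => by simp [Pi.single_eq_of_ne hn])
  simpa using h

/-- As |g'| ≥ 1/2, one has |1/g' - 1| ≤ 2δ. Cauchy's estimate on the intermediate radius 3ρ/2 gives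
the geometric ratio 2/3. -/
theorem dominated_taylorCoeffZero_inv_deriv {g : ℂ → ℂ} {ρ δ A : ℝ} (hρ : 0 < ρ) (hδ : δ ≤ 1 / 2)
    (hg : DifferentiableOn ℂ g (ball 0 (2 * ρ)))
    (hd : ∀ z ∈ ball (0 : ℂ) (2 * ρ), ‖deriv g z - 1‖ ≤ δ)
    (hA : ∀ n : ℕ, ((n : ℝ) + 1) ^ 2 * (2 / 3 : ℝ) ^ n ≤ A) :
    (∀ z ∈ ball (0 : ℂ) (2 * ρ),
      HasSum (fun n => taylorCoeffZero (fun z => (deriv g z)⁻¹) n * z ^ n) (deriv g z)⁻¹) ∧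
    Dominated ρ (2 * δ * A) (taylorCoeffZero (fun z => (deriv g z)⁻¹) - Pi.single 0 1) := by
  have hge : ∀ z ∈ ball (0 : ℂ) (2 * ρ), 1 / 2 ≤ ‖deriv g z‖ := fun z hz => by
    have h1 := norm_sub_norm_le 1 (deriv g z)
    rw [norm_sub_rev, norm_one] at h1
    linarith [hd z hz]
  have hne : ∀ z ∈ ball (0 : ℂ) (2 * ρ), deriv g z ≠ 0 := fun z hz h0 => by
    have := hge z hz
    rw [h0, norm_zero] at this
    linarith
  have hdiff : DifferentiableOn ℂ (fun z => (deriv g z)⁻¹) (ball 0 (2 * ρ)) :=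
    (hg.deriv isOpen_ball).fun_inv hne
  have hs := fun z hz => hasSum_taylorCoeffZero (z := z) hdiff hz
  refine ⟨hs, ?_⟩
  have hr : 0 < 2 * ρ := by linarith
  have e : taylorCoeffZero (fun z => (deriv g z)⁻¹ - 1) =
      taylorCoeffZero (fun z => (deriv g z)⁻¹) - Pi.single 0 1 :=
    taylorCoeffZero_eq_of_hasSum hr fun z hz => by
      simpa only [Pi.sub_apply, sub_mul] using (hs z hz).sub (hasSum_single_zero_mul_pow 1 z)
  rw [← e]
  refine dominated_taylorCoeffZero (R := 3 / 2 * ρ) (hdiff.fun_sub (differentiableOn_const 1)) hρ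
    (by linarith) (by linarith) (fun z hz => ?_) (fun n => ?_)
  · have hz' : z ∈ ball (0 : ℂ) (2 * ρ) := closedBall_subset_ball (by linarith) hz
    have h1 : (deriv g z)⁻¹ - 1 = (1 - deriv g z) * (deriv g z)⁻¹ := by
      field_simp [hne z hz']
    rw [h1, norm_mul, norm_inv, norm_sub_rev, mul_comm 2 δ]
    refine mul_le_mul (hd z hz') ?_ (by positivity) ((norm_nonneg _).trans (hd z hz'))
    exact inv_le_of_inv_le₀ two_pos (by linarith [hge z hz'])
  · have : ρ / (3 / 2 * ρ) = 2 / 3 := by field_simp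
    rw [this]
    exact hA n

/-- |g(z) - z| ≤ |z|/2 gives |g| ≥ 1/4 on |z| = 1/2, and the quantitative open mapping theorem
covers a disk of half that radius. -/
theorem ball_subset_image_of_norm_deriv_sub_one_le {g : ℂ → ℂ}
    (hg : DifferentiableOn ℂ g (ball 0 1)) (hg0 : g 0 = 0)
    (hd : ∀ z ∈ ball (0 : ℂ) 1, ‖deriv g z - 1‖ ≤ 1 / 2) :
    ball (0 : ℂ) (1 / 8) ⊆ g '' ball 0 1 := by
  have hsub : closedBall (0 : ℂ) (1 / 2) ⊆ ball 0 1 := closedBall_subset_ball (by norm_num)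
  have hda : ∀ z ∈ ball (0 : ℂ) 1, HasDerivAt g (deriv g z) z := fun z hz =>
    (hg.differentiableAt (isOpen_ball.mem_nhds hz)).hasDerivAt
  have hlow : ∀ z ∈ sphere (0 : ℂ) (1 / 2), 1 / 4 ≤ ‖g z - g 0‖ := fun z hz => by
    have h1 := (convex_ball (0 : ℂ) 1).norm_image_sub_le_of_norm_hasDerivWithin_le
      (f := fun z => g z - z) (fun x hx => ((hda x hx).fun_sub (hasDerivAt_id' x)).hasDerivWithinAt)
      hd (mem_ball_self one_pos) (hsub (sphere_subset_closedBall hz))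
    have hz' : ‖z‖ = 1 / 2 := mem_sphere_zero_iff_norm.1 hz
    rw [hg0, sub_zero, sub_zero, sub_zero, hz'] at h1
    have h2 := norm_sub_norm_le z (g z)
    rw [norm_sub_rev] at h2
    rw [hg0, sub_zero]
    linarith
  have hne : deriv g 0 ≠ 0 := fun h0 => by
    have := hd 0 (mem_ball_self one_pos)
    rw [h0] at this
    norm_num at this
  have hfreq : ∃ᶠ z in 𝓝 (0 : ℂ), g z ≠ g 0 :=
    ((hda 0 (mem_ball_self one_pos)).eventually_ne hne).frequently.filter_mono nhdsWithin_le_nhds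
  have hcl : DiffContOnCl ℂ g (ball 0 (1 / 2)) :=
    (hg.mono (by rw [closure_ball _ (by norm_num)]; exact hsub)).diffContOnCl
  have h := hcl.ball_subset_image_closedBall (by norm_num) hlow hfreq
  rw [hg0] at h
  refine Subset.trans ?_ (h.trans (image_mono hsub))
  exact ball_subset_ball (by norm_num)

/-- Initial functions close to the identity have a strong solution on `[0,T)`, which is controlled
by the solution for the disk. -/
theorem exists_strongSuctionSolution {T : ℝ} (hT0 : 0 < T) (hT : T < 1 / 2) :
    ∃ ρ δ : ℝ, 1 < ρ ∧ 0 < δ ∧ ∀ f₀ : ℂ → ℂ, IsCloseToDisk ρ δ f₀ →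
      ball (0 : ℂ) (1 / 8) ⊆ f₀ '' ball 0 1 ∧
      ∃ f, IsStrongSuctionSolution T f ∧ EqOn (f 0) f₀ (ball 0 1) ∧
        ∀ t ∈ Icc 0 T, ∀ z ∈ closedBall (0 : ℂ) 1, ‖f t z‖ ≤ 2 * Real.sqrt (1 - 2 * t) := by
  obtain ⟨ρ₀, η, hρ₀, hη, hflow⟩ := exists_coefficient_flow hT0 hT
  obtain ⟨A, hA, hAn⟩ := exists_sq_mul_geometric_le (q := 2 / 3) (by norm_num) (by norm_num)
  -- The radius is doubled to leave room for Cauchy's estimate, and δ is chosen so that 2δA ≤ η and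
  -- |g' - 1| ≤ 1/2.
  refine ⟨2 * ρ₀, min (1 / 2) (η / (2 * A)), by linarith, by positivity, fun f₀ h => ?_⟩
  have hδ : min (1 / 2) (η / (2 * A)) ≤ 1 / 2 := min_le_left _ _
  obtain ⟨g, hg, hgf, hgd⟩ := h.exists_extension (by linarith) (by positivity)
  obtain ⟨hs, hdom⟩ := dominated_taylorCoeffZero_inv_deriv (by linarith) hδ hg hgd hAn
  have hg0 : g 0 = 0 := by rw [hgf (mem_ball_self one_pos), h.map_zero]
  have h12 : ball (0 : ℂ) 1 ⊆ ball 0 (2 * ρ₀) := ball_subset_ball (by linarith)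
  have h22 : ball (0 : ℂ) 2 ⊆ ball 0 (2 * ρ₀) := ball_subset_ball (by linarith)
  refine ⟨hgf.image_eq ▸ ball_subset_image_of_norm_deriv_sub_one_le (hg.mono h12) hg0
    fun z hz => (hgd z (h12 hz)).trans hδ, ?_⟩
  set c := taylorCoeffZero (fun z => (deriv g z)⁻¹) with hc
  have hη' : 2 * min (1 / 2) (η / (2 * A)) * A ≤ η := by
    have := mul_le_mul_of_nonneg_right (min_le_right (1 / 2) (η / (2 * A))) (by positivity : 0 ≤ 2 * A)
    rw [div_mul_cancel₀ _ (by positivity)] at this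
    linarith
  obtain ⟨h', K, h1, h2, h3, h4⟩ := hflow c (hdom.mono (by linarith) hη')
  have H : CoefficientFlow T K c h' := ⟨h1, h2, h3, h4⟩
  have hc0 : (c 0).im = 0 := by
    rw [hc, taylorCoeffZero_zero, (hgf.eventuallyEq_of_mem (ball_mem_nhds 0 one_pos)).deriv_eq,
      Complex.inv_im, h.deriv_zero_pos.2]
    simp
  have hgder : ∀ z ∈ ball (0 : ℂ) 2, HasDerivAt g (powerSum c z)⁻¹ z := fun z hz => by
    rw [powerSum, (hs z (h22 hz)).tsum_eq, inv_inv]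
    exact (hg.differentiableAt (isOpen_ball.mem_nhds (h22 hz))).hasDerivAt
  refine ⟨flowMap g h', H.isStrongSuctionSolution_flowMap hT hc0 hgder hg0, fun z hz => ?_,
    fun t ht z hz => H.norm_flowMap_le hT hgder hg0 ht hz⟩
  simp [flowMap, hgf hz]


/-! ### Assembly of the three statements -/

theorem mainTheorem5 :
    (IsMaximalStrongSuctionSolution (fun ξ => ξ) (1 / 2) diskSolution ∧
      ∀ t ∈ Icc (0 : ℝ) (1 / 2),
        volume (diskSolution t '' ball (0 : ℂ) 1) = ENNReal.ofReal (Real.pi * (1 - 2 * t))) ∧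
    (∀ T₀ : ℝ, T₀ < 1 / 2 → ∃ ρ δ : ℝ, 1 < ρ ∧ 0 < δ ∧
      ∀ f₀ : ℂ → ℂ, IsCloseToDisk ρ δ f₀ →
        ∃ (b : ℝ) (f : ℝ → ℂ → ℂ), IsMaximalStrongSuctionSolution f₀ b f ∧ T₀ < b) ∧
    (∀ ε : ℝ, 0 < ε → ∃ ρ δ : ℝ, 1 < ρ ∧ 0 < δ ∧
      ∀ f₀ : ℂ → ℂ, IsCloseToDisk ρ δ f₀ →
        ∃ (b : ℝ) (f : ℝ → ℂ → ℂ), IsMaximalStrongSuctionSolution f₀ b f ∧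
          ∃ T ∈ Ioo 0 b, volume (f T '' ball (0 : ℂ) 1) ≤
            ENNReal.ofReal ε * volume (f 0 '' ball (0 : ℂ) 1)) := by
  refine ⟨⟨isMaximalStrongSuctionSolution_diskSolution,
    fun t ht => volume_diskSolution_image ht.2⟩, fun T₀ hT₀ => ?_, fun ε hε => ?_⟩
  -- A time strictly between T₀ and 1/2; the maximum with 1/4 keeps it positive when T₀ is negative.
  · have h1 : max ((T₀ + 1 / 2) / 2) (1 / 4) < 1 / 2 := max_lt (by linarith) (by norm_num)
    have h0 : 0 < max ((T₀ + 1 / 2) / 2) (1 / 4) := lt_max_of_lt_right (by norm_num)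
    obtain ⟨ρ, δ, hρ, hδ, H⟩ := exists_strongSuctionSolution h0 h1
    refine ⟨ρ, δ, hρ, hδ, fun f₀ hf₀ => ?_⟩
    obtain ⟨-, g, hg, hgi, -⟩ := H f₀ hf₀
    obtain ⟨b, f, hf, hb⟩ := hg.exists_maximal h0 hgi
    exact ⟨b, f, hf, by linarith [le_max_left ((T₀ + 1 / 2) / 2) (1 / 4)]⟩
  -- x is the fraction 1 - 2T of area left by the disk at the chosen time. The final area is at most
  -- 4πx and the initial one at least π/64, hence ε/256; the bound 1/2 keeps T positive.
  · set x := min (ε / 256) (1 / 2) with hx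
    have hx0 : 0 < x := by positivity
    have hx1 : x ≤ 1 / 2 := min_le_right _ _
    have hxε : x ≤ ε / 256 := min_le_left _ _
    -- The existence interval ends at (1 - x/2)/2, strictly after the observation time (1 - x)/2.
    obtain ⟨ρ, δ, hρ, hδ, H⟩ :=
      exists_strongSuctionSolution (T := (1 - x / 2) / 2) (by linarith) (by linarith)
    refine ⟨ρ, δ, hρ, hδ, fun f₀ hf₀ => ?_⟩
    obtain ⟨hball, g, hg, hgi, hgn⟩ := H f₀ hf₀
    obtain ⟨b, f, hf, hb⟩ := hg.exists_maximal (by linarith) hgi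
    refine ⟨b, f, hf, (1 - x) / 2, ⟨by linarith, by linarith⟩, ?_⟩
    have hgf := (hf.maximal _ g hg hgi).2 ((1 - x) / 2) ⟨by linarith, by linarith⟩
    have hsub : f ((1 - x) / 2) '' ball (0 : ℂ) 1 ⊆ closedBall 0 (2 * Real.sqrt x) := by
      rintro _ ⟨z, hz, rfl⟩
      have hz' := ball_subset_closedBall hz
      have := hgn ((1 - x) / 2) ⟨by linarith, by linarith⟩ z hz'
      rw [hgf hz', show 1 - 2 * ((1 - x) / 2) = x by ring] at this
      exact mem_closedBall_zero_iff.2 this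
    rw [hf.initial.image_eq]
    calc volume (f ((1 - x) / 2) '' ball (0 : ℂ) 1)
        ≤ volume (closedBall (0 : ℂ) (2 * Real.sqrt x)) := measure_mono hsub
      _ = ENNReal.ofReal (4 * x * Real.pi) := by
          rw [Complex.volume_closedBall, ← ENNReal.ofReal_pow (by positivity), mul_pow,
            Real.sq_sqrt hx0.le, ENNReal.ofReal_mul (by positivity),
            ENNReal.ofReal_mul (by positivity), ENNReal.ofReal_mul (by positivity)]
          norm_num [← ENNReal.ofReal_coe_nnreal]
      _ ≤ ENNReal.ofReal (ε * ((1 / 8) ^ 2 * Real.pi)) := by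
          refine ENNReal.ofReal_le_ofReal ?_
          nlinarith [Real.pi_pos]
      _ = ENNReal.ofReal ε * volume (ball (0 : ℂ) (1 / 8)) := by
          rw [Complex.volume_ball, ← ENNReal.ofReal_pow (by positivity), ENNReal.ofReal_mul hε.le,
            ENNReal.ofReal_mul (by positivity)]
          norm_num [← ENNReal.ofReal_coe_nnreal]
      _ ≤ ENNReal.ofReal ε * volume (f₀ '' ball (0 : ℂ) 1) := by gcongr
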